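/- **Setting.** Let $L>0$, let $F:\mathbb R^d\to\mathbb R^d$ be $L$-Lipschitz and $G:\mathbb R^d\rightrightarrows\mathbb R^d$ maximally monotone. Let $x^\star$ satisfy $0\in F(x^\star)+G(x^\star)$ and, for some $\rho>0$, the weak Minty variational inequality $\langle u,x-x^\star\rangle\ge-\rho\|u\|^2$ for all $x$ and all $u\in F(x)+G(x)$. A stochastic oracle $\widetilde F$ returns at each queried point $x$, with a fresh independent seed, a sample with $\mathbb E[\widetilde F(x)]=F(x)$ and $\mathbb E\|\widetilde F(x)-F(x)\|^2\le\sigma^2$. Let $\rho<\eta<1/L$, $\alpha=1-\rho/\eta$, $\mu=1-\eta L$, $L_B=1+\eta L$, and let $J_A=(\mathrm{Id}+A)^{-1}$ denote the resolvent of $A$. **Algorithm.** From $x_0\in\mathbb R^d$, for $k=0,1,\dots$ put $$\alpha_k=\frac{\alpha}{\sqrt{k+2}\,\log(k+3)},\qquad N_k=\left\lceil\frac{96\,\mu^{-2}}{\min\{\frac{\alpha_k}{120\alpha(k+1)},\frac1{120}\}}\right\rceil,\qquad M_k=\left\lceil\frac{672\cdot120\,\log_2N_k}{\mu^2}\right\rceil,$$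 and $x_{k+1}=(1-\alpha_k)x_k+\frac{\alpha_k}{M_k}\sum_{m=1}^{M_k}\widetilde J^{(m)}$, where $\widetilde J^{(1)},\dots,\widetilde J^{(M_k)}$ are independent copies of the following estimator: draw $I$ with $\Pr(I=i)=2^{-i}$, $i\ge1$; the estimator is $y^0+2^I(y^I-y^{I-1})$ if $2^I\le N_k$, and $y^0$ otherwise. Here $y^i$ is the result of $2^i$ iterations of stochastic forward-backward-forward (FBF) started at $z_0=x_k$, with seeds independent of $I$ and of the other runs: with $\tau_t=\frac{2}{(t+1)\mu+6L_B}$ and $\widetilde B(z)=z+\eta\widetilde F(z)-x_k$, $$z_{t+1/2}=J_{\tau_t\eta G}(z_t-\tau_t\widetilde B(z_t)),\qquad z_{t+1}=z_{t+1/2}+\tau_t\widetilde B(z_t)-\tau_t\widetilde B(z_{t+1/2}),$$ where the same sample $\widetilde B(z_t)$ is used in both formulas. Thus each FBF iteration makes two oracle calls and one resolvent call (the resolvent of a multiple of $G$). **Theorem.** The resolvents $J_{\eta(F+G)}$ and $J_{cG}$, $c>0$, are single-valued and defined on all of $\mathbb R^d$, and the following hold. 1. (Rate.) For every $K\ge1$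 and $x^{\mathrm{out}}$ uniform among $x_0,\dots,x_{K-1}$ (index independent of the run), $$\mathbb E\|(\mathrm{Id}-J_{\eta(F+G)})(x^{\mathrm{out}})\|^2\le\frac{64\left(\|x_0-x^\star\|^2+\alpha^2\eta^2\sigma^2\right)\log(K+3)}{\alpha^2\sqrt K}.$$ 2. (Cost per iteration.) There is a constant $C$ depending only on $\eta$ and $L$ such that iteration $k$ makes, in expectation, at most $C\log^2(k+2)$ oracle calls and at most $C\log^2(k+2)$ resolvent calls, for every $k\ge0$. 3. (Total complexity.) For every $D$ there are a constant $C'$ and a map $\varepsilon\mapsto K(\varepsilon)\ge1$, depending only on $\eta,L,\rho,\sigma,D$, such that whenever $\|x_0-x^\star\|\le D$: for every $\varepsilon>0$, running $K=K(\varepsilon)$ iterations gives $\mathbb E\|(\mathrm{Id}-J_{\eta(F+G)})(x^{\mathrm{out}})\|\le\varepsilon$ and $\eta^{-1}\mathbb E\|(\mathrm{Id}-J_{\eta(F+G)})(x^{\mathrm{out}})\|\le\varepsilon$; and for $0<\varepsilon\le1$ the expected total numbers of oracle calls and of resolvent calls are each at most $C'\varepsilon^{-4}(1+\log(1/\varepsilon))^4$,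 i.e. $\widetilde O(\varepsilon^{-4})$. -/

import Mathlib

open MeasureTheory ProbabilityTheory
open scoped NNReal RealInnerProductSpace

noncomputable section

namespace StochKM

/-! ### Set-valued operators -/

section Operators

variable {E : Type*} [NormedAddCommGroup E] [InnerProductSpace ℝ E]

/-- The operator `F + G` for single-valued `F` and set-valued `G`. -/
def opAdd (F : E → E) (G : E → Set E) : E → Set E :=
  fun x => {w | ∃ u ∈ G x, w = F x + u}

/-- The operator `c A`. -/
def opSmul (c : ℝ) (A : E → Set E) : E → Set E :=
  fun x => {w | ∃ u ∈ A x, w = c • u}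

/-- Monotonicity of a set-valued operator. -/
def IsMonotoneOp (A : E → Set E) : Prop :=
  ∀ x y : E, ∀ u ∈ A x, ∀ v ∈ A y, 0 ≤ ⟪u - v, x - y⟫

/-- Maximal monotonicity: the graph is not strictly contained in the graph of another monotone
operator. -/
def IsMaximalMonotone (A : E → Set E) : Prop :=
  IsMonotoneOp A ∧ ∀ B : E → Set E, IsMonotoneOp B → (∀ x, A x ⊆ B x) → B = A

/-- The set-valued resolvent `(Id + A)⁻¹`. -/
def resolventValues (A : E → Set E) (x : E) : Set E :=
  {y | ∃ u ∈ A y, x = y + u}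

open Classical in
/-- The resolvent `(Id + A)⁻¹` as a map: an element of `resolventValues A x`. This is used for
operators whose resolvent is everywhere defined and single-valued (the value where the resolvent
set is empty is a placeholder). -/
def resolventMap (A : E → Set E) (x : E) : E :=
  if h : (resolventValues A x).Nonempty then h.some else x

/-- `xs` is a solution of `0 ∈ (F + G)(x)`. -/
def IsSolution (F : E → E) (G : E → Set E) (xs : E) : Prop :=
  (0 : E) ∈ opAdd F G xs

/-- The weak Minty variational inequality with parameter `ρ` holds at `xs`. -/
def WeakMVI (ρ : ℝ) (F : E → E) (G : E → Set E) (xs : E) : Prop :=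
  ∀ x : E, ∀ u ∈ opAdd F G x, -ρ * ‖u‖ ^ 2 ≤ ⟪u, x - xs⟫

end Operators

/-! ### Randomness -/

/-- `Ft x s` is the answer of the stochastic first-order oracle at the point `x` with random seed
`s ∼ ν`: it is unbiased for `F x` and has variance at most `σ ^ 2`. -/
structure IsStochasticOracle {E Ξ : Type*} [NormedAddCommGroup E] [InnerProductSpace ℝ E]
    [MeasurableSpace E] [MeasurableSpace Ξ] (Ft : E → Ξ → E) (ν : Measure Ξ) (F : E → E)
    (σ : ℝ) : Prop where
  measurable : Measurable (Function.uncurry Ft)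
  integrable : ∀ x, Integrable (fun s => Ft x s) ν
  unbiased : ∀ x, ∫ s, Ft x s ∂ν = F x
  integrable_sq : ∀ x, Integrable (fun s => ‖Ft x s - F x‖ ^ 2) ν
  variance_le : ∀ x, ∫ s, ‖Ft x s - F x‖ ^ 2 ∂ν ≤ σ ^ 2

/-- Label of an oracle call: outer iteration `k`, copy `m` of the multilevel estimator, level `i`
(the run of the inner solver that computes `y ^ i`), inner iteration `t`, and whether the call is
made at `z_t` (`half = false`) or at `z_{t + 1/2}` (`half = true`). -/
structure SeedIndex where
  iter : ℕ
  copy : ℕ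
  level : ℕ
  step : ℕ
  half : Bool

/-- All random draws of the algorithm: the seeds `ξ j` are distributed as `ν`, the levels
`I (k, m)` are geometric with parameter `1/2` on `{1, 2, …}`, and all of these random variables are
mutually independent. -/
structure IsSampling {Ξ Ω : Type*} [MeasurableSpace Ξ] [MeasurableSpace Ω] (P : Measure Ω)
    (ν : Measure Ξ) (ξ : SeedIndex → Ω → Ξ) (I : ℕ × ℕ → Ω → ℕ) : Prop where
  measurable_seed : ∀ j, Measurable (ξ j)
  measurable_level : ∀ j, Measurable (I j)
  law_seed : ∀ j, P.map (ξ j) = ν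
  law_level : ∀ j, ∀ i : ℕ, P {ω | I j ω = i + 1} = (1 / 2) ^ (i + 1)
  indep_seed : iIndepFun ξ P
  indep_level : iIndepFun I P
  indep_seed_level : IndepFun (fun ω j => ξ j ω) (fun ω j => I j ω) P

/-- `X` is integrable and `𝔼[X] ≤ c`. -/
def ExpectationLE {Ω : Type*} [MeasurableSpace Ω] (P : Measure Ω) (X : Ω → ℝ) (c : ℝ) : Prop :=
  Integrable X P ∧ ∫ ω, X ω ∂P ≤ c

/-! ### The algorithm, with counters for its oracle calls -/

/-- A point together with the numbers of calls to the stochastic oracle and to the resolvent of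
(a multiple of) `G` that were made to compute it. -/
structure Run (E : Type*) where
  point : E
  oracleCalls : ℕ
  resolventCalls : ℕ

section Algorithm

variable {E Ξ : Type*} [NormedAddCommGroup E] [InnerProductSpace ℝ E]

/-- `T` iterations of the stochastic forward-backward-forward method for `A + B`, started from
`z₀`, where `B = B_in - z₀` and `B_in` is accessed through the oracle `Bin`. The step size is
`τ_t = 2 / ((t + 1) μ + 6 L_B)`. Iteration `t` evaluates the oracle at `z_t` with seed
`seed t false`, the resolvent of `τ_t A` once, and the oracle at `z_{t + 1/2}` with seed
`seed t true`. -/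
def fbf (μ LB : ℝ) (A : E → Set E) (Bin : E → Ξ → E) (z₀ : E) (seed : ℕ → Bool → Ξ) :
    ℕ → Run E
  | 0 => ⟨z₀, 0, 0⟩
  | t + 1 =>
    let r := fbf μ LB A Bin z₀ seed t
    let z := r.point
    let τ : ℝ := 2 / (((t : ℝ) + 1) * μ + 6 * LB)
    let b := Bin z (seed t false) - z₀
    let zh := resolventMap (opSmul τ A) (z - τ • b)
    let bh := Bin zh (seed t true) - z₀
    ⟨zh + τ • b - τ • bh, r.oracleCalls + 2, r.resolventCalls + 1⟩

/-- The multilevel Monte Carlo estimator built on `fbf`: with `y i` the result of `2 ^ i`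
iterations of `fbf` (on its own seeds `seed i`) and with drawn level `I`, it is
`y 0 + 2 ^ I (y I - y (I - 1))` if `2 ^ I ≤ N`, and `y 0` otherwise. -/
def mlmcFbf (μ LB : ℝ) (A : E → Set E) (Bin : E → Ξ → E) (z₀ : E) (N : ℕ) (I : ℕ)
    (seed : ℕ → ℕ → Bool → Ξ) : Run E :=
  let y : ℕ → Run E := fun i => fbf μ LB A Bin z₀ (seed i) (2 ^ i)
  if 2 ^ I ≤ N then
    ⟨(y 0).point + (2 ^ I : ℝ) • ((y I).point - (y (I - 1)).point),
      (y 0).oracleCalls + (y I).oracleCalls + (y (I - 1)).oracleCalls,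
      (y 0).resolventCalls + (y I).resolventCalls + (y (I - 1)).resolventCalls⟩
  else y 0

/-- `α = 1 - ρ / η`. -/
def relax (η ρ : ℝ) : ℝ := 1 - ρ / η

/-- `α_k = α / (√(k + 2) log (k + 3))`. -/
def stepSize (η ρ : ℝ) (k : ℕ) : ℝ :=
  relax η ρ / (√((k : ℝ) + 2) * Real.log ((k : ℝ) + 3))

/-- `N_k = ⌈96 (1 - η L)⁻² / min {α_k / (120 α (k + 1)), 1 / 120}⌉`. -/
def levelCap (L η ρ : ℝ) (k : ℕ) : ℕ :=
  ⌈96 * ((1 - η * L) ^ 2)⁻¹ /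
    min (stepSize η ρ k / (120 * relax η ρ * ((k : ℝ) + 1))) (1 / 120)⌉₊

/-- `M_k = ⌈672 · 120 · log₂ N_k / (1 - η L)²⌉`. -/
def batchSize (L η ρ : ℝ) (k : ℕ) : ℕ :=
  ⌈672 * 120 * Real.logb 2 (levelCap L η ρ k) / (1 - η * L) ^ 2⌉₊

/-- The estimate of `J_{η(F+G)}(x)` used in iteration `k`: the average of `M_k` copies of the
multilevel estimator with `A = η G`, `B_in = Id + η Ft`, `L_B = 1 + η L`, `μ = 1 - η L`. -/
def estimate (L η ρ : ℝ) (G : E → Set E) (Ft : E → Ξ → E) (ξ : SeedIndex → Ξ) (I : ℕ × ℕ → ℕ)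
    (k : ℕ) (x : E) : Run E :=
  let M := batchSize L η ρ k
  let J : ℕ → Run E := fun m =>
    mlmcFbf (1 - η * L) (1 + η * L) (opSmul η G) (fun z s => z + η • Ft z s) x
      (levelCap L η ρ k) (I (k, m)) (fun i t h => ξ ⟨k, m, i, t, h⟩)
  ⟨(M : ℝ)⁻¹ • ∑ m ∈ Finset.range M, (J m).point,
    ∑ m ∈ Finset.range M, (J m).oracleCalls,
    ∑ m ∈ Finset.range M, (J m).resolventCalls⟩

/-- The inexact Krasnosel'skii-Mann iteration
`x_{k+1} = (1 - α_k) x_k + α_k · estimate of J_{η(F+G)}(x_k)`. The counters of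
`km … k` count all calls made in iterations `0, …, k - 1`. -/
def km (L η ρ : ℝ) (G : E → Set E) (Ft : E → Ξ → E) (x₀ : E) (ξ : SeedIndex → Ξ)
    (I : ℕ × ℕ → ℕ) : ℕ → Run E
  | 0 => ⟨x₀, 0, 0⟩
  | k + 1 =>
    let r := km L η ρ G Ft x₀ ξ I k
    let e := estimate L η ρ G Ft ξ I k r.point
    ⟨(1 - stepSize η ρ k) • r.point + stepSize η ρ k • e.point,
      r.oracleCalls + e.oracleCalls, r.resolventCalls + e.resolventCalls⟩

end Algorithm

section RandomRun

variable {E Ξ Ω : Type*} [NormedAddCommGroup E] [InnerProductSpace ℝ E]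

/-- The random state of the algorithm after `k` iterations: the iterate `x_k` and the numbers of
calls made in iterations `0, …, k - 1`. -/
def run (L η ρ : ℝ) (G : E → Set E) (Ft : E → Ξ → E) (x₀ : E) (ξ : SeedIndex → Ω → Ξ)
    (I : ℕ × ℕ → Ω → ℕ) (k : ℕ) (ω : Ω) : Run E :=
  km L η ρ G Ft x₀ (fun j => ξ j ω) (fun j => I j ω) k

/-- The random estimate of `J_{η(F+G)}(x_k)` computed in iteration `k`, with the numbers of calls
made in that iteration. -/
def iteration (L η ρ : ℝ) (G : E → Set E) (Ft : E → Ξ → E) (x₀ : E) (ξ : SeedIndex → Ω → Ξ)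
    (I : ℕ × ℕ → Ω → ℕ) (k : ℕ) (ω : Ω) : Run E :=
  estimate L η ρ G Ft (fun j => ξ j ω) (fun j => I j ω) k (run L η ρ G Ft x₀ ξ I k ω).point

/-- The output `x_κ` of the algorithm for the index `κ = q.1` and the outcome `ω = q.2`. -/
def xout (L η ρ : ℝ) (G : E → Set E) (Ft : E → Ξ → E) (x₀ : E) (ξ : SeedIndex → Ω → Ξ)
    (I : ℕ × ℕ → Ω → ℕ) (q : ℕ × Ω) : E :=
  (run L η ρ G Ft x₀ ξ I q.1 q.2).point

/-- The norm `‖(Id - J_{η(F+G)})(x)‖` of the fixed-point residual. -/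
def fpResidual (η : ℝ) (F : E → E) (G : E → Set E) (x : E) : ℝ :=
  ‖x - resolventMap (opSmul η (opAdd F G)) x‖

end RandomRun

/-- Joint law of a uniform index in `{0, …, K - 1}` and an independent outcome of the algorithm. -/
def withUniformIndex {Ω : Type*} [MeasurableSpace Ω] (K : ℕ) (P : Measure Ω) :
    Measure (ℕ × Ω) :=
  (uniformOn (Set.Iio K)).prod P

end StochKM

end

open StochKM

/-!
Write `J = J_{η(F+G)}`. The weak Minty inequality gives `α ‖x - J x‖² ≤ ⟪x - J x, x - x⋆⟫`, so a
relaxed step of length `α_k ≤ α` towards `J x` decreases `‖x - x⋆‖²` by `α α_k ‖x - J x‖²`. The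
point `J x` solves a strongly monotone Lipschitz inclusion, for which `T` steps of stochastic
forward-backward-forward have mean-square error `O(1 / T)`. The multilevel estimator, whose level
is geometric, has the small bias of the finest level `N_k` at an expected cost of only `O(log N_k)`,
and averaging `M_k` copies controls its variance.

The bias enters one step through an inner product, which Young's inequality turns into a relative
growth `1 + w_k` of the distance, with `w_k = α_k / (α (k + 1))`. Since `∑ w_k` and `∑ α_k²`
converge, a discrete Grönwall inequality bounds `∑ α_k 𝔼 ‖x_k - J x_k‖²`. As `∑_{k < K} α_k` is of
order at least `√K / log K`, this is the rate; the costs follow from `log N_k = O(log (k + 2))`.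
-/

noncomputable section

namespace StochKM

/-! ### Monotone operators and resolvents -/

section Minty

variable {E : Type*} [NormedAddCommGroup E] [InnerProductSpace ℝ E]

theorem inner_sum_smul_le_sum_mul_inner {ι : Type*} [Fintype ι] {a u : ι → E}
    (hmono : ∀ i j, 0 ≤ ⟪u i - u j, a i - a j⟫) {w : ι → ℝ} (hw : w ∈ stdSimplex ℝ ι) :
    ⟪∑ i, w i • u i, ∑ i, w i • a i⟫ ≤ ∑ i, w i * ⟪u i, a i⟫ := by
  have hsum : 0 ≤ ∑ i, ∑ j, w i * w j * ⟪u i - u j, a i - a j⟫ :=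
    Finset.sum_nonneg fun i _ => Finset.sum_nonneg fun j _ =>
      mul_nonneg (mul_nonneg (hw.1 i) (hw.1 j)) (hmono i j)
  have hexpand : ∀ i, ∑ j, w i * w j * ⟪u i - u j, a i - a j⟫ =
      w i * ⟪u i, a i⟫ - ⟪w i • u i, ∑ j, w j • a j⟫ - ⟪∑ j, w j • u j, w i • a i⟫ +
        w i * ∑ j, w j * ⟪u j, a j⟫ := by
    intro i
    have hconst : w i * ⟪u i, a i⟫ = ∑ j, w j * (w i * ⟪u i, a i⟫) := by
      rw [← Finset.sum_mul, hw.2, one_mul]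
    rw [hconst, inner_sum, sum_inner, Finset.mul_sum, ← Finset.sum_sub_distrib,
      ← Finset.sum_sub_distrib, ← Finset.sum_add_distrib]
    refine Finset.sum_congr rfl fun j _ => ?_
    simp only [inner_sub_left, inner_sub_right, real_inner_smul_left, real_inner_smul_right]
    ring
  simp only [hexpand, Finset.sum_add_distrib, Finset.sum_sub_distrib, ← sum_inner, ← inner_sum,
    ← Finset.sum_mul, hw.2] at hsum
  linarith

-- First-order optimality for the convex function `w ↦ ∑ w j * b j + ‖∑ w j • c j‖ ^ 2`.
theorem exists_mem_stdSimplex_forall_sum_add_norm_sq_le {ι : Type*} [Fintype ι] [Nonempty ι]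
    (b : ι → ℝ) (c : ι → E) :
    ∃ w ∈ stdSimplex ℝ ι, ∀ i,
      ∑ j, w j * b j + 2 * ‖∑ j, w j • c j‖ ^ 2 ≤ b i + 2 * ⟪∑ j, w j • c j, c i⟫ := by
  classical
  let ℓ : (ι → ℝ) →L[ℝ] ℝ := (Fintype.linearCombination ℝ b).toContinuousLinearMap
  let T : (ι → ℝ) →L[ℝ] E := (Fintype.linearCombination ℝ c).toContinuousLinearMap
  obtain ⟨w, hw, hmin⟩ := (isCompact_stdSimplex (𝕜 := ℝ) ι).exists_isMinOn
    ⟨_, single_mem_stdSimplex ℝ (Classical.arbitrary ι)⟩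
    (f := fun v => ℓ v + ‖T v‖ ^ 2) (by fun_prop)
  refine ⟨w, hw, fun i => ?_⟩
  have hderiv := hmin.localize.hasFDerivWithinAt_nonneg
    (ℓ.hasFDerivAt.add T.hasFDerivAt.norm_sq).hasFDerivWithinAt
    (sub_mem_posTangentConeAt_of_segment_subset
      ((convex_stdSimplex ℝ ι).segment_subset hw (single_mem_stdSimplex ℝ i)))
  have hℓ : ∀ v, ℓ v = ∑ j, v j * b j := fun v => Fintype.linearCombination_apply ℝ b v
  have hT : ∀ v, T v = ∑ j, v j • c j := fun v => Fintype.linearCombination_apply ℝ c v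
  have hℓi : ℓ (Pi.single i 1) = b i := by simp [hℓ, Pi.single_apply]
  have hTi : T (Pi.single i 1) = c i := by simp [hT, Pi.single_apply]
  have hderiv' : 0 ≤ ℓ (Pi.single i 1 - w) + 2 * ⟪T w, T (Pi.single i 1 - w)⟫ := by
    simpa using hderiv
  rw [map_sub, map_sub, hℓi, hTi, inner_sub_right, real_inner_self_eq_norm_sq] at hderiv'
  rw [← hℓ, ← hT]
  linarith

-- The finite case of the Debrunner-Flor lemma.
theorem exists_forall_zero_le_inner_add_sub {ι : Type*} [Finite ι] {a u : ι → E}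
    (hmono : ∀ i j, 0 ≤ ⟪u i - u j, a i - a j⟫) : ∃ y : E, ∀ i, 0 ≤ ⟪u i + y, a i - y⟫ := by
  cases nonempty_fintype ι
  rcases isEmpty_or_nonempty ι with _ | _
  · exact ⟨0, fun i => isEmptyElim i⟩
  obtain ⟨w, hw, hopt⟩ := exists_mem_stdSimplex_forall_sum_add_norm_sq_le
    (fun i => ⟪u i, a i⟫) (fun i => (1 / 2 : ℝ) • (a i - u i))
  set y : E := ∑ j, w j • (1 / 2 : ℝ) • (a j - u j)
  refine ⟨y, fun i => ?_⟩
  have hy : y = (1 / 2 : ℝ) • (∑ j, w j • a j - ∑ j, w j • u j) := by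
    simp only [y, Finset.smul_sum, ← Finset.sum_sub_distrib, smul_comm (w _), smul_sub]
  have hvalue : 0 ≤ ∑ j, w j * ⟪u j, a j⟫ + ‖y‖ ^ 2 := by
    have hpolar : ‖y‖ ^ 2 + ⟪∑ j, w j • u j, ∑ j, w j • a j⟫ =
        1 / 4 * ‖∑ j, w j • a j + ∑ j, w j • u j‖ ^ 2 := by
      rw [hy, norm_smul, mul_pow, norm_sub_sq_real, norm_add_sq_real,
        real_inner_comm (∑ j, w j • a j)]
      norm_num
      ring
    have := inner_sum_smul_le_sum_mul_inner hmono hw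
    have : 0 ≤ 1 / 4 * ‖∑ j, w j • a j + ∑ j, w j • u j‖ ^ 2 := by positivity
    linarith
  have hexpand : ⟪u i + y, a i - y⟫ =
      ⟪u i, a i⟫ + 2 * ⟪y, (1 / 2 : ℝ) • (a i - u i)⟫ - ‖y‖ ^ 2 := by
    simp only [inner_add_left, inner_sub_right, inner_smul_right, real_inner_self_eq_norm_sq,
      real_inner_comm y (u i)]
    ring
  rw [hexpand]
  linarith [hopt i]

-- Closed balls of a Hilbert space are weakly compact.
theorem nonempty_iInter_closedBall [CompleteSpace E] {ι : Type*} {c : ι → E} {r : ι → ℝ}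
    (hfin : ∀ s : Finset ι, (⋂ i ∈ s, Metric.closedBall (c i) (r i)).Nonempty) :
    (⋂ i, Metric.closedBall (c i) (r i)).Nonempty := by
  classical
  rcases isEmpty_or_nonempty ι with _ | ⟨⟨i₀⟩⟩
  · simp
  let B : ι → Set (WeakDual ℝ E) := fun i =>
    WeakDual.toStrongDual ⁻¹' Metric.closedBall (InnerProductSpace.toDual ℝ E (c i)) (r i)
  have hB : ∀ i y, StrongDual.toWeakDual (InnerProductSpace.toDual ℝ E y) ∈ B i ↔
      y ∈ Metric.closedBall (c i) (r i) := fun i y => by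
    simp only [B, Set.mem_preimage, Metric.mem_closedBall]
    exact iff_of_eq (congrArg (· ≤ r i) ((InnerProductSpace.toDual ℝ E).dist_map y (c i)))
  obtain ⟨f, -, hf⟩ := (WeakDual.isCompact_closedBall _ _ : IsCompact (B i₀)).inter_iInter_nonempty
    B (fun i => WeakDual.isClosed_closedBall _ _) fun s => by
      obtain ⟨y, hy⟩ := hfin (insert i₀ s)
      simp only [Set.mem_iInter, Finset.mem_insert] at hy
      exact ⟨_, (hB i₀ y).2 (hy i₀ (Or.inl rfl)),
        Set.mem_iInter₂.2 fun i hi => (hB i y).2 (hy i (Or.inr hi))⟩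
  refine ⟨(InnerProductSpace.toDual ℝ E).symm (WeakDual.toStrongDual f), ?_⟩
  refine Set.mem_iInter.2 fun i => (hB i _).1 ?_
  rw [LinearIsometryEquiv.apply_symm_apply]
  exact Set.mem_iInter.1 hf i

theorem zero_le_inner_add_sub_iff_mem_closedBall {a v y : E} :
    0 ≤ ⟪v + y, a - y⟫ ↔
      y ∈ Metric.closedBall ((1 / 2 : ℝ) • (a - v)) ‖(1 / 2 : ℝ) • (a + v)‖ := by
  have hexpand : ⟪v + y, a - y⟫ =
      ‖(1 / 2 : ℝ) • (a + v)‖ ^ 2 - ‖y - (1 / 2 : ℝ) • (a - v)‖ ^ 2 := by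
    rw [norm_sub_sq_real, inner_smul_right, norm_smul, norm_smul, mul_pow, mul_pow,
      norm_add_sq_real, norm_sub_sq_real, inner_sub_right, inner_sub_right, inner_add_left,
      inner_add_left, real_inner_self_eq_norm_sq, real_inner_comm v a, real_inner_comm v y]
    norm_num
    ring
  rw [hexpand, sub_nonneg, sq_le_sq₀ (norm_nonneg _) (norm_nonneg _), mem_closedBall_iff_norm]

theorem IsMonotoneOp.exists_forall_zero_le_inner [CompleteSpace E] {A : E → Set E}
    (hA : IsMonotoneOp A) (x : E) : ∃ y : E, ∀ a, ∀ u ∈ A a, 0 ≤ ⟪u - (x - y), a - y⟫ := by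
  let Graph := {p : E × E // p.2 ∈ A p.1}
  have hshift : ∀ u y : E, u - (x - y) = u - x + y := fun u y => by abel
  have hball := nonempty_iInter_closedBall (ι := Graph)
    (c := fun p => (1 / 2 : ℝ) • (p.1.1 - (p.1.2 - x)))
    (r := fun p => ‖(1 / 2 : ℝ) • (p.1.1 + (p.1.2 - x))‖) fun s => by
      obtain ⟨y, hy⟩ := exists_forall_zero_le_inner_add_sub (ι := s)
        (a := fun p => p.1.1.1) (u := fun p => p.1.1.2 - x) fun p q => by
          simpa only [sub_sub_sub_cancel_right] using
            hA p.1.1.1 q.1.1.1 p.1.1.2 p.1.2 q.1.1.2 q.1.2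
      exact ⟨y, Set.mem_iInter₂.2 fun p hp =>
        zero_le_inner_add_sub_iff_mem_closedBall.1 (hy ⟨p, hp⟩)⟩
  obtain ⟨y, hy⟩ := hball
  refine ⟨y, fun a u hu => ?_⟩
  rw [hshift]
  exact zero_le_inner_add_sub_iff_mem_closedBall.2 (Set.mem_iInter.1 hy ⟨(a, u), hu⟩)

end Minty

section Resolvent

variable {E : Type*} [NormedAddCommGroup E]

theorem resolventMap_mem_resolventValues {A : E → Set E} {x : E}
    (h : (resolventValues A x).Nonempty) : resolventMap A x ∈ resolventValues A x := by
  rw [resolventMap, dif_pos h]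
  exact h.some_mem

theorem opAdd_eq_image (F : E → E) (G : E → Set E) (x : E) : opAdd F G x = (F x + ·) '' G x := by
  ext w
  simp only [opAdd, Set.mem_ofPred_eq, Set.mem_image, eq_comm]

variable [InnerProductSpace ℝ E] {A G : E → Set E} {F : E → E} {L : ℝ≥0} {c η ρ : ℝ}
  {x x' y y' xs : E}

theorem opSmul_eq_image (c : ℝ) (A : E → Set E) (x : E) : opSmul c A x = (c • ·) '' A x := by
  ext w
  simp only [opSmul, Set.mem_ofPred_eq, Set.mem_image, eq_comm]

theorem mem_resolventValues_opSmul :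
    y ∈ resolventValues (opSmul c A) x ↔ ∃ u ∈ A y, x = y + c • u := by
  simp only [resolventValues, Set.mem_ofPred_eq, opSmul_eq_image, Set.exists_mem_image]

theorem mem_resolventValues_opSmul_opAdd :
    y ∈ resolventValues (opSmul c (opAdd F A)) x ↔ ∃ u ∈ A y, x = y + c • (F y + u) := by
  simp only [mem_resolventValues_opSmul, opAdd_eq_image, Set.exists_mem_image]

theorem mem_resolventValues_opSmul_opAdd_iff_sub :
    y ∈ resolventValues (opSmul c (opAdd F A)) x ↔
      y ∈ resolventValues (opSmul c A) (x - c • F y) := by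
  rw [mem_resolventValues_opSmul_opAdd, mem_resolventValues_opSmul]
  simp only [smul_add, sub_eq_iff_eq_add', add_left_comm]

theorem opSmul_opSmul (a b : ℝ) (A : E → Set E) : opSmul a (opSmul b A) = opSmul (a * b) A := by
  ext x w
  simp only [opSmul_eq_image, Set.image_image, smul_smul]

theorem IsMonotoneOp.smul (hA : IsMonotoneOp A) (hc : 0 ≤ c) : IsMonotoneOp (opSmul c A) := by
  rintro x y _ ⟨u, hu, rfl⟩ _ ⟨v, hv, rfl⟩
  rw [← smul_sub, real_inner_smul_left]
  exact mul_nonneg hc (hA x y u hu v hv)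

theorem IsMonotoneOp.norm_sub_le_of_mem_resolventValues (hA : IsMonotoneOp A)
    (h : y ∈ resolventValues A x)
    (h' : y' ∈ resolventValues A x') : ‖y - y'‖ ≤ ‖x - x'‖ := by
  obtain ⟨u, hu, rfl⟩ := h
  obtain ⟨v, hv, rfl⟩ := h'
  have hmono := hA y y' u hu v hv
  refine le_of_sq_le_sq ?_ (norm_nonneg _)
  rw [add_sub_add_comm, norm_add_sq_real, real_inner_comm]
  nlinarith [sq_nonneg ‖u - v‖]

theorem IsMonotoneOp.norm_sub_le_of_mem_resolventValues_opAdd (hG : IsMonotoneOp G)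
    (hF : LipschitzWith L F) (hη : 0 ≤ η)
    (h : y ∈ resolventValues (opSmul η (opAdd F G)) x)
    (h' : y' ∈ resolventValues (opSmul η (opAdd F G)) x') :
    (1 - η * L) * ‖y - y'‖ ≤ ‖x - x'‖ := by
  have hLip : η * ‖F y - F y'‖ ≤ η * (L * ‖y - y'‖) := by
    gcongr
    exact hF.norm_sub_le y y'
  have hnonexp : ‖y - y'‖ ≤ ‖x - x'‖ + η * ‖F y - F y'‖ := calc
    ‖y - y'‖ ≤ ‖x - η • F y - (x' - η • F y')‖ := (hG.smul hη).norm_sub_le_of_mem_resolventValues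
      (mem_resolventValues_opSmul_opAdd_iff_sub.1 h)
      (mem_resolventValues_opSmul_opAdd_iff_sub.1 h')
    _ ≤ ‖x - x'‖ + ‖η • F y - η • F y'‖ := by
      rw [sub_sub_sub_comm]
      exact norm_sub_le _ _
    _ = ‖x - x'‖ + η * ‖F y - F y'‖ := by
      rw [← smul_sub, norm_smul, Real.norm_of_nonneg hη]
  linarith

theorem IsMaximalMonotone.mem_of_forall {v : E} (hG : IsMaximalMonotone G)
    (h : ∀ a, ∀ u ∈ G a, 0 ≤ ⟪u - v, a - y⟫) : v ∈ G y := by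
  have hmono : IsMonotoneOp fun z => {w | w ∈ G z ∨ z = y ∧ w = v} := by
    rintro a b u (hu | ⟨rfl, rfl⟩) w (hw | ⟨rfl, rfl⟩)
    · exact hG.1 a b u hu w hw
    · exact h a u hu
    · rw [← neg_sub, ← neg_sub b, inner_neg_neg]
      exact h b w hw
    · simp
  rw [← hG.2 _ hmono fun x u hu => Or.inl hu]
  exact Or.inr ⟨rfl, rfl⟩

-- Under the weak Minty inequality the resolvent is conically nonexpansive towards `xs`.
theorem WeakMVI.relax_mul_norm_sub_sq_le (hW : WeakMVI ρ F G xs) (hη : 0 < η)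
    (hy : y ∈ resolventValues (opSmul η (opAdd F G)) x) :
    relax η ρ * ‖x - y‖ ^ 2 ≤ ⟪x - y, x - xs⟫ := by
  obtain ⟨g, hg, rfl⟩ := mem_resolventValues_opSmul_opAdd.1 hy
  have hminty := hW y (F y + g) ⟨g, hg, rfl⟩
  have hrelax : relax η ρ * (η * ‖F y + g‖) ^ 2 =
      (η * ‖F y + g‖) ^ 2 - η * (ρ * ‖F y + g‖ ^ 2) := by
    rw [relax]
    field_simp
  rw [add_sub_cancel_left, add_sub_right_comm, inner_add_right, real_inner_smul_left,
    real_inner_smul_left, inner_smul_right, real_inner_self_eq_norm_sq, norm_smul,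
    Real.norm_of_nonneg hη.le, hrelax]
  nlinarith

variable [CompleteSpace E]

theorem IsMaximalMonotone.existsUnique_mem_resolventValues (hG : IsMaximalMonotone G) (hc : 0 < c)
    (x : E) : ∃! y, y ∈ resolventValues (opSmul c G) x := by
  have hmono := hG.1.smul hc.le
  refine existsUnique_of_exists_of_unique ?_ fun y y' h h' => ?_
  · obtain ⟨y, hy⟩ := hmono.exists_forall_zero_le_inner x
    refine ⟨y, mem_resolventValues_opSmul.2
      ⟨c⁻¹ • (x - y), hG.mem_of_forall fun a u hu => ?_, ?_⟩⟩
    · refine nonneg_of_mul_nonneg_right ?_ hc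
      rw [← real_inner_smul_left, smul_sub, smul_inv_smul₀ hc.ne']
      exact hy a (c • u) ⟨u, hu, rfl⟩
    · rw [smul_inv_smul₀ hc.ne', add_sub_cancel]
  · simpa [sub_eq_zero] using hmono.norm_sub_le_of_mem_resolventValues h h'

theorem IsMaximalMonotone.resolventMap_mem (hG : IsMaximalMonotone G) (hc : 0 < c) (x : E) :
    resolventMap (opSmul c G) x ∈ resolventValues (opSmul c G) x :=
  resolventMap_mem_resolventValues (hG.existsUnique_mem_resolventValues hc x).exists

theorem IsMaximalMonotone.lipschitzWith_resolventMap (hG : IsMaximalMonotone G) (hc : 0 < c) :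
    LipschitzWith 1 (resolventMap (opSmul c G)) :=
  LipschitzWith.of_dist_le_mul fun x y => by
    rw [dist_eq_norm, dist_eq_norm, NNReal.coe_one, one_mul]
    exact (hG.1.smul hc.le).norm_sub_le_of_mem_resolventValues (hG.resolventMap_mem hc x)
      (hG.resolventMap_mem hc y)

-- A resolvent value of `η (F + G)` at `x` is a fixed point of `y ↦ J_{ηG} (x - η F y)`.
theorem IsMaximalMonotone.existsUnique_mem_resolventValues_opAdd (hG : IsMaximalMonotone G)
    (hF : LipschitzWith L F) (hη : 0 < η) (hηL : η * L < 1) (x : E) :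
    ∃! y, y ∈ resolventValues (opSmul η (opAdd F G)) x := by
  refine existsUnique_of_exists_of_unique ?_ fun y y' h h' => ?_
  · have hcontr : ContractingWith (η.toNNReal * L)
        fun y => resolventMap (opSmul η G) (x - η • F y) := by
      refine ⟨?_, LipschitzWith.of_dist_le_mul fun y y' => ?_⟩
      · rw [← NNReal.coe_lt_coe]
        simpa [hη.le] using hηL
      · refine ((hG.lipschitzWith_resolventMap hη).dist_le_mul _ _).trans ?_
        have := hF.dist_le_mul y y'
        rw [NNReal.coe_one, one_mul, dist_sub_left, dist_smul₀, Real.norm_of_nonneg hη.le,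
          NNReal.coe_mul, Real.coe_toNNReal _ hη.le, mul_assoc]
        gcongr
    refine ⟨hcontr.fixedPoint, mem_resolventValues_opSmul_opAdd_iff_sub.2 ?_⟩
    have hmem := hG.resolventMap_mem hη (x - η • F hcontr.fixedPoint)
    rwa [hcontr.fixedPoint_isFixedPt.eq] at hmem
  · have hle := hG.1.norm_sub_le_of_mem_resolventValues_opAdd hF hη.le h h'
    rw [sub_self, norm_zero] at hle
    exact sub_eq_zero.1 (norm_le_zero_iff.1
      (nonpos_of_mul_nonpos_right hle (sub_pos.2 hηL)))

theorem IsMaximalMonotone.resolventMap_opAdd_mem (hG : IsMaximalMonotone G)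
    (hF : LipschitzWith L F) (hη : 0 < η) (hηL : η * L < 1) (x : E) :
    resolventMap (opSmul η (opAdd F G)) x ∈ resolventValues (opSmul η (opAdd F G)) x :=
  resolventMap_mem_resolventValues (hG.existsUnique_mem_resolventValues_opAdd hF hη hηL x).exists

theorem IsMaximalMonotone.continuous_resolventMap_opAdd (hG : IsMaximalMonotone G)
    (hF : LipschitzWith L F) (hη : 0 < η) (hηL : η * L < 1) :
    Continuous (resolventMap (opSmul η (opAdd F G))) := by
  have hpos : 0 < 1 - η * L := by linarith
  refine (LipschitzWith.of_dist_le_mul (K := (1 - η * L)⁻¹.toNNReal) fun x y => ?_).continuous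
  rw [Real.coe_toNNReal _ (inv_nonneg.2 hpos.le), inv_mul_eq_div, le_div_iff₀ hpos, mul_comm,
    dist_eq_norm, dist_eq_norm]
  exact hG.1.norm_sub_le_of_mem_resolventValues_opAdd hF hη.le
    (hG.resolventMap_opAdd_mem hF hη hηL x) (hG.resolventMap_opAdd_mem hF hη hηL y)

end Resolvent

/-! ### Expectation bounds and independence -/

section ExpectationBounds

variable {Ω : Type*} [MeasurableSpace Ω] {P : Measure Ω} {f g : Ω → ℝ} {a b : ℝ}

theorem ExpectationLE.mono (h : ExpectationLE P f a) (hab : a ≤ b) : ExpectationLE P f b :=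
  ⟨h.1, h.2.trans hab⟩

theorem ExpectationLE.add (hf : ExpectationLE P f a) (hg : ExpectationLE P g b) :
    ExpectationLE P (fun ω => f ω + g ω) (a + b) :=
  ⟨hf.1.add hg.1, (integral_add hf.1 hg.1).trans_le (add_le_add hf.2 hg.2)⟩

theorem ExpectationLE.const_mul (hf : ExpectationLE P f a) {c : ℝ} (hc : 0 ≤ c) :
    ExpectationLE P (fun ω => c * f ω) (c * a) :=
  ⟨hf.1.const_mul c, (integral_const_mul c f).trans_le (mul_le_mul_of_nonneg_left hf.2 hc)⟩

theorem ExpectationLE.sum {ι : Type*} {s : Finset ι} {f : ι → Ω → ℝ} {a : ι → ℝ}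
    (h : ∀ i ∈ s, ExpectationLE P (f i) (a i)) :
    ExpectationLE P (fun ω => ∑ i ∈ s, f i ω) (∑ i ∈ s, a i) :=
  ⟨integrable_finsetSum s fun i hi => (h i hi).1,
    (integral_finsetSum s fun i hi => (h i hi).1).trans_le
      (Finset.sum_le_sum fun i hi => (h i hi).2)⟩

theorem expectationLE_const [IsProbabilityMeasure P] (c : ℝ) : ExpectationLE P (fun _ => c) c :=
  ⟨integrable_const c, by simp⟩

theorem ExpectationLE.of_nonneg_of_le (hg : ExpectationLE P g a) (hf : AEStronglyMeasurable f P)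
    (h0 : ∀ ω, 0 ≤ f ω) (hfg : ∀ ω, f ω ≤ g ω) : ExpectationLE P f a := by
  have hfi : Integrable f P := hg.1.mono' hf <| Filter.Eventually.of_forall fun ω => by
    simpa only [Real.norm_of_nonneg (h0 ω)] using hfg ω
  exact ⟨hfi, (integral_mono hfi hg.1 hfg).trans hg.2⟩

theorem ExpectationLE.of_sq [IsProbabilityMeasure P]
    (h : ExpectationLE P (fun ω => f ω ^ 2) (a ^ 2)) (hf : AEStronglyMeasurable f P)
    (h0 : ∀ ω, 0 ≤ f ω) (ha : 0 < a) : ExpectationLE P f a := by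
  have young : ∀ ω, f ω ≤ a / 2 + (2 * a)⁻¹ * f ω ^ 2 := fun ω => by
    have heq : a / 2 + (2 * a)⁻¹ * f ω ^ 2 - f ω = (f ω - a) ^ 2 / (2 * a) := by
      field_simp
      ring
    have : 0 ≤ (f ω - a) ^ 2 / (2 * a) := by positivity
    linarith
  refine (((expectationLE_const (a / 2)).add
    (h.const_mul (by positivity : 0 ≤ (2 * a)⁻¹))).of_nonneg_of_le hf h0 young).mono
    (le_of_eq ?_)
  field_simp
  ring

theorem ExpectationLE.comp_measurePreserving {Ξ : Type*} [MeasurableSpace Ξ] {ν : Measure Ξ}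
    {f : Ξ → ℝ} (h : ExpectationLE ν f a) {s : Ω → Ξ} (hs : MeasurePreserving s P ν) :
    ExpectationLE P (fun ω => f (s ω)) a := by
  refine ⟨hs.integrable_comp_of_integrable h.1, le_trans (le_of_eq ?_) h.2⟩
  rw [← hs.map_eq, integral_map hs.measurable.aemeasurable]
  exact hs.map_eq ▸ h.1.aestronglyMeasurable

/-- Conditioning on `X`, which fixes it in the expectation, as a form of Fubini's theorem. -/
theorem ExpectationLE.of_indepFun {𝒳 𝒴 : Type*} [MeasurableSpace 𝒳] [MeasurableSpace 𝒴]
    [IsProbabilityMeasure P] {X : Ω → 𝒳} {Y : Ω → 𝒴} (hXY : IndepFun X Y P) (hX : Measurable X)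
    (hY : Measurable Y) {h : 𝒳 → 𝒴 → ℝ} (hm : Measurable (Function.uncurry h))
    (h0 : ∀ x y, 0 ≤ h x y) {φ : 𝒳 → ℝ} (hφm : Measurable φ)
    (hle : ∀ x, ExpectationLE P (fun ω => h x (Y ω)) (φ x))
    (hφ : ExpectationLE P (fun ω => φ (X ω)) a) :
    ExpectationLE P (fun ω => h (X ω) (Y ω)) a := by
  have := Measure.isProbabilityMeasure_map (μ := P) hX.aemeasurable
  have := Measure.isProbabilityMeasure_map (μ := P) hY.aemeasurable
  have hmx : ∀ x, Measurable (h x) := fun x => hm.comp measurable_prodMk_left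
  have hφi : Integrable φ (P.map X) :=
    (integrable_map_measure hφm.aestronglyMeasurable hX.aemeasurable).2 hφ.1
  have hfiber : ∀ x, ∫ y, h x y ∂(P.map Y) ≤ φ x := fun x =>
    (integral_map hY.aemeasurable (hmx x).aestronglyMeasurable).trans_le (hle x).2
  have hi : Integrable (Function.uncurry h) ((P.map X).prod (P.map Y)) := by
    refine (integrable_prod_iff hm.aestronglyMeasurable).2
      ⟨Filter.Eventually.of_forall fun x => (integrable_map_measure
        (hmx x).aestronglyMeasurable hY.aemeasurable).2 (hle x).1, ?_⟩
    refine hφi.mono' hm.norm.stronglyMeasurable.integral_prod_right'.aestronglyMeasurable ?_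
    refine Filter.Eventually.of_forall fun x => ?_
    simp only [Function.uncurry_apply_pair, Real.norm_of_nonneg (h0 x _),
      Real.norm_of_nonneg (integral_nonneg (h0 x))]
    exact hfiber x
  have hmap := hXY.map_prod_eq_prod_map_map hX.aemeasurable hY.aemeasurable
  refine ⟨(hmap ▸ hi).comp_measurable (hX.prodMk hY), ?_⟩
  calc ∫ ω, h (X ω) (Y ω) ∂P
      = ∫ p, Function.uncurry h p ∂((P.map X).prod (P.map Y)) := by
        rw [← hmap, integral_map (hX.prodMk hY).aemeasurable hm.aestronglyMeasurable]
        rfl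
    _ = ∫ x, ∫ y, h x y ∂(P.map Y) ∂(P.map X) := integral_prod _ hi
    _ ≤ ∫ x, φ x ∂(P.map X) := integral_mono hi.integral_prod_left hφi hfiber
    _ = ∫ ω, φ (X ω) ∂P := integral_map hX.aemeasurable hφm.aestronglyMeasurable
    _ ≤ a := hφ.2

end ExpectationBounds

section Draws

theorem indepFun_of_measurable_biSup {Ω ι 𝒳 𝒴 : Type*} {mΩ : MeasurableSpace Ω} {P : Measure Ω}
    {m : ι → MeasurableSpace Ω} (hle : ∀ i, m i ≤ mΩ) (hind : iIndep m P) {S T : Set ι}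
    (hST : Disjoint S T) [MeasurableSpace 𝒳] [MeasurableSpace 𝒴] {X : Ω → 𝒳} {Y : Ω → 𝒴}
    (hX : Measurable[⨆ i ∈ S, m i] X) (hY : Measurable[⨆ i ∈ T, m i] Y) : IndepFun X Y P :=
  (IndepFun_iff_Indep _ _ _).2 (indep_of_indep_of_le_left (indep_of_indep_of_le_right
    (indep_iSup_of_disjoint hle hind hST) hY.comap_le) hX.comap_le)

theorem measurable_biSup_comap {Ω ι 𝒳 : Type*} [MeasurableSpace 𝒳] {X : ι → Ω → 𝒳} {S : Set ι}
    {i : ι} (hi : i ∈ S) :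
    Measurable[⨆ i ∈ S, MeasurableSpace.comap (X i) inferInstance] (X i) :=
  Measurable.mono (comap_measurable (X i))
    (le_biSup (fun i => MeasurableSpace.comap (X i) inferInstance) hi) le_rfl

variable {Ξ Ω : Type*} [MeasurableSpace Ξ] {ξ : SeedIndex → Ω → Ξ} {I : ℕ × ℕ → Ω → ℕ}
  {S T : Set (SeedIndex ⊕ (ℕ × ℕ))}

/-- The σ-algebra generated by a single draw: a seed (`Sum.inl`) or a level (`Sum.inr`). -/
@[reducible]
def drawSigma (ξ : SeedIndex → Ω → Ξ) (I : ℕ × ℕ → Ω → ℕ) :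
    SeedIndex ⊕ (ℕ × ℕ) → MeasurableSpace Ω
  | .inl j => MeasurableSpace.comap (ξ j) inferInstance
  | .inr j => MeasurableSpace.comap (I j) inferInstance

/-- The σ-algebra generated by a set of draws: what is known once these draws are revealed. -/
@[reducible]
def drawsSigma (ξ : SeedIndex → Ω → Ξ) (I : ℕ × ℕ → Ω → ℕ) (S : Set (SeedIndex ⊕ (ℕ × ℕ))) :
    MeasurableSpace Ω :=
  ⨆ j ∈ S, drawSigma ξ I j

theorem drawsSigma_mono (h : S ⊆ T) : drawsSigma ξ I S ≤ drawsSigma ξ I T :=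
  biSup_mono h

theorem measurable_seed_drawsSigma {j : SeedIndex} (hj : .inl j ∈ S) :
    Measurable[drawsSigma ξ I S] (ξ j) :=
  Measurable.mono (comap_measurable (ξ j)) (le_biSup (drawSigma ξ I) hj) le_rfl

theorem measurable_level_drawsSigma {j : ℕ × ℕ} (hj : .inr j ∈ S) :
    Measurable[drawsSigma ξ I S] (I j) :=
  Measurable.mono (comap_measurable (I j)) (le_biSup (drawSigma ξ I) hj) le_rfl

variable [mΩ : MeasurableSpace Ω] {P : Measure Ω} {ν : Measure Ξ}

theorem IsSampling.measurePreserving_seed (hS : IsSampling P ν ξ I) (j : SeedIndex) :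
    MeasurePreserving (ξ j) P ν :=
  ⟨hS.measurable_seed j, hS.law_seed j⟩

theorem IsSampling.drawSigma_le (hS : IsSampling P ν ξ I) (j : SeedIndex ⊕ (ℕ × ℕ)) :
    drawSigma ξ I j ≤ mΩ := by
  rcases j with j | j
  · exact (hS.measurable_seed j).comap_le
  · exact (hS.measurable_level j).comap_le

theorem IsSampling.drawsSigma_le (hS : IsSampling P ν ξ I) (S : Set (SeedIndex ⊕ (ℕ × ℕ))) :
    drawsSigma ξ I S ≤ mΩ :=
  iSup₂_le fun j _ => hS.drawSigma_le j

theorem IsSampling.iIndep_drawSigma (hS : IsSampling P ν ξ I) : iIndep (drawSigma ξ I) P := by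
  rw [iIndep_iff]
  intro s f hf
  have hsplit : ⋂ i ∈ s, f i = (⋂ j ∈ s.toLeft, f (.inl j)) ∩ ⋂ j ∈ s.toRight, f (.inr j) := by
    ext ω
    simp
  have hl : ∀ j ∈ s.toLeft, MeasurableSet[drawSigma ξ I (.inl j)] (f (.inl j)) :=
    fun j hj => hf _ (by simpa using hj)
  have hr : ∀ j ∈ s.toRight, MeasurableSet[drawSigma ξ I (.inr j)] (f (.inr j)) :=
    fun j hj => hf _ (by simpa using hj)
  have hinter := (Indep_iff _ _ _).1 ((IndepFun_iff_Indep _ _ _).1 hS.indep_seed_level)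
    (⋂ j ∈ s.toLeft, f (.inl j)) (⋂ j ∈ s.toRight, f (.inr j))
    (Finset.measurableSet_biInter _ fun j hj => by
      obtain ⟨B, hB, h⟩ := hl j hj
      exact ⟨(fun g : SeedIndex → Ξ => g j) ⁻¹' B, measurable_pi_apply j hB, h⟩)
    (Finset.measurableSet_biInter _ fun j hj => by
      obtain ⟨B, hB, h⟩ := hr j hj
      exact ⟨(fun g : ℕ × ℕ → ℕ => g j) ⁻¹' B, measurable_pi_apply j hB, h⟩)
  rw [hsplit, hinter,
    (iIndep_iff _ _).1 ((iIndepFun_iff_iIndep _ _ _).1 hS.indep_seed) s.toLeft hl,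
    (iIndep_iff _ _).1 ((iIndepFun_iff_iIndep _ _ _).1 hS.indep_level) s.toRight hr,
    Finset.prod_sum_eq_prod_toLeft_mul_prod_toRight]

theorem IsSampling.indepFun (hS : IsSampling P ν ξ I) (hST : Disjoint S T) {𝒳 𝒴 : Type*}
    [MeasurableSpace 𝒳] [MeasurableSpace 𝒴] {X : Ω → 𝒳} {Y : Ω → 𝒴}
    (hX : Measurable[drawsSigma ξ I S] X) (hY : Measurable[drawsSigma ξ I T] Y) :
    IndepFun X Y P :=
  indepFun_of_measurable_biSup hS.drawSigma_le hS.iIndep_drawSigma hST hX hY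

end Draws

/-! ### Second moments of random vectors -/

section SecondMoment

theorem norm_add_sq_le_two_mul {E : Type*} [SeminormedAddCommGroup E] (a b : E) :
    ‖a + b‖ ^ 2 ≤ 2 * ‖a‖ ^ 2 + 2 * ‖b‖ ^ 2 :=
  (pow_le_pow_left₀ (norm_nonneg _) (norm_add_le a b) 2).trans
    (add_sq_le.trans_eq (mul_add _ _ _))

theorem norm_inv_smul_sum_sub_le {E : Type*} [SeminormedAddCommGroup E] [NormedSpace ℝ E]
    {a : ℕ → E} {y : E} {b : ℝ} {M : ℕ} (hM : 0 < M) (h : ∀ m, ‖a m - y‖ ≤ b) :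
    ‖(M : ℝ)⁻¹ • ∑ m ∈ Finset.range M, a m - y‖ ≤ b := by
  rw [← mem_closedBall_iff_norm, Finset.smul_sum]
  refine (convex_closedBall y b).sum_mem (fun _ _ => by positivity) ?_
    fun m _ => mem_closedBall_iff_norm.2 (h m)
  rw [Finset.sum_const, Finset.card_range, nsmul_eq_mul, mul_inv_cancel₀ (by positivity)]

variable {Ω : Type*} [MeasurableSpace Ω] {P : Measure Ω}

theorem integrable_of_integrable_norm_sub_sq {E : Type*} [NormedAddCommGroup E]
    [IsFiniteMeasure P] {X : Ω → E} (hX : AEStronglyMeasurable X P) {y : E}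
    (h : Integrable (fun ω => ‖X ω - y‖ ^ 2) P) : Integrable X P := by
  have hsub : Integrable (fun ω => X ω - y) P :=
    ((integrable_const (1 : ℝ)).add h).mono' (hX.sub aestronglyMeasurable_const)
      (Filter.Eventually.of_forall fun ω => by
        simp only [Pi.add_apply]
        nlinarith [sq_nonneg (‖X ω - y‖ - 1 / 2)])
  simpa only [Pi.add_def, sub_add_cancel] using hsub.add (integrable_const y)

theorem norm_integral_average_sub_le {E : Type*} [NormedAddCommGroup E] [NormedSpace ℝ E]
    {V : ℕ → Ω → E} (hV : ∀ m, Integrable (V m) P) {y : E} {b : ℝ}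
    (hb : ∀ m, ‖∫ ω, V m ω ∂P - y‖ ≤ b) {M : ℕ} (hM : 0 < M) :
    ‖∫ ω, (M : ℝ)⁻¹ • ∑ m ∈ Finset.range M, V m ω ∂P - y‖ ≤ b := by
  rw [integral_smul, integral_finsetSum _ fun m _ => hV m]
  exact norm_inv_smul_sum_sub_le hM hb

variable {E ι : Type*} [NormedAddCommGroup E] [InnerProductSpace ℝ E] [CompleteSpace E]

theorem integral_sub_const [IsProbabilityMeasure P] {X : Ω → E} (hX : Integrable X P) (y : E) :
    ∫ ω, (X ω - y) ∂P = ∫ ω, X ω ∂P - y := by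
  rw [integral_sub hX (integrable_const _), integral_const, probReal_univ, one_smul]

theorem expectationLE_norm_add_smul_sq [IsProbabilityMeasure P] {g : Ω → E} {v : ℝ}
    (hg : Integrable g P) (h2 : ExpectationLE P (fun ω => ‖g ω‖ ^ 2) v) (a : E) (c : ℝ) :
    ExpectationLE P (fun ω => ‖a + c • g ω‖ ^ 2)
      (‖a‖ ^ 2 + 2 * c * ⟪a, ∫ ω, g ω ∂P⟫ + c ^ 2 * v) := by
  have hexpand : (fun ω => ‖a + c • g ω‖ ^ 2) =
      fun ω => ‖a‖ ^ 2 + 2 * c * ⟪a, g ω⟫ + c ^ 2 * ‖g ω‖ ^ 2 := by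
    funext ω
    rw [norm_add_sq_real, norm_smul, mul_pow, inner_smul_right, Real.norm_eq_abs, sq_abs]
    ring
  have hcross : ExpectationLE P (fun ω => 2 * c * ⟪a, g ω⟫) (2 * c * ⟪a, ∫ ω, g ω ∂P⟫) :=
    ⟨(hg.const_inner a).const_mul _, by rw [integral_const_mul, integral_inner hg]⟩
  rw [hexpand]
  exact ((expectationLE_const _).add hcross).add (h2.const_mul (sq_nonneg c))

theorem expectationLE_norm_sub_integral_sq [IsProbabilityMeasure P] {X : Ω → E}
    (hX : Integrable X P) {y : E} {v : ℝ} (h : ExpectationLE P (fun ω => ‖X ω - y‖ ^ 2) v) :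
    ExpectationLE P (fun ω => ‖X ω - ∫ ω', X ω' ∂P‖ ^ 2) (v - ‖∫ ω, X ω ∂P - y‖ ^ 2) := by
  have hsq := expectationLE_norm_add_smul_sq (hX.sub (integrable_const y)) h
    (-(∫ ω, X ω ∂P - y)) 1
  simp only [Pi.sub_apply, integral_sub_const hX, inner_neg_left, real_inner_self_eq_norm_sq,
    norm_neg, one_smul] at hsq
  convert hsq.mono (b := v - ‖∫ ω, X ω ∂P - y‖ ^ 2) (by linarith) using 4
  abel

theorem norm_integral_sub_sq_le [IsProbabilityMeasure P] {X : Ω → E} (hX : Integrable X P) {y : E}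
    {v : ℝ} (h : ExpectationLE P (fun ω => ‖X ω - y‖ ^ 2) v) : ‖∫ ω, X ω ∂P - y‖ ^ 2 ≤ v :=
  sub_nonneg.1 <| (integral_nonneg fun _ => sq_nonneg _).trans
    (expectationLE_norm_sub_integral_sq hX h).2

variable [MeasurableSpace E] [BorelSpace E]

theorem integral_inner_eq_zero_of_indepFun {X Y : Ω → E} (h : IndepFun X Y P)
    (hX : Integrable X P) (hY : Integrable Y P) (h0 : ∫ ω, Y ω ∂P = 0) :
    ∫ ω, ⟪X ω, Y ω⟫ ∂P = 0 :=
  (h.integral_bilin hX hY (innerSL ℝ)).trans (by rw [h0, map_zero])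

theorem expectationLE_norm_sum_sq {W : ι → Ω → E} {v : ι → ℝ} (s : Finset ι)
    (hW : ∀ i ∈ s, Integrable (W i) P) (h0 : ∀ i ∈ s, ∫ ω, W i ω ∂P = 0)
    (h2 : ∀ i ∈ s, ExpectationLE P (fun ω => ‖W i ω‖ ^ 2) (v i))
    (hi : (s : Set ι).Pairwise fun i j => IndepFun (W i) (W j) P) :
    ExpectationLE P (fun ω => ‖∑ i ∈ s, W i ω‖ ^ 2) (∑ i ∈ s, v i) := by
  induction s using Finset.cons_induction with
  | empty => simp [ExpectationLE]
  | cons j s hj ih =>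
    simp only [Finset.mem_cons, forall_eq_or_imp] at hW h0 h2
    rw [Finset.coe_cons, Set.pairwise_insert] at hi
    have hcross : ∀ i ∈ s, ExpectationLE P (fun ω => ⟪W j ω, W i ω⟫) 0 := fun i his =>
      have hij := (hi.2 i his (ne_of_mem_of_not_mem his hj).symm).1
      ⟨hij.integrable_bilin hW.1 (hW.2 i his) (innerSL ℝ),
        (integral_inner_eq_zero_of_indepFun hij hW.1 (hW.2 i his) (h0.2 i his)).le⟩
    have hsq := (h2.1.add ((ExpectationLE.sum hcross).const_mul zero_le_two)).add
      (ih hW.2 h0.2 h2.2 hi.1)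
    simpa only [Finset.sum_cons, norm_add_sq_real, inner_sum, Finset.sum_const_zero, mul_zero,
      add_zero] using hsq

theorem expectationLE_norm_average_sub_sq [IsProbabilityMeasure P] {V : ℕ → Ω → E}
    (hV : ∀ m, Integrable (V m) P) (hi : ∀ m n, m ≠ n → IndepFun (V m) (V n) P) {y : E} {b v : ℝ}
    (hb : ∀ m, ‖∫ ω, V m ω ∂P - y‖ ≤ b)
    (hv : ∀ m, ExpectationLE P (fun ω => ‖V m ω - y‖ ^ 2) v) {M : ℕ} (hM : 0 < M) :
    ExpectationLE P (fun ω => ‖(M : ℝ)⁻¹ • ∑ m ∈ Finset.range M, V m ω - y‖ ^ 2)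
      (b ^ 2 + v / M) := by
  have hcentred : ∀ m, Integrable (fun ω => V m ω - ∫ ω', V m ω' ∂P) P := fun m =>
    (hV m).sub (integrable_const _)
  have hmean : ∀ m, ∫ ω, (V m ω - ∫ ω', V m ω' ∂P) ∂P = 0 := fun m => by
    rw [integral_sub_const (hV m), sub_self]
  have hsum := expectationLE_norm_sum_sq (Finset.range M) (fun m _ => hcentred m)
    (fun m _ => hmean m) (fun m _ => (expectationLE_norm_sub_integral_sq (hV m) (hv m)).mono
      (sub_le_self v (sq_nonneg _)))
    (fun m _ n _ hmn => (hi m n hmn).comp (measurable_id.sub_const _) (measurable_id.sub_const _))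
  have hsq := expectationLE_norm_add_smul_sq (integrable_finsetSum _ fun m _ => hcentred m) hsum
    ((M : ℝ)⁻¹ • ∑ m ∈ Finset.range M, ∫ ω, V m ω ∂P - y) (M : ℝ)⁻¹
  rw [integral_finsetSum _ fun m _ => hcentred m, Finset.sum_eq_zero fun m _ => hmean m,
    inner_zero_right, mul_zero, add_zero, Finset.sum_const, Finset.card_range, nsmul_eq_mul] at hsq
  simp only [Finset.sum_sub_distrib, smul_sub, sub_add_eq_add_sub, add_sub_cancel] at hsq
  refine hsq.mono (add_le_add ?_ (le_of_eq ?_))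
  · exact pow_le_pow_left₀ (norm_nonneg _) (norm_inv_smul_sum_sub_le hM hb) 2
  · field_simp

end SecondMoment

/-! ### Stochastic forward-backward-forward iterations -/

section ForwardBackwardForward

variable {E : Type*} [NormedAddCommGroup E] [InnerProductSpace ℝ E] {A : E → Set E} {B : E → E}
  {μ LB τ : ℝ} {b y z zh : E}

theorem mul_norm_sub_sq_le_inner_of_mem_resolventValues (hA : IsMonotoneOp A)
    (hB : ∀ z w, μ * ‖z - w‖ ^ 2 ≤ ⟪B z - B w, z - w⟫) (hτ : 0 ≤ τ)
    (hzh : zh ∈ resolventValues (opSmul τ A) (z - τ • b)) (hy : -B y ∈ A y) :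
    τ * μ * ‖zh - y‖ ^ 2 ≤ ⟪zh - y, z - zh + τ • (B zh - b)⟫ := by
  obtain ⟨p, hp, hz⟩ := mem_resolventValues_opSmul.1 hzh
  have hsum : z - zh + τ • (B zh - b) = τ • ((p - -B y) + (B zh - B y)) := by
    rw [sub_eq_iff_eq_add.1 hz]
    module
  rw [hsum, inner_smul_right, real_inner_comm, inner_add_left, mul_assoc]
  exact mul_le_mul_of_nonneg_left (by linarith [hA zh y p hp _ hy, hB zh y]) hτ

theorem norm_smul_sub_sq_le_of_lipschitz (hB : ∀ z w, ‖B z - B w‖ ≤ LB * ‖z - w‖) (hτ : 0 ≤ τ)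
    (hτL : τ * LB ≤ 1 / 3) :
    ‖τ • (B zh - b)‖ ^ 2 ≤ 2 / 9 * ‖z - zh‖ ^ 2 + 2 * τ ^ 2 * ‖b - B z‖ ^ 2 := by
  have hlip : τ * ‖B zh - B z‖ ≤ 1 / 3 * ‖z - zh‖ :=
    calc τ * ‖B zh - B z‖ ≤ τ * (LB * ‖zh - z‖) := by gcongr; exact hB _ _
      _ = τ * LB * ‖z - zh‖ := by rw [norm_sub_rev]; ring
      _ ≤ 1 / 3 * ‖z - zh‖ := by gcongr
  have htri : ‖τ • (B zh - b)‖ ≤ 1 / 3 * ‖z - zh‖ + τ * ‖b - B z‖ := by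
    rw [norm_smul, Real.norm_of_nonneg hτ, norm_sub_rev b]
    nlinarith [norm_sub_le_norm_sub_add_norm_sub (B zh) (B z) b]
  nlinarith [pow_le_pow_left₀ (norm_nonneg _) htri 2,
    sq_nonneg (1 / 3 * ‖z - zh‖ - τ * ‖b - B z‖)]

/-- With `g = τ (B zh - b)`, monotonicity gives `‖zh - y - g‖² ≤ ‖z - y‖² - ‖z - zh‖² + ‖g‖²` up
to the contraction term, and `g` is small by Lipschitz continuity. -/
theorem norm_fbf_step_sub_sq_le (hA : IsMonotoneOp A)
    (hBmono : ∀ z w, μ * ‖z - w‖ ^ 2 ≤ ⟪B z - B w, z - w⟫)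
    (hBlip : ∀ z w, ‖B z - B w‖ ≤ LB * ‖z - w‖) (hτ : 0 ≤ τ) (hμ : 0 ≤ μ) (hμL : μ ≤ LB)
    (hτL : τ * LB ≤ 1 / 3) (hzh : zh ∈ resolventValues (opSmul τ A) (z - τ • b))
    (hy : -B y ∈ A y) :
    ‖zh + τ • b - τ • B zh - y‖ ^ 2 ≤
      (1 - τ * μ) * ‖z - y‖ ^ 2 + 2 * τ ^ 2 * ‖b - B z‖ ^ 2 := by
  have hmono := mul_norm_sub_sq_le_inner_of_mem_resolventValues hA hBmono hτ hzh hy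
  have hlip := norm_smul_sub_sq_le_of_lipschitz (zh := zh) (b := b) (z := z) hBlip hτ hτL
  have hτμ : τ * μ ≤ 1 / 3 := (mul_le_mul_of_nonneg_left hμL hτ).trans hτL
  generalize hg : τ • (B zh - b) = g at hmono hlip
  generalize hv : zh - y = v at hmono
  generalize hd : z - zh = d at hmono hlip
  have hnext : zh + τ • b - τ • B zh - y = v - g := by rw [← hv, ← hg]; module
  have hprev : z - y = d + v := by rw [← hd, ← hv]; abel
  have hexpand : ‖d + v‖ ^ 2 ≤ 2 * ‖d‖ ^ 2 + 2 * ‖v‖ ^ 2 :=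
    norm_add_sq_le_two_mul d v
  have hcontract : τ * μ * ‖d + v‖ ^ 2 ≤ 2 / 3 * ‖d‖ ^ 2 + 2 * (τ * μ * ‖v‖ ^ 2) := by
    nlinarith [mul_le_mul_of_nonneg_left hexpand (mul_nonneg hτ hμ), sq_nonneg ‖d‖]
  rw [inner_add_right, real_inner_comm] at hmono
  rw [hnext, hprev, sub_mul, one_mul]
  rw [norm_sub_sq_real]
  linarith [norm_add_sq_real d v, sq_nonneg ‖d‖]

variable {Ξ Ω : Type*}

/-- The step size `τ_t` of `fbf`. -/
def fbfStepSize (μ LB : ℝ) (t : ℕ) : ℝ :=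
  2 / (((t : ℝ) + 1) * μ + 6 * LB)

/-- The point `z_{t + 1/2}` of `fbf`, from `z_t = z` and the first seed `s` of iteration `t`. -/
def fbfHalfStep (μ LB : ℝ) (A : E → Set E) (Bin : E → Ξ → E) (z₀ : E) (t : ℕ) (z : E) (s : Ξ) :
    E :=
  resolventMap (opSmul (fbfStepSize μ LB t) A) (z - fbfStepSize μ LB t • (Bin z s - z₀))

/-- The point `z_{t + 1}` of `fbf`, from `z_t = z` and the seeds `s`, `s'` of iteration `t`. -/
def fbfStep (μ LB : ℝ) (A : E → Set E) (Bin : E → Ξ → E) (z₀ : E) (t : ℕ) (z : E) (s s' : Ξ) : E :=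
  fbfHalfStep μ LB A Bin z₀ t z s + fbfStepSize μ LB t • (Bin z s - z₀) -
    fbfStepSize μ LB t • (Bin (fbfHalfStep μ LB A Bin z₀ t z s) s' - z₀)

theorem fbf_succ_point (Bin : E → Ξ → E) (z₀ : E) (seed : ℕ → Bool → Ξ) (t : ℕ) :
    (fbf μ LB A Bin z₀ seed (t + 1)).point =
      fbfStep μ LB A Bin z₀ t (fbf μ LB A Bin z₀ seed t).point (seed t false) (seed t true) :=
  rfl

theorem fbfStepSize_pos (hμ : 0 < μ) (hμL : μ ≤ LB) (t : ℕ) : 0 < fbfStepSize μ LB t := by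
  have := hμ.trans_le hμL
  unfold fbfStepSize
  positivity

theorem fbfStepSize_mul_le (hμ : 0 < μ) (hμL : μ ≤ LB) (t : ℕ) :
    fbfStepSize μ LB t * LB ≤ 1 / 3 := by
  have hLB := hμ.trans_le hμL
  rw [fbfStepSize, div_mul_eq_mul_div, div_le_iff₀ (by positivity)]
  linarith [mul_nonneg (t.cast_nonneg.trans (le_add_of_nonneg_right zero_le_one)) hμ.le]

/-- The bound on `𝔼 ‖z_t - y‖ ^ 2` that the contraction of one iteration of `fbf` propagates,
for `R = ‖z₀ - y‖ ^ 2` and an oracle of variance `V`. -/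
def fbfErrorBound (μ LB R V : ℝ) (t : ℕ) : ℝ :=
  (6 * LB / μ * (6 * LB / μ - 1) * R + 12 * (μ ^ 2)⁻¹ * V * t) /
    ((t + 6 * LB / μ - 1) * (t + 6 * LB / μ))

theorem six_le_six_mul_div (hμ : 0 < μ) (hμL : μ ≤ LB) : 6 ≤ 6 * LB / μ := by
  rw [le_div_iff₀ hμ]
  linarith

theorem fbfErrorBound_zero (hμ : 0 < μ) (hμL : μ ≤ LB) (R V : ℝ) :
    fbfErrorBound μ LB R V 0 = R := by
  have hc := six_le_six_mul_div hμ hμL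
  have hc₀ : 6 * LB / μ ≠ 0 := by linarith
  have hc₁ : 6 * LB / μ - 1 ≠ 0 := by linarith
  simp only [fbfErrorBound, Nat.cast_zero, mul_zero, add_zero, zero_add]
  rw [mul_comm (_ - 1) (_ / _), mul_div_cancel_left₀ _ (mul_ne_zero hc₀ hc₁)]

theorem fbfErrorBound_succ_ge (hμ : 0 < μ) (hμL : μ ≤ LB) (R : ℝ) {V : ℝ} (hV : 0 ≤ V) (t : ℕ) :
    (1 - fbfStepSize μ LB t * μ) * fbfErrorBound μ LB R V t + 3 * fbfStepSize μ LB t ^ 2 * V ≤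
      fbfErrorBound μ LB R V (t + 1) := by
  have hc := six_le_six_mul_div hμ hμL
  have hτ : fbfStepSize μ LB t = 2 / (μ * (t + 6 * LB / μ + 1)) := by
    rw [fbfStepSize]
    congr 1
    field_simp
    ring
  rw [hτ, fbfErrorBound, fbfErrorBound]
  generalize 6 * LB / μ * (6 * LB / μ - 1) * R = r
  push_cast
  rw [add_right_comm (t : ℝ) 1 (6 * LB / μ)]
  have hS : 6 ≤ (t : ℝ) + 6 * LB / μ := by linarith [t.cast_nonneg (α := ℝ)]
  generalize (t : ℝ) + 6 * LB / μ = S at hS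
  have hS₁ : S - 1 ≠ 0 := by linarith
  have hcontract : (1 - 2 / (μ * (S + 1)) * μ) *
      ((r + 12 * (μ ^ 2)⁻¹ * V * t) / ((S - 1) * S)) =
      (r + 12 * (μ ^ 2)⁻¹ * V * t) / (S * (S + 1)) := by
    field_simp
    ring
  have hnoise : 3 * (2 / (μ * (S + 1))) ^ 2 * V ≤ 12 * (μ ^ 2)⁻¹ * V / (S * (S + 1)) :=
    calc 3 * (2 / (μ * (S + 1))) ^ 2 * V = 12 * (μ ^ 2)⁻¹ * V / ((S + 1) * (S + 1)) := by
          field_simp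
          ring
      _ ≤ 12 * (μ ^ 2)⁻¹ * V / (S * (S + 1)) := by gcongr; linarith
  calc _ ≤ (r + 12 * (μ ^ 2)⁻¹ * V * t) / (S * (S + 1)) + 12 * (μ ^ 2)⁻¹ * V / (S * (S + 1)) := by
        rw [hcontract]
        gcongr
    _ = _ := by rw [add_sub_cancel_right, ← add_div, mul_add_one (_ * V), add_assoc]

theorem fbfErrorBound_le (hμ : 0 < μ) (hμL : μ ≤ LB) {R V : ℝ} (hR : 0 ≤ R) (hV : 0 ≤ V) {t : ℕ}
    (ht : 1 ≤ t) : fbfErrorBound μ LB R V t ≤ (6 * LB / μ * R + 12 * (μ ^ 2)⁻¹ * V) / t := by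
  have hc := six_le_six_mul_div hμ hμL
  have ht₁ : (1 : ℝ) ≤ t := mod_cast ht
  rw [fbfErrorBound]
  generalize 6 * LB / μ = c at hc
  rw [div_le_div_iff₀ (by nlinarith) (by linarith)]
  have hinit : c * R * ((c - 1) * t) ≤ c * R * ((t + c - 1) * (t + c)) :=
    mul_le_mul_of_nonneg_left (by nlinarith) (by positivity)
  have hnoise : 12 * (μ ^ 2)⁻¹ * V * (t * t) ≤ 12 * (μ ^ 2)⁻¹ * V * ((t + c - 1) * (t + c)) :=
    mul_le_mul_of_nonneg_left (by nlinarith) (by positivity)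
  linarith

variable [MeasurableSpace E] [MeasurableSpace Ξ] [MeasurableSpace Ω] {Bin : E → Ξ → E} {z₀ : E}
  {s σ : ℝ} {ν : Measure Ξ} {P : Measure Ω}

theorem IsStochasticOracle.expectationLE {F : E → E} {Ft : E → Ξ → E}
    (h : IsStochasticOracle Ft ν F σ) (x : E) :
    ExpectationLE ν (fun s => ‖Ft x s - F x‖ ^ 2) (σ ^ 2) :=
  ⟨h.integrable_sq x, h.variance_le x⟩

/-- The setting of `fbf`, without the starting point: a maximally monotone `A` and a strongly
monotone, Lipschitz `B` accessed through the stochastic oracle `Bin` with variance at most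
`σ ^ 2`. -/
structure FbfProblem (μ LB σ : ℝ) (A : E → Set E) (B : E → E) (Bin : E → Ξ → E)
    (ν : Measure Ξ) : Prop where
  maximal : IsMaximalMonotone A
  strongMono : ∀ z w, μ * ‖z - w‖ ^ 2 ≤ ⟪B z - B w, z - w⟫
  lipschitz : ∀ z w, ‖B z - B w‖ ≤ LB * ‖z - w‖
  oracle : IsStochasticOracle Bin ν B σ
  pos : 0 < μ
  le : μ ≤ LB

variable [CompleteSpace E]

namespace FbfProblem

theorem lipschitzWith_resolventMap (h : FbfProblem μ LB σ A B Bin ν) (t : ℕ) :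
    LipschitzWith 1 (resolventMap (opSmul (fbfStepSize μ LB t) A)) :=
  h.maximal.lipschitzWith_resolventMap (fbfStepSize_pos h.pos h.le t)

theorem norm_fbfStep_sub_sq_le (h : FbfProblem μ LB σ A B Bin ν) (hy : z₀ - B y ∈ A y) (t : ℕ)
    (z : E) (s : Ξ) :
    ‖fbfHalfStep μ LB A Bin z₀ t z s + fbfStepSize μ LB t • (Bin z s - z₀) -
        fbfStepSize μ LB t • (B (fbfHalfStep μ LB A Bin z₀ t z s) - z₀) - y‖ ^ 2 ≤
      (1 - fbfStepSize μ LB t * μ) * ‖z - y‖ ^ 2 +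
        2 * fbfStepSize μ LB t ^ 2 * ‖Bin z s - B z‖ ^ 2 := by
  have hτ := fbfStepSize_pos h.pos h.le t
  have hstep := norm_fbf_step_sub_sq_le (B := fun z => B z - z₀) (b := Bin z s - z₀) (y := y)
    (z := z) (zh := fbfHalfStep μ LB A Bin z₀ t z s) h.maximal.1
    (fun z w => by simpa only [sub_sub_sub_cancel_right] using h.strongMono z w)
    (fun z w => by simpa only [sub_sub_sub_cancel_right] using h.lipschitz z w) hτ.le h.pos.le h.le
    (fbfStepSize_mul_le h.pos h.le t) (h.maximal.resolventMap_mem hτ _) (by rwa [neg_sub])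
  rwa [sub_sub_sub_cancel_right] at hstep

theorem expectationLE_fbfStep_snd [IsProbabilityMeasure P] (h : FbfProblem μ LB σ A B Bin ν)
    (hy : z₀ - B y ∈ A y) {s' : Ω → Ξ} (hs' : MeasurePreserving s' P ν) (t : ℕ) (z : E) (s : Ξ) :
    ExpectationLE P (fun ω => ‖fbfStep μ LB A Bin z₀ t z s (s' ω) - y‖ ^ 2)
      ((1 - fbfStepSize μ LB t * μ) * ‖z - y‖ ^ 2 +
        2 * fbfStepSize μ LB t ^ 2 * ‖Bin z s - B z‖ ^ 2 + fbfStepSize μ LB t ^ 2 * σ ^ 2) := by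
  set τ := fbfStepSize μ LB t
  set zh := fbfHalfStep μ LB A Bin z₀ t z s
  have hint : Integrable (fun ω => Bin zh (s' ω)) P :=
    hs'.integrable_comp_of_integrable (h.oracle.integrable zh)
  have hmean : ∫ ω, (Bin zh (s' ω) - B zh) ∂P = 0 := by
    rw [integral_sub hint (integrable_const _), ← h.oracle.unbiased zh, ← hs'.map_eq,
      integral_map hs'.measurable.aemeasurable
        (hs'.map_eq ▸ (h.oracle.integrable zh).aestronglyMeasurable)]
    simp
  have hsq := expectationLE_norm_add_smul_sq (hint.sub (integrable_const (B zh)))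
    ((h.oracle.expectationLE zh).comp_measurePreserving hs')
    (zh + τ • (Bin z s - z₀) - τ • (B zh - z₀) - y) (-τ)
  simp only [Pi.sub_apply, hmean, inner_zero_right, mul_zero, add_zero, neg_sq] at hsq
  have hfun : (fun ω => ‖fbfStep μ LB A Bin z₀ t z s (s' ω) - y‖ ^ 2) = fun ω =>
      ‖zh + τ • (Bin z s - z₀) - τ • (B zh - z₀) - y + -τ • (Bin zh (s' ω) - B zh)‖ ^ 2 := by
    funext ω
    rw [fbfStep]
    congr 2
    module
  rw [hfun]
  exact hsq.mono (by gcongr; exact h.norm_fbfStep_sub_sq_le hy t z s)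

variable [BorelSpace E] [SecondCountableTopology E]

theorem measurable_fbfHalfStep {Ω' : Type*} {_ : MeasurableSpace Ω'}
    (h : FbfProblem μ LB σ A B Bin ν) (t : ℕ) {X Z : Ω' → E} {s : Ω' → Ξ} (hX : Measurable X)
    (hZ : Measurable Z) (hs : Measurable s) :
    Measurable fun ω => fbfHalfStep μ LB A Bin (X ω) t (Z ω) (s ω) :=
  (h.lipschitzWith_resolventMap t).continuous.measurable.comp
    (hZ.sub (((h.oracle.measurable.comp (hZ.prodMk hs)).sub hX).const_smul _))

theorem measurable_fbfStep {Ω' : Type*} {_ : MeasurableSpace Ω'}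
    (h : FbfProblem μ LB σ A B Bin ν) (t : ℕ) {X Z : Ω' → E} {s s' : Ω' → Ξ} (hX : Measurable X)
    (hZ : Measurable Z) (hs : Measurable s) (hs' : Measurable s') :
    Measurable fun ω => fbfStep μ LB A Bin (X ω) t (Z ω) (s ω) (s' ω) :=
  have hhalf := h.measurable_fbfHalfStep t hX hZ hs
  (hhalf.add (((h.oracle.measurable.comp (hZ.prodMk hs)).sub hX).const_smul _)).sub
    (((h.oracle.measurable.comp (hhalf.prodMk hs')).sub hX).const_smul _)

theorem measurable_fbf {Ω' : Type*} {_ : MeasurableSpace Ω'} (h : FbfProblem μ LB σ A B Bin ν)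
    {X : Ω' → E} (hX : Measurable X) {s : ℕ → Bool → Ω' → Ξ} {T : ℕ}
    (hs : ∀ t < T, ∀ b, Measurable (s t b)) :
    Measurable fun ω => (fbf μ LB A Bin (X ω) (fun t b => s t b ω) T).point := by
  induction T with
  | zero => exact hX
  | succ t ih =>
    simp only [fbf_succ_point]
    exact h.measurable_fbfStep t hX (ih fun u hu => hs u (hu.trans t.lt_succ_self))
      (hs t t.lt_succ_self false) (hs t t.lt_succ_self true)

theorem indepFun_fbf (h : FbfProblem μ LB σ A B Bin ν) {s : ℕ → Bool → Ω → Ξ}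
    (hs : ∀ t b, Measurable (s t b)) (hind : iIndepFun (fun p : ℕ × Bool => s p.1 p.2) P) (t : ℕ) :
    IndepFun (fun ω => (fbf μ LB A Bin z₀ (fun t b => s t b ω) t).point)
      (fun ω => (s t false ω, s t true ω)) P := by
  set X : ℕ × Bool → Ω → Ξ := fun p => s p.1 p.2
  refine indepFun_of_measurable_biSup (m := fun p => MeasurableSpace.comap (X p) inferInstance)
    (S := {p | p.1 < t}) (T := {p | p.1 = t}) (fun p => (hs p.1 p.2).comap_le)
    ((iIndepFun_iff_iIndep _ _ _).1 hind)
    (Set.disjoint_left.2 fun _ (hp : _ < _) (hq : _ = _) => hp.ne hq) ?_ ?_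
  · exact h.measurable_fbf (@measurable_const _ _ _ (_) _) fun u hu b =>
      measurable_biSup_comap (X := X) (i := (u, b)) (S := {p | p.1 < t}) hu
  · exact Measurable.prodMk
      (measurable_biSup_comap (X := X) (i := (t, false)) (S := {p | p.1 = t}) rfl)
      (measurable_biSup_comap (X := X) (i := (t, true)) (S := {p | p.1 = t}) rfl)

variable [IsProbabilityMeasure P]

theorem expectationLE_fbfStep (h : FbfProblem μ LB σ A B Bin ν) (hy : z₀ - B y ∈ A y)
    {s s' : Ω → Ξ} (hs : MeasurePreserving s P ν) (hs' : MeasurePreserving s' P ν)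
    (hi : IndepFun s s' P) (t : ℕ) (z : E) :
    ExpectationLE P (fun ω => ‖fbfStep μ LB A Bin z₀ t z (s ω) (s' ω) - y‖ ^ 2)
      ((1 - fbfStepSize μ LB t * μ) * ‖z - y‖ ^ 2 + 3 * fbfStepSize μ LB t ^ 2 * σ ^ 2) := by
  have hm : Measurable (Function.uncurry fun s s' => ‖fbfStep μ LB A Bin z₀ t z s s' - y‖ ^ 2) :=
    ((h.measurable_fbfStep t measurable_const measurable_const measurable_fst
      measurable_snd).sub_const y).norm.pow_const 2
  have hBin : Measurable fun s => Bin z s := h.oracle.measurable.comp measurable_prodMk_left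
  have hnoise := (h.oracle.expectationLE z).comp_measurePreserving hs
  refine ExpectationLE.of_indepFun hi hs.measurable hs'.measurable hm (fun _ _ => sq_nonneg _) ?_
    (fun s => h.expectationLE_fbfStep_snd hy hs' t z s)
    (((expectationLE_const _).add (hnoise.const_mul (by positivity))).add
      (expectationLE_const _) |>.mono (by linarith))
  exact ((((hBin.sub_const _).norm.pow_const 2).const_mul _).const_add _).add_const _

theorem expectationLE_fbf_succ (h : FbfProblem μ LB σ A B Bin ν) (hy : z₀ - B y ∈ A y)
    {s : ℕ → Bool → Ω → Ξ} (hs : ∀ t b, MeasurePreserving (s t b) P ν)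
    (hind : iIndepFun (fun p : ℕ × Bool => s p.1 p.2) P) (t : ℕ) {v : ℝ}
    (hv : ExpectationLE P
      (fun ω => ‖(fbf μ LB A Bin z₀ (fun t b => s t b ω) t).point - y‖ ^ 2) v) :
    ExpectationLE P (fun ω => ‖(fbf μ LB A Bin z₀ (fun t b => s t b ω) (t + 1)).point - y‖ ^ 2)
      ((1 - fbfStepSize μ LB t * μ) * v + 3 * fbfStepSize μ LB t ^ 2 * σ ^ 2) := by
  have hpair : IndepFun (s t false) (s t true) P :=
    hind.indepFun (i := (t, false)) (j := (t, true)) (by simp)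
  have hcontract : 0 ≤ 1 - fbfStepSize μ LB t * μ := by
    nlinarith [fbfStepSize_pos h.pos h.le t, fbfStepSize_mul_le h.pos h.le t, h.le]
  have hstep : Measurable
      (Function.uncurry fun z (q : Ξ × Ξ) => ‖fbfStep μ LB A Bin z₀ t z q.1 q.2 - y‖ ^ 2) :=
    ((h.measurable_fbfStep t measurable_const measurable_fst measurable_snd.fst
      measurable_snd.snd).sub_const y).norm.pow_const 2
  exact ExpectationLE.of_indepFun (h.indepFun_fbf (fun t b => (hs t b).measurable) hind t)
    (h.measurable_fbf measurable_const fun t _ b => (hs t b).measurable)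
    ((hs t false).measurable.prodMk (hs t true).measurable) hstep (fun _ _ => sq_nonneg _)
    ((((measurable_id.sub_const y).norm.pow_const 2).const_mul _).add_const _)
    (fun z => h.expectationLE_fbfStep hy (hs t false) (hs t true) hpair t z)
    ((hv.const_mul hcontract).add (expectationLE_const _))

theorem expectationLE_fbf (h : FbfProblem μ LB σ A B Bin ν) (hy : z₀ - B y ∈ A y)
    {s : ℕ → Bool → Ω → Ξ} (hs : ∀ t b, MeasurePreserving (s t b) P ν)
    (hind : iIndepFun (fun p : ℕ × Bool => s p.1 p.2) P) {T : ℕ} (hT : 1 ≤ T) :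
    ExpectationLE P (fun ω => ‖(fbf μ LB A Bin z₀ (fun t b => s t b ω) T).point - y‖ ^ 2)
      ((6 * LB / μ * ‖z₀ - y‖ ^ 2 + 12 * (μ ^ 2)⁻¹ * σ ^ 2) / T) := by
  suffices ∀ t, ExpectationLE P
      (fun ω => ‖(fbf μ LB A Bin z₀ (fun t b => s t b ω) t).point - y‖ ^ 2)
      (fbfErrorBound μ LB (‖z₀ - y‖ ^ 2) (σ ^ 2) t) from
    (this T).mono (fbfErrorBound_le h.pos h.le (sq_nonneg _) (sq_nonneg _) hT)
  intro t
  induction t with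
  | zero => exact (expectationLE_const (‖z₀ - y‖ ^ 2)).mono (fbfErrorBound_zero h.pos h.le _ _).ge
  | succ t ih =>
    exact (h.expectationLE_fbf_succ hy hs hind t ih).mono
      (fbfErrorBound_succ_ge h.pos h.le _ (sq_nonneg _) t)

end FbfProblem

end ForwardBackwardForward

/-! ### The inner problem that computes the resolvent of `η (F + G)` -/

section InnerProblem

variable {E Ξ : Type*} [NormedAddCommGroup E] [InnerProductSpace ℝ E] {L : ℝ≥0} {c η σ : ℝ}
  {F : E → E} {G : E → Set E} {Ft : E → Ξ → E} {x : E}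

theorem IsMaximalMonotone.smul (hG : IsMaximalMonotone G) (hc : 0 < c) :
    IsMaximalMonotone (opSmul c G) := by
  refine ⟨hG.1.smul hc.le, fun B hB hGB => ?_⟩
  have hmax : opSmul c⁻¹ B = G := hG.2 _ (hB.smul (inv_nonneg.2 hc.le)) fun x u hu =>
    ⟨c • u, hGB x ⟨u, hu, rfl⟩, (inv_smul_smul₀ hc.ne' u).symm⟩
  rw [← hmax, opSmul_opSmul, mul_inv_cancel₀ hc.ne']
  ext x u
  simp [opSmul]

theorem mul_norm_sub_sq_le_inner_of_lipschitzWith (hF : LipschitzWith L F) (hη : 0 ≤ η)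
    (z w : E) : (1 - η * L) * ‖z - w‖ ^ 2 ≤ ⟪(z + η • F z) - (w + η • F w), z - w⟫ := by
  rw [add_sub_add_comm, ← smul_sub, inner_add_left, real_inner_self_eq_norm_sq,
    real_inner_smul_left]
  have hinner : -(L * ‖z - w‖ ^ 2) ≤ ⟪F z - F w, z - w⟫ := by
    have habs := (abs_le.1 (abs_real_inner_le_norm (F z - F w) (z - w))).1
    nlinarith [mul_le_mul_of_nonneg_right (hF.norm_sub_le z w) (norm_nonneg (z - w))]
  linarith [mul_le_mul_of_nonneg_left hinner hη]

theorem norm_add_smul_sub_le_of_lipschitzWith (hF : LipschitzWith L F) (hη : 0 ≤ η) (z w : E) :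
    ‖(z + η • F z) - (w + η • F w)‖ ≤ (1 + η * L) * ‖z - w‖ := by
  rw [add_sub_add_comm, ← smul_sub]
  refine (norm_add_le _ _).trans ?_
  rw [norm_smul, Real.norm_of_nonneg hη]
  linarith [mul_le_mul_of_nonneg_left (hF.norm_sub_le z w) hη]

variable [MeasurableSpace E] [MeasurableSpace Ξ] {ν : Measure Ξ}

/-- An inclusion `0 ∈ F x + G x` with an `L`-Lipschitz `F`, accessed through the stochastic oracle
`Ft`, and a maximally monotone `G`, and a step `η` for which `η (F + G)` has a resolvent. -/
structure StochasticInclusion (L : ℝ≥0) (η σ : ℝ) (F : E → E) (G : E → Set E) (Ft : E → Ξ → E)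
    (ν : Measure Ξ) : Prop where
  lipschitz : LipschitzWith L F
  maximal : IsMaximalMonotone G
  oracle : IsStochasticOracle Ft ν F σ
  pos : 0 < η
  lt_one : η * L < 1

namespace StochasticInclusion

theorem sub_resolventMap_mem [CompleteSpace E] (h : StochasticInclusion L η σ F G Ft ν)
    (x : E) :
    x - (resolventMap (opSmul η (opAdd F G)) x + η • F (resolventMap (opSmul η (opAdd F G)) x)) ∈
      opSmul η G (resolventMap (opSmul η (opAdd F G)) x) := by
  obtain ⟨u, hu, hx⟩ := mem_resolventValues_opSmul_opAdd.1
    (h.maximal.resolventMap_opAdd_mem h.lipschitz h.pos h.lt_one x)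
  refine ⟨u, hu, ?_⟩
  rw [sub_eq_iff_eq_add]
  refine hx.trans ?_
  module

variable [CompleteSpace E] [BorelSpace E] [SecondCountableTopology E] [IsProbabilityMeasure ν]

theorem isStochasticOracle_id_add_smul (h : StochasticInclusion L η σ F G Ft ν) :
    IsStochasticOracle (fun z s => z + η • Ft z s) ν (fun z => z + η • F z) (η * σ) where
  measurable := measurable_fst.add (h.oracle.measurable.const_smul η)
  integrable x := (integrable_const x).add ((h.oracle.integrable x).smul η)
  unbiased x := by
    rw [integral_add (integrable_const x) ((h.oracle.integrable x).fun_smul η), integral_smul,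
      h.oracle.unbiased]
    simp
  integrable_sq x := by
    simpa only [add_sub_add_left_eq_sub, ← smul_sub, norm_smul, mul_pow] using
      (h.oracle.integrable_sq x).const_mul (‖η‖ ^ 2)
  variance_le x := by
    simp only [add_sub_add_left_eq_sub, ← smul_sub, norm_smul, mul_pow, integral_const_mul,
      Real.norm_eq_abs, sq_abs]
    exact mul_le_mul_of_nonneg_left (h.oracle.variance_le x) (sq_nonneg η)

theorem fbfProblem (h : StochasticInclusion L η σ F G Ft ν) :
    FbfProblem (1 - η * L) (1 + η * L) (η * σ) (opSmul η G) (fun z => z + η • F z)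
      (fun z s => z + η • Ft z s) ν where
  maximal := h.maximal.smul h.pos
  strongMono := mul_norm_sub_sq_le_inner_of_lipschitzWith h.lipschitz h.pos.le
  lipschitz := norm_add_smul_sub_le_of_lipschitzWith h.lipschitz h.pos.le
  oracle := h.isStochasticOracle_id_add_smul
  pos := sub_pos.2 h.lt_one
  le := by linarith [mul_nonneg h.pos.le L.coe_nonneg]

theorem expectationLE_fbf (h : StochasticInclusion L η σ F G Ft ν)
    {Ω : Type*} [MeasurableSpace Ω] {P : Measure Ω} [IsProbabilityMeasure P] (x : E)
    {s : ℕ → Bool → Ω → Ξ} (hs : ∀ t b, MeasurePreserving (s t b) P ν)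
    (hind : iIndepFun (fun p : ℕ × Bool => s p.1 p.2) P) {T : ℕ} (hT : 1 ≤ T) :
    ExpectationLE P (fun ω => ‖(fbf (1 - η * L) (1 + η * L) (opSmul η G)
        (fun z s => z + η • Ft z s) x (fun t b => s t b ω) T).point -
          resolventMap (opSmul η (opAdd F G)) x‖ ^ 2)
      (12 * ((1 - η * L) ^ 2)⁻¹ * (fpResidual η F G x ^ 2 + η ^ 2 * σ ^ 2) / T) := by
  refine (h.fbfProblem.expectationLE_fbf (h.sub_resolventMap_mem x) hs hind hT).mono ?_
  have hηL : 0 ≤ η * L := mul_nonneg h.pos.le L.coe_nonneg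
  have hμ : 0 < 1 - η * L := sub_pos.2 h.lt_one
  have hc : 6 * (1 + η * L) / (1 - η * L) ≤ 12 * ((1 - η * L) ^ 2)⁻¹ := by
    rw [div_le_iff₀ hμ, pow_two, mul_inv, mul_assoc, inv_mul_cancel_right₀ hμ.ne']
    linarith [h.lt_one, (one_le_inv₀ hμ).2 (by linarith : 1 - η * L ≤ 1)]
  rw [fpResidual, mul_add (12 * _), mul_pow]
  gcongr

end StochasticInclusion

end InnerProblem

/-! ### The multilevel estimator -/

section Multilevel

variable {Ω E : Type*}

theorem sum_indicator_level [AddCommMonoid E] (J : Ω → ℕ) (f : ℕ → Ω → E) (n : ℕ) (ω : Ω) :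
    ∑ i ∈ Finset.range n, {ω | J ω = i + 1}.indicator (f i) ω =
      if 1 ≤ J ω ∧ J ω ≤ n then f (J ω - 1) ω else 0 := by
  rcases hJ : J ω with _ | j
  · simp [hJ]
  · simp [Set.indicator_apply, hJ]

variable [NormedAddCommGroup E]

/-- The multilevel Monte Carlo estimator built on approximations `Y i` of increasing accuracy.
Only the correction `Y i - Y (i - 1)` selected by the random level `J = i` is evaluated; weighting
it with the inverse `2 ^ i` of its probability makes the estimator as accurate in the mean as
`Y n`, where `n = log₂ N` is the last admissible level. -/
def multilevel [NormedSpace ℝ E] (Y : ℕ → Ω → E) (J : Ω → ℕ) (N : ℕ) (ω : Ω) : E :=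
  if 2 ^ J ω ≤ N then Y 0 ω + (2 ^ J ω : ℝ) • (Y (J ω) ω - Y (J ω - 1) ω) else Y 0 ω

variable {Y : ℕ → Ω → E} {J : Ω → ℕ} {N : ℕ}

theorem multilevel_eq_add_sum [NormedSpace ℝ E] (hN : N ≠ 0) (ω : Ω) :
    multilevel Y J N ω = Y 0 ω + ∑ i ∈ Finset.range (Nat.log 2 N),
      {ω | J ω = i + 1}.indicator (fun ω => (2 ^ (i + 1) : ℝ) • (Y (i + 1) ω - Y i ω)) ω := by
  simp only [sum_indicator_level, multilevel, ← Nat.le_log_iff_pow_le one_lt_two hN]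
  rcases J ω with _ | j
  · simp
  · by_cases hj : j + 1 ≤ Nat.log 2 N <;> simp [hj]

theorem norm_sq_sum_indicator_level (J : Ω → ℕ) (f : ℕ → Ω → E) (n : ℕ) (ω : Ω) :
    ‖∑ i ∈ Finset.range n, {ω | J ω = i + 1}.indicator (f i) ω‖ ^ 2 =
      ∑ i ∈ Finset.range n, {ω | J ω = i + 1}.indicator (fun ω => ‖f i ω‖ ^ 2) ω := by
  rw [sum_indicator_level, sum_indicator_level J fun i ω => ‖f i ω‖ ^ 2]
  split_ifs <;> simp

variable [MeasurableSpace Ω] {P : Measure Ω}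

theorem expectationLE_norm_sub_succ_sq [MeasurableSpace E] [BorelSpace E]
    [SecondCountableTopology E] (hY : ∀ i, Measurable (Y i)) {y : E} {B : ℝ}
    (hv : ∀ i, ExpectationLE P (fun ω => ‖Y i ω - y‖ ^ 2) (B / 2 ^ i)) (i : ℕ) :
    ExpectationLE P (fun ω => ‖Y (i + 1) ω - Y i ω‖ ^ 2) (6 * B / 2 ^ (i + 1)) := by
  refine ((((hv (i + 1)).const_mul zero_le_two).add ((hv i).const_mul zero_le_two)).mono
    (le_of_eq ?_)).of_nonneg_of_le
      (((hY (i + 1)).sub (hY i)).norm.pow_const 2).aestronglyMeasurable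
      (fun _ => sq_nonneg _) fun ω => ?_
  · rw [pow_succ]
    field_simp
    ring
  · simpa only [sub_sub_sub_cancel_right, ← sub_eq_add_neg, norm_neg] using
      norm_add_sq_le_two_mul (Y (i + 1) ω - y) (-(Y i ω - y))

theorem integrable_indicator_level [NormedSpace ℝ E] (hY : ∀ i, Integrable (Y i) P)
    (hJ : Measurable J) (i : ℕ) : Integrable ({ω | J ω = i + 1}.indicator
      fun ω => (2 ^ (i + 1) : ℝ) • (Y (i + 1) ω - Y i ω)) P :=
  (((hY (i + 1)).sub (hY i)).smul _).indicator (hJ (measurableSet_singleton (i + 1)))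

theorem integrable_multilevel [NormedSpace ℝ E] (hY : ∀ i, Integrable (Y i) P) (hJ : Measurable J)
    (hN : N ≠ 0) : Integrable (multilevel Y J N) P := by
  rw [funext (multilevel_eq_add_sum hN)]
  exact (hY 0).add (integrable_finsetSum _ fun i _ => integrable_indicator_level hY hJ i)

variable [NormedSpace ℝ E] [MeasurableSpace E] [BorelSpace E] [SecondCountableTopology E]

theorem integral_indicator_of_indepFun (hJ : Measurable J)
    {X : Ω → E} (hX : AEMeasurable X P) (h : IndepFun J X P) (i : ℕ) :
    ∫ ω, {ω | J ω = i}.indicator X ω ∂P = P.real {ω | J ω = i} • ∫ ω, X ω ∂P := by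
  rw [integral_indicator (show MeasurableSet {ω | J ω = i} from hJ (measurableSet_singleton i))]
  exact Indep.setIntegral_eq_smul (f := id) hJ.comap_le ((IndepFun_iff_Indep _ _ _).1 h) hX
    ⟨{i}, measurableSet_singleton i, rfl⟩ measurable_id.aestronglyMeasurable

theorem integral_multilevel (hY : ∀ i, Integrable (Y i) P) (hJ : Measurable J)
    (hlaw : ∀ i : ℕ, P {ω | J ω = i + 1} = (1 / 2) ^ (i + 1))
    (hi : ∀ i, IndepFun J (fun ω => Y (i + 1) ω - Y i ω) P) (hN : N ≠ 0) :
    ∫ ω, multilevel Y J N ω ∂P = ∫ ω, Y (Nat.log 2 N) ω ∂P := by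
  have hmean : ∀ i, ∫ ω, {ω | J ω = i + 1}.indicator
      (fun ω => (2 ^ (i + 1) : ℝ) • (Y (i + 1) ω - Y i ω)) ω ∂P =
        ∫ ω, Y (i + 1) ω ∂P - ∫ ω, Y i ω ∂P := fun i => by
    rw [integral_indicator_of_indepFun (X := fun ω => (2 ^ (i + 1) : ℝ) • (Y (i + 1) ω - Y i ω)) hJ
        (((hY (i + 1)).sub (hY i)).smul _).aemeasurable
        ((hi i).comp measurable_id (measurable_const_smul _)), integral_smul, smul_smul,
      integral_sub (hY _) (hY _), Measure.real, hlaw]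
    simp
  have hterm := integrable_indicator_level hY hJ
  rw [funext (multilevel_eq_add_sum hN),
    integral_add (hY 0) (integrable_finsetSum _ fun i _ => hterm i),
    integral_finsetSum _ fun i _ => hterm i,
    Finset.sum_congr rfl fun i _ => hmean i, Finset.sum_range_sub fun i => ∫ ω, Y i ω ∂P,
    add_sub_cancel]

theorem expectationLE_multilevel_sub_sq [IsFiniteMeasure P] (hY : ∀ i, Measurable (Y i))
    (hJ : Measurable J)
    (hlaw : ∀ i : ℕ, P {ω | J ω = i + 1} = (1 / 2) ^ (i + 1))
    (hi : ∀ i, IndepFun J (fun ω => Y (i + 1) ω - Y i ω) P) {y : E} {B : ℝ}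
    (hv : ∀ i, ExpectationLE P (fun ω => ‖Y i ω - y‖ ^ 2) (B / 2 ^ i)) (hN : N ≠ 0) :
    ExpectationLE P (fun ω => ‖multilevel Y J N ω - y‖ ^ 2) ((2 + 12 * Nat.log 2 N) * B) := by
  have hYi : ∀ i, Integrable (Y i) P := fun i =>
    integrable_of_integrable_norm_sub_sq (hY i).aestronglyMeasurable (hv i).1
  have hlevel : ∀ i, ExpectationLE P ({ω | J ω = i + 1}.indicator
      fun ω => ‖(2 ^ (i + 1) : ℝ) • (Y (i + 1) ω - Y i ω)‖ ^ 2) (6 * B) := by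
    intro i
    have hD := (expectationLE_norm_sub_succ_sq hY hv i).const_mul (sq_nonneg ((2 : ℝ) ^ (i + 1)))
    simp only [norm_smul, mul_pow, norm_pow, Real.norm_ofNat]
    refine ⟨hD.1.indicator (hJ (measurableSet_singleton (i + 1))), ?_⟩
    rw [integral_indicator_of_indepFun hJ hD.1.aemeasurable ((hi i).comp measurable_id
      ((measurable_norm.pow_const 2).const_mul _)), Measure.real, hlaw, smul_eq_mul]
    refine (mul_le_mul_of_nonneg_left hD.2 ENNReal.toReal_nonneg).trans_eq ?_
    simp only [ENNReal.toReal_pow, one_div, ENNReal.toReal_inv, ENNReal.toReal_ofNat, inv_pow]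
    field_simp
  have hbound := ((hv 0).const_mul zero_le_two).add
    ((ExpectationLE.sum fun i (_ : i ∈ Finset.range (Nat.log 2 N)) => hlevel i).const_mul
      zero_le_two)
  refine (hbound.mono (le_of_eq ?_)).of_nonneg_of_le
    (((integrable_multilevel hYi hJ hN).aestronglyMeasurable.sub
      aestronglyMeasurable_const).norm.pow 2) (fun _ => sq_nonneg _) fun ω => ?_
  · rw [Finset.sum_const, Finset.card_range, nsmul_eq_mul]
    ring
  · rw [← norm_sq_sum_indicator_level J fun i ω => (2 ^ (i + 1) : ℝ) • (Y (i + 1) ω - Y i ω),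
      multilevel_eq_add_sum hN, add_sub_right_comm]
    exact norm_add_sq_le_two_mul _ _

end Multilevel

/-! ### Step sizes, truncation levels and batch sizes -/

section StepSizes

variable {η ρ : ℝ}

theorem relax_pos (hη : 0 < η) (hρη : ρ < η) : 0 < relax η ρ :=
  sub_pos.2 ((div_lt_one hη).2 hρη)

theorem one_lt_log_add_three (k : ℕ) : 1 < Real.log ((k : ℝ) + 3) := by
  rw [Real.lt_log_iff_exp_lt (by positivity)]
  linarith [Real.exp_one_lt_three, k.cast_nonneg (α := ℝ)]

theorem one_lt_sqrt_add_two (k : ℕ) : 1 < √((k : ℝ) + 2) := by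
  rw [Real.lt_sqrt zero_le_one]
  linarith [k.cast_nonneg (α := ℝ)]

theorem one_lt_sqrt_mul_log (k : ℕ) : 1 < √((k : ℝ) + 2) * Real.log ((k : ℝ) + 3) :=
  one_lt_mul_of_lt_of_le (one_lt_sqrt_add_two k) (one_lt_log_add_three k).le

theorem stepSize_pos (hη : 0 < η) (hρη : ρ < η) (k : ℕ) : 0 < stepSize η ρ k :=
  div_pos (relax_pos hη hρη) (zero_lt_one.trans (one_lt_sqrt_mul_log k))

theorem stepSize_le (hη : 0 < η) (hρη : ρ < η) (k : ℕ) : stepSize η ρ k ≤ relax η ρ :=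
  div_le_self (relax_pos hη hρη).le (one_lt_sqrt_mul_log k).le

/-- The weight `α_k / (α (k + 1))` that enters `N_k`. It is summable and bounds the relative growth
of `‖x_k - x⋆‖ ^ 2` caused by the bias of the estimator in iteration `k`. -/
def driftWeight (k : ℕ) : ℝ :=
  1 / (((k : ℝ) + 1) * (√((k : ℝ) + 2) * Real.log ((k : ℝ) + 3)))

theorem driftWeight_pos (k : ℕ) : 0 < driftWeight k :=
  div_pos one_pos (mul_pos (by positivity) (zero_lt_one.trans (one_lt_sqrt_mul_log k)))

theorem stepSize_eq_driftWeight_mul (k : ℕ) :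
    stepSize η ρ k = driftWeight k * (relax η ρ * ((k : ℝ) + 1)) := by
  have := zero_lt_one.trans (one_lt_sqrt_mul_log k)
  rw [stepSize, driftWeight]
  field_simp

/-- The relative accuracy requested of the mean of the estimator in iteration `k`. -/
def biasTolerance (k : ℕ) : ℝ :=
  min (driftWeight k / 120) (1 / 120)

theorem biasTolerance_pos (k : ℕ) : 0 < biasTolerance k :=
  lt_min (div_pos (driftWeight_pos k) (by norm_num)) (by norm_num)

theorem biasTolerance_le_driftWeight_div (k : ℕ) : biasTolerance k ≤ driftWeight k / 120 :=
  min_le_left _ _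

theorem biasTolerance_le (k : ℕ) : biasTolerance k ≤ 1 / 120 :=
  min_le_right _ _

theorem levelCap_eq (L : ℝ) (hη : 0 < η) (hρη : ρ < η) (k : ℕ) :
    levelCap L η ρ k = ⌈96 * ((1 - η * L) ^ 2)⁻¹ / biasTolerance k⌉₊ := by
  have hα := relax_pos hη hρη
  have hratio : stepSize η ρ k / (120 * relax η ρ * ((k : ℝ) + 1)) = driftWeight k / 120 := by
    rw [stepSize_eq_driftWeight_mul]
    field_simp
  rw [levelCap, hratio, biasTolerance]

variable {L : ℝ}

theorem le_levelCap_mul (hη : 0 < η) (hρη : ρ < η) (k : ℕ) :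
    96 * ((1 - η * L) ^ 2)⁻¹ ≤ levelCap L η ρ k * biasTolerance k := by
  rw [← div_le_iff₀ (biasTolerance_pos k), levelCap_eq L hη hρη]
  exact Nat.le_ceil _

theorem two_le_levelCap (hη : 0 < η) (hρη : ρ < η) (hηL₀ : 0 ≤ η * L) (hηL : η * L < 1) (k : ℕ) :
    2 ≤ levelCap L η ρ k := by
  have hμ : 1 ≤ ((1 - η * L) ^ 2)⁻¹ :=
    (one_le_inv₀ (pow_pos (by linarith) 2)).2 (pow_le_one₀ (by linarith) (by linarith))
  have hcap : 96 * ((1 - η * L) ^ 2)⁻¹ ≤ (levelCap L η ρ k : ℝ) * (1 / 120) :=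
    (le_levelCap_mul hη hρη k).trans
      (mul_le_mul_of_nonneg_left (biasTolerance_le k) (Nat.cast_nonneg _))
  exact_mod_cast (by linarith : (2 : ℝ) ≤ levelCap L η ρ k)

theorem one_le_logb_levelCap (hη : 0 < η) (hρη : ρ < η) (hηL₀ : 0 ≤ η * L) (hηL : η * L < 1)
    (k : ℕ) : 1 ≤ Real.logb 2 (levelCap L η ρ k) := by
  have hcap : (2 : ℝ) ≤ levelCap L η ρ k := mod_cast two_le_levelCap hη hρη hηL₀ hηL k
  rwa [Real.le_logb_iff_rpow_le one_lt_two (by linarith), Real.rpow_one]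

theorem batchSize_pos (hη : 0 < η) (hρη : ρ < η) (hηL₀ : 0 ≤ η * L) (hηL : η * L < 1) (k : ℕ) :
    0 < batchSize L η ρ k := by
  have hlog := one_le_logb_levelCap hη hρη hηL₀ hηL k
  exact Nat.ceil_pos.2 (div_pos (by positivity) (pow_pos (by linarith) 2))

theorem div_two_pow_log_levelCap_le (hη : 0 < η) (hρη : ρ < η) (k : ℕ) :
    12 * ((1 - η * L) ^ 2)⁻¹ / 2 ^ Nat.log 2 (levelCap L η ρ k) ≤ biasTolerance k / 4 := by
  have hcap : (levelCap L η ρ k : ℝ) ≤ 2 ^ Nat.log 2 (levelCap L η ρ k) * 2 := by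
    rw [← pow_succ]
    exact_mod_cast (Nat.lt_pow_succ_log_self one_lt_two _).le
  have hle := (le_levelCap_mul (L := L) hη hρη k).trans
    (mul_le_mul_of_nonneg_right hcap (biasTolerance_pos k).le)
  rw [div_le_iff₀ (by positivity)]
  linarith

theorem div_batchSize_le (hη : 0 < η) (hρη : ρ < η) (hηL₀ : 0 ≤ η * L) (hηL : η * L < 1) (k : ℕ) :
    (2 + 12 * (Nat.log 2 (levelCap L η ρ k) : ℝ)) * (12 * ((1 - η * L) ^ 2)⁻¹) /
      batchSize L η ρ k ≤ 1 / 480 := by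
  have hlog := one_le_logb_levelCap hη hρη hηL₀ hηL k
  have hbatch : 672 * 120 * Real.logb 2 (levelCap L η ρ k) / (1 - η * L) ^ 2 ≤
      batchSize L η ρ k := Nat.le_ceil _
  have hnat : (Nat.log 2 (levelCap L η ρ k) : ℝ) ≤ Real.logb 2 (levelCap L η ρ k) :=
    mod_cast Real.natLog_le_logb (levelCap L η ρ k) 2
  rw [div_le_iff₀ (mod_cast batchSize_pos hη hρη hηL₀ hηL k)]
  calc (2 + 12 * (Nat.log 2 (levelCap L η ρ k) : ℝ)) * (12 * ((1 - η * L) ^ 2)⁻¹)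
      ≤ (14 * Real.logb 2 (levelCap L η ρ k)) * (12 * ((1 - η * L) ^ 2)⁻¹) := by
        gcongr
        linarith
    _ = 1 / 480 * (672 * 120 * Real.logb 2 (levelCap L η ρ k) / (1 - η * L) ^ 2) := by ring
    _ ≤ 1 / 480 * batchSize L η ρ k := by gcongr

end StepSizes

/-! ### The estimate of the resolvent -/

section Estimate

variable {E : Type*} [NormedAddCommGroup E] [InnerProductSpace ℝ E] {Ξ Ω : Type*} {L : ℝ≥0}
  {η ρ σ : ℝ} {F : E → E} {G : E → Set E} {Ft : E → Ξ → E} {ξ : SeedIndex → Ω → Ξ}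
  {I : ℕ × ℕ → Ω → ℕ}

/-- The approximation `y ^ i` of the resolvent at `x` that copy `m` of the estimator of iteration
`k` would compute. -/
def levelPoint (L : ℝ≥0) (η : ℝ) (G : E → Set E) (Ft : E → Ξ → E) (ξ : SeedIndex → Ω → Ξ)
    (k m : ℕ) (x : E) (i : ℕ) (ω : Ω) : E :=
  (fbf (1 - η * L) (1 + η * L) (opSmul η G) (fun z s => z + η • Ft z s) x
    (fun t b => ξ ⟨k, m, i, t, b⟩ ω) (2 ^ i)).point

/-- Copy `m` of the multilevel estimator of iteration `k`, at the point `x`. -/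
def estimatorCopy (L : ℝ≥0) (η ρ : ℝ) (G : E → Set E) (Ft : E → Ξ → E) (ξ : SeedIndex → Ξ)
    (I : ℕ × ℕ → ℕ) (k m : ℕ) (x : E) : Run E :=
  mlmcFbf (1 - η * L) (1 + η * L) (opSmul η G) (fun z s => z + η • Ft z s) x
    (levelCap L η ρ k) (I (k, m)) (fun i t b => ξ ⟨k, m, i, t, b⟩)

theorem estimatorCopy_point (k m : ℕ) (x : E) (ω : Ω) :
    (estimatorCopy L η ρ G Ft (fun j => ξ j ω) (fun j => I j ω) k m x).point =
      multilevel (levelPoint L η G Ft ξ k m x) (I (k, m)) (levelCap L η ρ k) ω := by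
  rw [estimatorCopy, mlmcFbf, apply_ite Run.point]
  rfl

/-- The iteration and the copy of the estimator in which a draw is used. -/
def drawCopy : SeedIndex ⊕ (ℕ × ℕ) → ℕ × ℕ :=
  Sum.elim (fun j => (j.iter, j.copy)) id

namespace StochasticInclusion

variable [MeasurableSpace E] [MeasurableSpace Ξ] {ν : Measure Ξ}

theorem levelCap_ne_zero (h : StochasticInclusion L η σ F G Ft ν) (hρη : ρ < η) (k : ℕ) :
    levelCap L η ρ k ≠ 0 :=
  (two_pos.trans_le (two_le_levelCap h.pos hρη (mul_nonneg h.pos.le L.coe_nonneg) h.lt_one k)).ne'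

variable [CompleteSpace E] [SecondCountableTopology E] [BorelSpace E] [IsProbabilityMeasure ν]

theorem measurable_levelPoint (h : StochasticInclusion L η σ F G Ft ν) {_ : MeasurableSpace Ω}
    {k m i : ℕ} (hξ : ∀ t b, Measurable (ξ ⟨k, m, i, t, b⟩)) {X : Ω → E} (hX : Measurable X) :
    Measurable fun ω => levelPoint L η G Ft ξ k m (X ω) i ω :=
  h.fbfProblem.measurable_fbf (s := fun t b => ξ ⟨k, m, i, t, b⟩) hX fun t _ b => hξ t b

theorem measurable_estimatorCopy (h : StochasticInclusion L η σ F G Ft ν) {_ : MeasurableSpace Ω}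
    {k m : ℕ} (hξ : ∀ i t b, Measurable (ξ ⟨k, m, i, t, b⟩)) (hI : Measurable (I (k, m)))
    {X : Ω → E} (hX : Measurable X) : Measurable fun ω =>
      (estimatorCopy L η ρ G Ft (fun j => ξ j ω) (fun j => I j ω) k m (X ω)).point := by
  have hlevel : ∀ i, Measurable fun ω => levelPoint L η G Ft ξ k m (X ω) i ω := fun i =>
    h.measurable_levelPoint (hξ i) hX
  have hpair : Measurable fun p : ℕ × Ω =>
      multilevel (levelPoint L η G Ft ξ k m (X p.2)) (fun _ => p.1) (levelCap L η ρ k) p.2 := by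
    refine measurable_from_prod_countable_right fun i => ?_
    dsimp only [multilevel]
    split_ifs
    · exact (hlevel 0).add (((hlevel i).sub (hlevel (i - 1))).const_smul _)
    · exact hlevel 0
  simp only [estimatorCopy_point]
  exact hpair.comp (hI.prodMk measurable_id)

theorem measurable_estimate (h : StochasticInclusion L η σ F G Ft ν) {_ : MeasurableSpace Ω}
    {k : ℕ} (hξ : ∀ m i t b, Measurable (ξ ⟨k, m, i, t, b⟩)) (hI : ∀ m, Measurable (I (k, m)))
    {X : Ω → E} (hX : Measurable X) : Measurable fun ω =>
      (estimate L η ρ G Ft (fun j => ξ j ω) (fun j => I j ω) k (X ω)).point :=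
  (Finset.measurable_sum _ fun m _ =>
    h.measurable_estimatorCopy (hξ m) (hI m) hX).const_smul ((batchSize L η ρ k : ℝ)⁻¹)

theorem measurable_estimatorCopy_drawsSigma (h : StochasticInclusion L η σ F G Ft ν) (k m : ℕ)
    (x : E) : Measurable[drawsSigma ξ I {j | drawCopy j = (k, m)}] fun ω =>
      (estimatorCopy L η ρ G Ft (fun j => ξ j ω) (fun j => I j ω) k m x).point := by
  have hξ : ∀ i t b, Measurable[drawsSigma ξ I {j | drawCopy j = (k, m)}]
      (ξ ⟨k, m, i, t, b⟩) := fun _ _ _ => measurable_seed_drawsSigma rfl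
  have hI : Measurable[drawsSigma ξ I {j | drawCopy j = (k, m)}] (I (k, m)) :=
    measurable_level_drawsSigma rfl
  exact h.measurable_estimatorCopy hξ hI measurable_const

variable [MeasurableSpace Ω] {P : Measure Ω}

theorem indepFun_level_levelPoint_sub (h : StochasticInclusion L η σ F G Ft ν)
    (hS : IsSampling P ν ξ I) (k m : ℕ) (x : E) (i : ℕ) :
    IndepFun (I (k, m)) (fun ω => levelPoint L η G Ft ξ k m x (i + 1) ω -
      levelPoint L η G Ft ξ k m x i ω) P := by
  have hlevel : ∀ i, Measurable[drawsSigma ξ I (Set.range Sum.inl)]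
      (levelPoint L η G Ft ξ k m x i) := fun i =>
    h.measurable_levelPoint (X := fun _ => x)
      (fun t b => measurable_seed_drawsSigma (Set.mem_range_self _)) measurable_const
  refine hS.indepFun (S := {.inr (k, m)}) ?_ (measurable_level_drawsSigma rfl)
    ((hlevel (i + 1)).sub (hlevel i))
  simp

theorem indepFun_estimatorCopy (h : StochasticInclusion L η σ F G Ft ν)
    (hS : IsSampling P ν ξ I) (k : ℕ) {m n : ℕ} (hmn : m ≠ n) (x : E) :
    IndepFun
      (fun ω => (estimatorCopy L η ρ G Ft (fun j => ξ j ω) (fun j => I j ω) k m x).point)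
      (fun ω => (estimatorCopy L η ρ G Ft (fun j => ξ j ω) (fun j => I j ω) k n x).point) P :=
  hS.indepFun (Set.disjoint_left.2 fun _ hm hn => hmn (Prod.ext_iff.1 (hm.symm.trans hn)).2)
    (h.measurable_estimatorCopy_drawsSigma k m x) (h.measurable_estimatorCopy_drawsSigma k n x)

variable [IsProbabilityMeasure P]

theorem expectationLE_levelPoint (h : StochasticInclusion L η σ F G Ft ν)
    (hS : IsSampling P ν ξ I) (k m : ℕ) (x : E) (i : ℕ) :
    ExpectationLE P (fun ω => ‖levelPoint L η G Ft ξ k m x i ω -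
      resolventMap (opSmul η (opAdd F G)) x‖ ^ 2)
      (12 * ((1 - η * L) ^ 2)⁻¹ * (fpResidual η F G x ^ 2 + η ^ 2 * σ ^ 2) / 2 ^ i) := by
  have hinj : Function.Injective fun p : ℕ × Bool => SeedIndex.mk k m i p.1 p.2 := by
    rintro ⟨t, b⟩ ⟨t', b'⟩ heq
    simpa using heq
  have hfbf := h.expectationLE_fbf x (s := fun t b => ξ ⟨k, m, i, t, b⟩)
    (fun t b => hS.measurePreserving_seed _) (hS.indep_seed.precomp hinj)
    (Nat.one_le_two_pow (n := i))
  rwa [Nat.cast_pow, Nat.cast_ofNat] at hfbf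

theorem integrable_levelPoint (h : StochasticInclusion L η σ F G Ft ν)
    (hS : IsSampling P ν ξ I) (k m : ℕ) (x : E) (i : ℕ) :
    Integrable (levelPoint L η G Ft ξ k m x i) P :=
  integrable_of_integrable_norm_sub_sq
    (h.measurable_levelPoint (X := fun _ => x) (fun _ _ => hS.measurable_seed _)
      measurable_const).aestronglyMeasurable (h.expectationLE_levelPoint hS k m x i).1

theorem integrable_estimatorCopy (h : StochasticInclusion L η σ F G Ft ν)
    (hS : IsSampling P ν ξ I) (hρη : ρ < η) (k m : ℕ) (x : E) : Integrable (fun ω =>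
      (estimatorCopy L η ρ G Ft (fun j => ξ j ω) (fun j => I j ω) k m x).point) P := by
  simp only [estimatorCopy_point]
  exact integrable_multilevel (h.integrable_levelPoint hS k m x) (hS.measurable_level (k, m))
    (h.levelCap_ne_zero hρη k)

theorem norm_integral_estimatorCopy_sub_sq_le (h : StochasticInclusion L η σ F G Ft ν)
    (hS : IsSampling P ν ξ I) (hρη : ρ < η) (k m : ℕ) (x : E) :
    ‖∫ ω, (estimatorCopy L η ρ G Ft (fun j => ξ j ω) (fun j => I j ω) k m x).point ∂P -
      resolventMap (opSmul η (opAdd F G)) x‖ ^ 2 ≤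
      biasTolerance k / 4 * (fpResidual η F G x ^ 2 + η ^ 2 * σ ^ 2) := by
  simp only [estimatorCopy_point]
  rw [integral_multilevel (h.integrable_levelPoint hS k m x) (hS.measurable_level (k, m))
    (hS.law_level (k, m)) (h.indepFun_level_levelPoint_sub hS k m x) (h.levelCap_ne_zero hρη k)]
  refine (norm_integral_sub_sq_le (h.integrable_levelPoint hS k m x _)
    (h.expectationLE_levelPoint hS k m x _)).trans ?_
  rw [mul_div_right_comm]
  exact mul_le_mul_of_nonneg_right (div_two_pow_log_levelCap_le h.pos hρη k) (by positivity)

theorem expectationLE_estimatorCopy_sub_sq (h : StochasticInclusion L η σ F G Ft ν)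
    (hS : IsSampling P ν ξ I) (hρη : ρ < η) (k m : ℕ) (x : E) :
    ExpectationLE P (fun ω =>
      ‖(estimatorCopy L η ρ G Ft (fun j => ξ j ω) (fun j => I j ω) k m x).point -
        resolventMap (opSmul η (opAdd F G)) x‖ ^ 2)
      ((2 + 12 * Nat.log 2 (levelCap L η ρ k)) *
        (12 * ((1 - η * L) ^ 2)⁻¹ * (fpResidual η F G x ^ 2 + η ^ 2 * σ ^ 2))) := by
  simp only [estimatorCopy_point]
  exact expectationLE_multilevel_sub_sq
    (fun i => h.measurable_levelPoint (X := fun _ => x) (fun _ _ => hS.measurable_seed _)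
      measurable_const) (hS.measurable_level (k, m)) (hS.law_level (k, m))
    (h.indepFun_level_levelPoint_sub hS k m x) (h.expectationLE_levelPoint hS k m x)
    (h.levelCap_ne_zero hρη k)

theorem integrable_estimate (h : StochasticInclusion L η σ F G Ft ν)
    (hS : IsSampling P ν ξ I) (hρη : ρ < η) (k : ℕ) (x : E) : Integrable (fun ω =>
      (estimate L η ρ G Ft (fun j => ξ j ω) (fun j => I j ω) k x).point) P :=
  (integrable_finsetSum _ fun m _ => h.integrable_estimatorCopy hS hρη k m x).smul _

theorem norm_integral_estimate_sub_sq_le (h : StochasticInclusion L η σ F G Ft ν)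
    (hS : IsSampling P ν ξ I) (hρη : ρ < η) (k : ℕ) (x : E) :
    ‖∫ ω, (estimate L η ρ G Ft (fun j => ξ j ω) (fun j => I j ω) k x).point ∂P -
      resolventMap (opSmul η (opAdd F G)) x‖ ^ 2 ≤
      driftWeight k / 480 * (fpResidual η F G x ^ 2 + η ^ 2 * σ ^ 2) := by
  have hηL₀ : 0 ≤ η * L := mul_nonneg h.pos.le L.coe_nonneg
  have hbound : 0 ≤ driftWeight k / 480 * (fpResidual η F G x ^ 2 + η ^ 2 * σ ^ 2) :=
    mul_nonneg (div_nonneg (driftWeight_pos k).le (by norm_num)) (by positivity)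
  have hcopy : ∀ m, ‖∫ ω, (estimatorCopy L η ρ G Ft (fun j => ξ j ω) (fun j => I j ω) k m x).point
      ∂P - resolventMap (opSmul η (opAdd F G)) x‖ ≤
        √(driftWeight k / 480 * (fpResidual η F G x ^ 2 + η ^ 2 * σ ^ 2)) := fun m => by
    refine Real.le_sqrt_of_sq_le ((h.norm_integral_estimatorCopy_sub_sq_le hS hρη k m x).trans ?_)
    refine mul_le_mul_of_nonneg_right ?_ (by positivity)
    linarith [biasTolerance_le_driftWeight_div k]
  exact (Real.le_sqrt (norm_nonneg _) hbound).1 (norm_integral_average_sub_le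
    (h.integrable_estimatorCopy hS hρη k · x) hcopy (batchSize_pos h.pos hρη hηL₀ h.lt_one k))

theorem expectationLE_estimate_sub_sq (h : StochasticInclusion L η σ F G Ft ν)
    (hS : IsSampling P ν ξ I) (hρη : ρ < η) (k : ℕ) (x : E) :
    ExpectationLE P (fun ω =>
      ‖(estimate L η ρ G Ft (fun j => ξ j ω) (fun j => I j ω) k x).point -
        resolventMap (opSmul η (opAdd F G)) x‖ ^ 2)
      ((fpResidual η F G x ^ 2 + η ^ 2 * σ ^ 2) / 240) := by
  have hηL₀ : 0 ≤ η * L := mul_nonneg h.pos.le L.coe_nonneg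
  set S := fpResidual η F G x ^ 2 + η ^ 2 * σ ^ 2
  have hS₀ : 0 ≤ S := by positivity
  have hbias : ∀ m, ‖∫ ω, (estimatorCopy L η ρ G Ft (fun j => ξ j ω) (fun j => I j ω) k m x).point
      ∂P - resolventMap (opSmul η (opAdd F G)) x‖ ≤ √(1 / 480 * S) := fun m => by
    refine Real.le_sqrt_of_sq_le ((h.norm_integral_estimatorCopy_sub_sq_le hS hρη k m x).trans ?_)
    refine mul_le_mul_of_nonneg_right ?_ hS₀
    linarith [biasTolerance_le k]
  refine (expectationLE_norm_average_sub_sq (h.integrable_estimatorCopy hS hρη k · x)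
    (fun m n hmn => h.indepFun_estimatorCopy hS k hmn x) hbias
    (h.expectationLE_estimatorCopy_sub_sq hS hρη k · x)
    (batchSize_pos h.pos hρη hηL₀ h.lt_one k)).mono ?_
  rw [Real.sq_sqrt (by positivity), ← mul_assoc, mul_div_right_comm]
  linarith [mul_le_mul_of_nonneg_right (div_batchSize_le h.pos hρη hηL₀ h.lt_one k) hS₀]

end StochasticInclusion

end Estimate

/-! ### One iteration -/

section Step

variable {E : Type*} [NormedAddCommGroup E] [InnerProductSpace ℝ E]

theorem norm_sub_smul_sq_le {a α : ℝ} (ha : 0 ≤ a) (haα : a ≤ α) {v w : E}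
    (hvw : α * ‖v‖ ^ 2 ≤ ⟪v, w⟫) : ‖w - a • v‖ ^ 2 ≤ ‖w‖ ^ 2 - a * α * ‖v‖ ^ 2 := by
  have hinner := mul_le_mul_of_nonneg_left hvw ha
  have hsq : a * a * ‖v‖ ^ 2 ≤ a * α * ‖v‖ ^ 2 := by gcongr
  rw [norm_sub_sq_real, norm_smul, mul_pow, Real.norm_of_nonneg ha, inner_smul_right,
    real_inner_comm]
  linarith

theorem two_mul_inner_le_young {β : ℝ} (hβ : 0 < β) (a : ℝ) (u b : E) :
    2 * a * ⟪u, b⟫ ≤ β * ‖u‖ ^ 2 + a ^ 2 / β * ‖b‖ ^ 2 := by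
  have hsq : 0 ≤ ‖β • u - a • b‖ ^ 2 := sq_nonneg _
  rw [norm_sub_sq_real, norm_smul, norm_smul, mul_pow, mul_pow, Real.norm_eq_abs, sq_abs,
    Real.norm_eq_abs, sq_abs, inner_smul_left, inner_smul_right, conj_trivial] at hsq
  have hexpand : β * ‖u‖ ^ 2 + a ^ 2 / β * ‖b‖ ^ 2 - 2 * a * ⟪u, b⟫ =
      (β ^ 2 * ‖u‖ ^ 2 - 2 * (β * (a * ⟪u, b⟫)) + a ^ 2 * ‖b‖ ^ 2) / β := by
    field_simp
    ring
  exact sub_nonneg.1 (hexpand ▸ div_nonneg hsq hβ.le)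

variable [CompleteSpace E] [SecondCountableTopology E] [MeasurableSpace E] [BorelSpace E]
  {Ξ Ω : Type*} [MeasurableSpace Ξ] [MeasurableSpace Ω] {L : ℝ≥0} {η ρ σ : ℝ} {F : E → E}
  {G : E → Set E} {Ft : E → Ξ → E} {ν : Measure Ξ} [IsProbabilityMeasure ν] {P : Measure Ω}
  [IsProbabilityMeasure P] {ξ : SeedIndex → Ω → Ξ} {I : ℕ × ℕ → Ω → ℕ}

/-- The exact relaxed step `u` towards the resolvent decreases the distance to the solution; the
bias of the estimate only enters through `⟪u, bias⟫`, which Young's inequality with parameter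
`driftWeight k` turns into a summable relative growth. -/
theorem StochasticInclusion.expectationLE_step (h : StochasticInclusion L η σ F G Ft ν)
    (hS : IsSampling P ν ξ I) (hρη : ρ < η) {xs : E} (hW : WeakMVI ρ F G xs) (k : ℕ) (x : E) :
    ExpectationLE P (fun ω => ‖(1 - stepSize η ρ k) • x + stepSize η ρ k •
        (estimate L η ρ G Ft (fun j => ξ j ω) (fun j => I j ω) k x).point - xs‖ ^ 2)
      ((1 + driftWeight k) * ‖x - xs‖ ^ 2 -
        relax η ρ * stepSize η ρ k / 2 * fpResidual η F G x ^ 2 +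
        stepSize η ρ k ^ 2 * (η ^ 2 * σ ^ 2) / 160) := by
  set J := resolventMap (opSmul η (opAdd F G)) x
  set V := fun ω => (estimate L η ρ G Ft (fun j => ξ j ω) (fun j => I j ω) k x).point
  set a := stepSize η ρ k
  set β := driftWeight k
  set R := fpResidual η F G x
  set u := x - xs - a • (x - J)
  have hV : Integrable V P := h.integrable_estimate hS hρη k x
  have ha : 0 < a := stepSize_pos h.pos hρη k
  have haα : a ≤ relax η ρ := stepSize_le h.pos hρη k
  have hβ : 0 < β := driftWeight_pos k
  have hu : ‖u‖ ^ 2 ≤ ‖x - xs‖ ^ 2 - a * relax η ρ * R ^ 2 := norm_sub_smul_sq_le ha.le haα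
    (hW.relax_mul_norm_sub_sq_le h.pos
      (h.maximal.resolventMap_opAdd_mem h.lipschitz h.pos h.lt_one x))
  have hcross : 2 * a * ⟪u, ∫ ω, V ω ∂P - J⟫ ≤
      β * ‖u‖ ^ 2 + a ^ 2 * (R ^ 2 + η ^ 2 * σ ^ 2) / 480 := calc
    _ ≤ β * ‖u‖ ^ 2 + a ^ 2 / β * ‖∫ ω, V ω ∂P - J‖ ^ 2 := two_mul_inner_le_young hβ a u _
    _ ≤ β * ‖u‖ ^ 2 + a ^ 2 / β * (β / 480 * (R ^ 2 + η ^ 2 * σ ^ 2)) := by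
      gcongr
      exact h.norm_integral_estimate_sub_sq_le hS hρη k x
    _ = β * ‖u‖ ^ 2 + a ^ 2 * (R ^ 2 + η ^ 2 * σ ^ 2) / 480 := by field_simp
  have hstep := expectationLE_norm_add_smul_sq (hV.sub (integrable_const J))
    (h.expectationLE_estimate_sub_sq hS hρη k x) u a
  simp only [Pi.sub_apply, integral_sub_const hV] at hstep
  have hpoint : ∀ ω, (1 - a) • x + a • V ω - xs = u + a • (V ω - J) := fun ω => by module
  simp only [V] at hpoint
  simp only [hpoint]
  refine hstep.mono ?_
  have haR : a ^ 2 * R ^ 2 ≤ a * relax η ρ * R ^ 2 := by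
    rw [pow_two a]
    gcongr
  have hR : 0 ≤ a ^ 2 * R ^ 2 := by positivity
  have hβR : 0 ≤ β * (a * relax η ρ * R ^ 2) := mul_nonneg hβ.le (hR.trans haR)
  linarith [mul_le_mul_of_nonneg_left hu hβ.le]

end Step

/-! ### Summation of the one-step inequality -/

section Series

theorem sum_range_le_of_le_sub_succ {f g : ℕ → ℝ} (hfg : ∀ k, f k ≤ g k - g (k + 1))
    (hg : ∀ k, 0 ≤ g k) (n : ℕ) : ∑ k ∈ Finset.range n, f k ≤ g 0 :=
  calc ∑ k ∈ Finset.range n, f k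
      ≤ ∑ k ∈ Finset.range n, (g k - g (k + 1)) := Finset.sum_le_sum fun k _ => hfg k
    _ = g 0 - g n := Finset.sum_range_sub' g n
    _ ≤ g 0 := sub_le_self _ (hg n)

theorem one_div_sq_mul_le_of_sq_eq {p q : ℝ} (hp : 1 ≤ p) (hq : 0 < q) (hpq : q ^ 2 = p ^ 2 + 1) :
    1 / (p ^ 2 * q) ≤ 3 / p - 3 / q := by
  have hq2 : q ≤ 2 * p := by nlinarith
  have hpos : 0 < p := by linarith
  have hdiff : 3 / p - 3 / q = 3 / (p * q * (q + p)) := by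
    field_simp
    linarith
  rw [hdiff, div_le_div_iff₀ (by positivity) (by positivity)]
  nlinarith [mul_pos hpos hq]

theorem driftWeight_le_sub (k : ℕ) :
    driftWeight k ≤ 3 / √((k : ℝ) + 1) - 3 / √((k + 1 : ℕ) + 1 : ℝ) := by
  have hcast : ((k + 1 : ℕ) + 1 : ℝ) = k + 2 := by
    push_cast
    ring
  have hsq : √((k : ℝ) + 1) ^ 2 = k + 1 := Real.sq_sqrt (by positivity)
  rw [hcast]
  refine le_trans ?_ (one_div_sq_mul_le_of_sq_eq (Real.one_le_sqrt.2 (by linarith))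
    (Real.sqrt_pos.2 (by positivity)) ?_)
  · rw [hsq]
    exact one_div_le_one_div_of_le (by positivity) (mul_le_mul_of_nonneg_left
      (le_mul_of_one_le_right (Real.sqrt_nonneg _) (one_lt_log_add_three k).le) (by positivity))
  · rw [hsq, Real.sq_sqrt (by positivity)]
    ring

theorem sum_driftWeight_le (n : ℕ) : ∑ k ∈ Finset.range n, driftWeight k ≤ 3 :=
  (sum_range_le_of_le_sub_succ driftWeight_le_sub (fun _ => by positivity) n).trans (by simp)

theorem inv_le_log_sub_log (x : ℝ) (hx : 0 < x) :
    1 / (x + 1) ≤ Real.log (x + 1) - Real.log x := by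
  rw [← Real.log_div (by positivity) (by positivity)]
  refine le_trans (le_of_eq ?_) (Real.one_sub_inv_le_log_of_pos (by positivity))
  field_simp
  ring

theorem stepSize_sq_le_sub (η ρ : ℝ) (k : ℕ) : stepSize η ρ k ^ 2 ≤
    3 / 2 * relax η ρ ^ 2 / Real.log ((k : ℝ) + 2) -
      3 / 2 * relax η ρ ^ 2 / Real.log ((k + 1 : ℕ) + 2) := by
  have hk : (0 : ℝ) ≤ k := k.cast_nonneg
  have hcast : ((k + 1 : ℕ) + 2 : ℝ) = (k : ℝ) + 2 + 1 := by
    push_cast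
    ring
  have hlog := inv_le_log_sub_log ((k : ℝ) + 2) (by positivity)
  have hp : 0 < Real.log ((k : ℝ) + 2) := Real.log_pos (by linarith)
  have hpq : Real.log ((k : ℝ) + 2) ≤ Real.log ((k : ℝ) + 2 + 1) :=
    Real.log_le_log (by linarith) (by linarith)
  rw [hcast, stepSize, div_pow, mul_pow, Real.sq_sqrt (by positivity),
    show (k : ℝ) + 3 = k + 2 + 1 by ring]
  set p := Real.log ((k : ℝ) + 2)
  set q := Real.log ((k : ℝ) + 2 + 1)
  have hq : 0 < q := hp.trans_le hpq
  have hstep : 1 / (((k : ℝ) + 2) * q ^ 2) ≤ 3 / 2 * ((q - p) / (p * q)) := calc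
    1 / (((k : ℝ) + 2) * q ^ 2) ≤ 3 / 2 * (1 / ((k : ℝ) + 2 + 1)) / (p * q) := by
      rw [mul_one_div, div_div, div_le_div_iff₀ (by positivity) (by positivity)]
      nlinarith [mul_le_mul_of_nonneg_right hpq hq.le, mul_nonneg hk (sq_nonneg q), sq_nonneg q]
    _ ≤ 3 / 2 * (q - p) / (p * q) := by gcongr
    _ = 3 / 2 * ((q - p) / (p * q)) := by ring
  calc relax η ρ ^ 2 / (((k : ℝ) + 2) * q ^ 2)
      = relax η ρ ^ 2 * (1 / (((k : ℝ) + 2) * q ^ 2)) := by ring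
    _ ≤ relax η ρ ^ 2 * (3 / 2 * ((q - p) / (p * q))) := by gcongr
    _ = 3 / 2 * relax η ρ ^ 2 / p - 3 / 2 * relax η ρ ^ 2 / q := by
      field_simp

theorem sum_stepSize_sq_le (η ρ : ℝ) (n : ℕ) :
    ∑ k ∈ Finset.range n, stepSize η ρ k ^ 2 ≤ 3 * relax η ρ ^ 2 := by
  have hlog : ∀ k : ℕ, 0 < Real.log ((k : ℝ) + 2) := fun k =>
    Real.log_pos (by linarith [k.cast_nonneg (α := ℝ)])
  have htwo := Real.log_two_gt_d9
  refine (sum_range_le_of_le_sub_succ (stepSize_sq_le_sub η ρ)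
    (fun k => div_nonneg (by positivity) (hlog k).le) n).trans ?_
  rw [Nat.cast_zero, zero_add, div_le_iff₀ (by linarith)]
  nlinarith [sq_nonneg (relax η ρ)]

/-- A discrete Grönwall inequality with dissipation `r`. -/
theorem add_sum_le_exp_sum_mul {e r β c : ℕ → ℝ} (he : ∀ k, 0 ≤ e k) (hr : ∀ k, 0 ≤ r k)
    (hβ : ∀ k, 0 ≤ β k) (hc : ∀ k, 0 ≤ c k)
    (h : ∀ k, e (k + 1) ≤ (1 + β k) * e k - r k + c k) (n : ℕ) :
    e n + ∑ k ∈ Finset.range n, r k ≤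
      Real.exp (∑ k ∈ Finset.range n, β k) * (e 0 + ∑ k ∈ Finset.range n, c k) := by
  induction n with
  | zero => simp
  | succ n ih =>
    rw [Finset.sum_range_succ, Finset.sum_range_succ, Finset.sum_range_succ, Real.exp_add]
    set R := ∑ k ∈ Finset.range n, r k
    set B := ∑ k ∈ Finset.range n, β k
    set C := ∑ k ∈ Finset.range n, c k
    have hR : 0 ≤ R := Finset.sum_nonneg fun k _ => hr k
    have hB : 0 ≤ B := Finset.sum_nonneg fun k _ => hβ k
    have hexp : 1 ≤ Real.exp B * Real.exp (β n) :=
      one_le_mul_of_one_le_of_one_le (Real.one_le_exp hB) (Real.one_le_exp (hβ n))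
    calc e (n + 1) + (R + r n) ≤ (1 + β n) * e n + R + c n := by linarith [h n]
      _ ≤ (1 + β n) * (e n + R) + c n := by linarith [mul_nonneg (hβ n) hR]
      _ ≤ Real.exp (β n) * (e n + R) + c n := by
        gcongr
        · exact add_nonneg (he n) hR
        · linarith [Real.add_one_le_exp (β n)]
      _ ≤ Real.exp (β n) * (Real.exp B * (e 0 + C)) + Real.exp B * Real.exp (β n) * c n := by
        gcongr
        exact le_mul_of_one_le_left (hc n) hexp
      _ = Real.exp B * Real.exp (β n) * (e 0 + (C + c n)) := by ring

end Series

section UniformIndex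

theorem integrableOn_count_finset {α E : Type*} [MeasurableSpace α] [MeasurableSingletonClass α]
    [NormedAddCommGroup E] (s : Finset α) (g : α → E) :
    IntegrableOn g (s : Set α) Measure.count := by
  have : IsFiniteMeasure (Measure.count.restrict (s : Set α)) := ⟨by
    rw [Measure.restrict_apply_univ, Measure.count_apply_finset]
    exact ENNReal.natCast_lt_top _⟩
  have hon := IntegrableOn.finset (μ := Measure.count.restrict (s : Set α)) (s := s) (f := g)
  rwa [IntegrableOn, Measure.restrict_restrict s.measurableSet, Set.inter_self] at hon

theorem integrable_uniformOn_finset {α E : Type*} [MeasurableSpace α] [MeasurableSingletonClass α]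
    [NormedAddCommGroup E] (s : Finset α) (g : α → E) : Integrable g (uniformOn (s : Set α)) := by
  rcases s.eq_empty_or_nonempty with rfl | hs
  · simp [uniformOn]
  refine (integrableOn_count_finset s g).smul_measure ?_
  simpa using hs.ne_empty

theorem integral_uniformOn_finset {α E : Type*} [MeasurableSpace α] [MeasurableSingletonClass α]
    [NormedAddCommGroup E] [NormedSpace ℝ E] [CompleteSpace E] (s : Finset α) (g : α → E) :
    ∫ a, g a ∂uniformOn (s : Set α) = (s.card : ℝ)⁻¹ • ∑ a ∈ s, g a := by
  rw [uniformOn, ProbabilityTheory.cond, integral_smul_measure,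
    setIntegral_finset s (integrableOn_count_finset s g)]
  simp [Measure.real]

theorem expectationLE_withUniformIndex {Ω : Type*} [MeasurableSpace Ω] {P : Measure Ω}
    [IsProbabilityMeasure P] {f : ℕ × Ω → ℝ} (hm : ∀ k, Measurable fun ω => f (k, ω))
    (hi : ∀ k, Integrable (fun ω => f (k, ω)) P) {K : ℕ} {c : ℝ}
    (hc : (K : ℝ)⁻¹ * ∑ k ∈ Finset.range K, ∫ ω, f (k, ω) ∂P ≤ c) :
    ExpectationLE (withUniformIndex K P) f c := by
  have hrange : (Set.Iio K : Set ℕ) = (Finset.range K : Set ℕ) := by simp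
  have hfi : Integrable f (withUniformIndex K P) := by
    rw [withUniformIndex, hrange,
      integrable_prod_iff (measurable_from_prod_countable_right hm).aestronglyMeasurable]
    exact ⟨Filter.Eventually.of_forall hi, integrable_uniformOn_finset _ _⟩
  refine ⟨hfi, ?_⟩
  rw [withUniformIndex, hrange] at hfi ⊢
  rwa [integral_prod _ hfi, integral_uniformOn_finset, Finset.card_range]

end UniformIndex

/-! ### The outer iteration -/

section OuterIteration

theorem relax_div_le_stepSize {η ρ : ℝ} (hα : 0 ≤ relax η ρ) {k K : ℕ} (hk : k < K) :
    relax η ρ / (3 / 2 * √(K : ℝ) * Real.log ((K : ℝ) + 3)) ≤ stepSize η ρ k := by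
  have hcast : (k : ℝ) + 1 ≤ K := mod_cast hk
  have hK : (0 : ℝ) ≤ K := K.cast_nonneg
  have hsqrt : √((k : ℝ) + 2) ≤ 3 / 2 * √(K : ℝ) := by
    refine Real.sqrt_le_iff.2 ⟨by positivity, ?_⟩
    rw [mul_pow, Real.sq_sqrt hK]
    linarith [k.cast_nonneg (α := ℝ)]
  have hlog : Real.log ((k : ℝ) + 3) ≤ Real.log ((K : ℝ) + 3) :=
    Real.log_le_log (by positivity) (by linarith)
  have hpos := one_lt_log_add_three k
  exact div_le_div_of_nonneg_left hα (by positivity) (by gcongr)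

theorem exp_three_le : Real.exp 3 ≤ 64 / 3 :=
  calc Real.exp 3 = Real.exp 1 ^ 3 := by rw [← Real.exp_nat_mul]; norm_num
    _ ≤ 2.7182818286 ^ 3 := by gcongr; exact Real.exp_one_lt_d9.le
    _ ≤ 64 / 3 := by norm_num

/-- The constant of the rate for runs that start at distance at most `D` from the solution. -/
def rateConst (η ρ σ D : ℝ) : ℝ :=
  64 * (D ^ 2 + relax η ρ ^ 2 * (η ^ 2 * σ ^ 2)) / relax η ρ ^ 2

variable {E Ξ Ω : Type*} [NormedAddCommGroup E] [InnerProductSpace ℝ E] {L : ℝ≥0} {η ρ σ : ℝ}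
  {F : E → E} {G : E → Set E} {Ft : E → Ξ → E} {ξ : SeedIndex → Ω → Ξ} {I : ℕ × ℕ → Ω → ℕ}
  {x₀ xs : E}

/-- The draws of iteration `k`, padded to families indexed by all labels. -/
def iterDraws (ξ : SeedIndex → Ω → Ξ) (I : ℕ × ℕ → Ω → ℕ) (k : ℕ) (ω : Ω) :
    (SeedIndex → Ξ) × (ℕ × ℕ → ℕ) :=
  (fun j => ξ { j with iter := k } ω, fun j => I (k, j.2) ω)

theorem run_succ_point (k : ℕ) (ω : Ω) :
    (run L η ρ G Ft x₀ ξ I (k + 1) ω).point =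
      (1 - stepSize η ρ k) • (run L η ρ G Ft x₀ ξ I k ω).point + stepSize η ρ k •
        (estimate L η ρ G Ft (fun j => ξ j ω) (fun j => I j ω) k
          (run L η ρ G Ft x₀ ξ I k ω).point).point :=
  rfl

variable [MeasurableSpace Ξ]

theorem measurable_iterDraws_drawsSigma (k : ℕ) :
    Measurable[drawsSigma ξ I {j | (drawCopy j).1 = k}] (iterDraws ξ I k) := by
  let _ := drawsSigma ξ I {j | (drawCopy j).1 = k}
  exact Measurable.prodMk (measurable_pi_lambda _ fun _ => measurable_seed_drawsSigma rfl)
    (measurable_pi_lambda _ fun _ => measurable_level_drawsSigma rfl)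

namespace StochasticInclusion

variable [CompleteSpace E] [MeasurableSpace E] {ν : Measure Ξ}

theorem fpResidual_sq_le (h : StochasticInclusion L η σ F G Ft ν) (hρη : ρ < η)
    (hW : WeakMVI ρ F G xs) (x : E) :
    fpResidual η F G x ^ 2 ≤ (relax η ρ ^ 2)⁻¹ * ‖x - xs‖ ^ 2 := by
  have hα := relax_pos h.pos hρη
  have hle : relax η ρ * fpResidual η F G x ^ 2 ≤ fpResidual η F G x * ‖x - xs‖ :=
    (hW.relax_mul_norm_sub_sq_le h.pos
      (h.maximal.resolventMap_opAdd_mem h.lipschitz h.pos h.lt_one x)).trans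
      (real_inner_le_norm _ _)
  rw [inv_mul_eq_div, le_div_iff₀ (by positivity)]
  nlinarith [sq_nonneg (relax η ρ * fpResidual η F G x - ‖x - xs‖)]

variable [BorelSpace E]

theorem measurable_fpResidual (h : StochasticInclusion L η σ F G Ft ν) :
    Measurable (fpResidual η F G) :=
  (continuous_id.sub (h.maximal.continuous_resolventMap_opAdd h.lipschitz h.pos
    h.lt_one)).norm.measurable

variable [SecondCountableTopology E] [IsProbabilityMeasure ν]

theorem measurable_run_drawsSigma (h : StochasticInclusion L η σ F G Ft ν) (k : ℕ) :
    Measurable[drawsSigma ξ I {j | (drawCopy j).1 < k}]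
      fun ω => (run L η ρ G Ft x₀ ξ I k ω).point := by
  induction k with
  | zero => exact measurable_const
  | succ k ih =>
    have hX : Measurable[drawsSigma ξ I {j | (drawCopy j).1 < k + 1}]
        fun ω => (run L η ρ G Ft x₀ ξ I k ω).point :=
      ih.mono (drawsSigma_mono fun _ hj => Nat.lt_succ_of_lt hj) le_rfl
    have hξ : ∀ m i t b, Measurable[drawsSigma ξ I {j | (drawCopy j).1 < k + 1}]
        (ξ ⟨k, m, i, t, b⟩) := fun _ _ _ _ => measurable_seed_drawsSigma (Nat.lt_succ_self k)
    have hI : ∀ m, Measurable[drawsSigma ξ I {j | (drawCopy j).1 < k + 1}] (I (k, m)) := fun _ =>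
      measurable_level_drawsSigma (Nat.lt_succ_self k)
    simp only [run_succ_point]
    exact (hX.const_smul _).add ((h.measurable_estimate hξ hI hX).const_smul _)

theorem measurable_step (h : StochasticInclusion L η σ F G Ft ν) (k : ℕ) :
    Measurable fun q : E × (SeedIndex → Ξ) × (ℕ × ℕ → ℕ) => (1 - stepSize η ρ k) • q.1 +
      stepSize η ρ k • (estimate L η ρ G Ft q.2.1 q.2.2 k q.1).point :=
  (measurable_fst.const_smul _).add ((h.measurable_estimate
    (ξ := fun j (q : E × (SeedIndex → Ξ) × (ℕ × ℕ → ℕ)) => q.2.1 j) (I := fun j q => q.2.2 j)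
    (fun _ _ _ _ => (measurable_pi_apply _).comp (measurable_fst.comp measurable_snd))
    (fun _ => (measurable_pi_apply _).comp (measurable_snd.comp measurable_snd))
    measurable_fst).const_smul _)

variable [MeasurableSpace Ω] {P : Measure Ω}

theorem measurable_run (h : StochasticInclusion L η σ F G Ft ν) (hS : IsSampling P ν ξ I) (k : ℕ) :
    Measurable fun ω => (run L η ρ G Ft x₀ ξ I k ω).point :=
  (h.measurable_run_drawsSigma k).mono (hS.drawsSigma_le _) le_rfl

theorem integrable_fpResidual_sq (h : StochasticInclusion L η σ F G Ft ν)
    (hS : IsSampling P ν ξ I) (hρη : ρ < η) (hW : WeakMVI ρ F G xs) {k : ℕ}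
    (hk : Integrable (fun ω => ‖(run L η ρ G Ft x₀ ξ I k ω).point - xs‖ ^ 2) P) :
    Integrable (fun ω => fpResidual η F G (run L η ρ G Ft x₀ ξ I k ω).point ^ 2) P :=
  (hk.const_mul (relax η ρ ^ 2)⁻¹).mono'
    ((h.measurable_fpResidual.comp (h.measurable_run hS k)).pow_const 2).aestronglyMeasurable
    (.of_forall fun _ => (Real.norm_of_nonneg (sq_nonneg _)).trans_le (h.fpResidual_sq_le hρη hW _))

variable [IsProbabilityMeasure P]

theorem expectationLE_run_succ (h : StochasticInclusion L η σ F G Ft ν) (hS : IsSampling P ν ξ I)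
    (hρη : ρ < η) (hW : WeakMVI ρ F G xs) {k : ℕ}
    (hk : Integrable (fun ω => ‖(run L η ρ G Ft x₀ ξ I k ω).point - xs‖ ^ 2) P) :
    ExpectationLE P (fun ω => ‖(run L η ρ G Ft x₀ ξ I (k + 1) ω).point - xs‖ ^ 2)
      ((1 + driftWeight k) * ∫ ω, ‖(run L η ρ G Ft x₀ ξ I k ω).point - xs‖ ^ 2 ∂P -
        relax η ρ * stepSize η ρ k / 2 *
          ∫ ω, fpResidual η F G (run L η ρ G Ft x₀ ξ I k ω).point ^ 2 ∂P +
        stepSize η ρ k ^ 2 * (η ^ 2 * σ ^ 2) / 160) := by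
  have hindep : IndepFun (fun ω => (run L η ρ G Ft x₀ ξ I k ω).point) (iterDraws ξ I k) P :=
    hS.indepFun (Set.disjoint_left.2 fun _ hlt heq => hlt.ne heq)
      (h.measurable_run_drawsSigma k) (measurable_iterDraws_drawsSigma k)
  have hdist := hk.const_mul (1 + driftWeight k)
  have hres := (h.integrable_fpResidual_sq hS hρη hW hk).const_mul
    (relax η ρ * stepSize η ρ k / 2)
  refine ExpectationLE.of_indepFun (h := fun x y => ‖(1 - stepSize η ρ k) • x + stepSize η ρ k •
      (estimate L η ρ G Ft y.1 y.2 k x).point - xs‖ ^ 2) hindep (h.measurable_run hS k)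
    ((measurable_iterDraws_drawsSigma k).mono (hS.drawsSigma_le _) le_rfl)
    (((h.measurable_step k).sub_const xs).norm.pow_const 2) (fun _ _ => sq_nonneg _) ?_
    (h.expectationLE_step hS hρη hW k)
    ⟨(hdist.sub hres).add (integrable_const _), le_of_eq ?_⟩
  · have := h.measurable_fpResidual
    fun_prop
  · refine (integral_add (hdist.sub hres) (integrable_const _)).trans ?_
    rw [integral_sub' hdist hres, integral_const_mul, integral_const_mul, integral_const,
      probReal_univ, one_smul]

theorem integrable_run (h : StochasticInclusion L η σ F G Ft ν) (hS : IsSampling P ν ξ I)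
    (hρη : ρ < η) (hW : WeakMVI ρ F G xs) (k : ℕ) :
    Integrable (fun ω => ‖(run L η ρ G Ft x₀ ξ I k ω).point - xs‖ ^ 2) P := by
  induction k with
  | zero => exact integrable_const (‖x₀ - xs‖ ^ 2)
  | succ k ih => exact (h.expectationLE_run_succ hS hρη hW ih).1

theorem sum_fpResidual_sq_le (h : StochasticInclusion L η σ F G Ft ν) (hS : IsSampling P ν ξ I)
    (hρη : ρ < η) (hW : WeakMVI ρ F G xs) (K : ℕ) :
    ∑ k ∈ Finset.range K, relax η ρ * stepSize η ρ k / 2 *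
        ∫ ω, fpResidual η F G (run L η ρ G Ft x₀ ξ I k ω).point ^ 2 ∂P ≤
      Real.exp 3 * (‖x₀ - xs‖ ^ 2 + relax η ρ ^ 2 * (η ^ 2 * σ ^ 2)) := by
  have hgronwall := add_sum_le_exp_sum_mul
    (e := fun k => ∫ ω, ‖(run L η ρ G Ft x₀ ξ I k ω).point - xs‖ ^ 2 ∂P)
    (r := fun k => relax η ρ * stepSize η ρ k / 2 *
        ∫ ω, fpResidual η F G (run L η ρ G Ft x₀ ξ I k ω).point ^ 2 ∂P)
    (c := fun k => stepSize η ρ k ^ 2 * (η ^ 2 * σ ^ 2) / 160)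
    (fun k => integral_nonneg fun ω => sq_nonneg _)
    (fun k => mul_nonneg (div_nonneg (mul_nonneg (relax_pos h.pos hρη).le
      (stepSize_pos h.pos hρη k).le) zero_le_two) (integral_nonneg fun ω => sq_nonneg _))
    (fun k => (driftWeight_pos k).le) (fun k => by positivity)
    (fun k => (h.expectationLE_run_succ hS hρη hW (h.integrable_run hS hρη hW k)).2) K
  have hinit : ∫ ω, ‖(run L η ρ G Ft x₀ ξ I 0 ω).point - xs‖ ^ 2 ∂P = ‖x₀ - xs‖ ^ 2 :=
    (integral_const (‖x₀ - xs‖ ^ 2)).trans (by simp)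
  have hnoise : ∑ k ∈ Finset.range K, stepSize η ρ k ^ 2 * (η ^ 2 * σ ^ 2) / 160 ≤
      relax η ρ ^ 2 * (η ^ 2 * σ ^ 2) := by
    rw [← Finset.sum_div, ← Finset.sum_mul, div_le_iff₀ (by norm_num), mul_right_comm]
    refine mul_le_mul_of_nonneg_right ?_ (by positivity)
    linarith [sum_stepSize_sq_le η ρ K, sq_nonneg (relax η ρ)]
  refine (le_add_of_nonneg_left (integral_nonneg fun ω => sq_nonneg _)).trans
    (hgronwall.trans ?_)
  simp only [hinit]
  gcongr
  exact sum_driftWeight_le K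

theorem expectationLE_fpResidual_sq (h : StochasticInclusion L η σ F G Ft ν)
    (hS : IsSampling P ν ξ I) (hρη : ρ < η) (hW : WeakMVI ρ F G xs) {K : ℕ} (hK : 1 ≤ K) :
    ExpectationLE (withUniformIndex K P)
      (fun q => fpResidual η F G (xout L η ρ G Ft x₀ ξ I q) ^ 2)
      (64 * (‖x₀ - xs‖ ^ 2 + relax η ρ ^ 2 * (η ^ 2 * σ ^ 2)) * Real.log ((K : ℝ) + 3) /
        (relax η ρ ^ 2 * √(K : ℝ))) := by
  refine expectationLE_withUniformIndex
    (fun k => (h.measurable_fpResidual.comp (h.measurable_run hS k)).pow_const 2)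
    (fun k => h.integrable_fpResidual_sq hS hρη hW (h.integrable_run hS hρη hW k)) ?_
  have hα := relax_pos h.pos hρη
  have hlog := one_lt_log_add_three K
  have hKpos : (0 : ℝ) < K := mod_cast hK
  have hsum := h.sum_fpResidual_sq_le hS hρη hW (x₀ := x₀) K
  simp only [xout]
  set W := ‖x₀ - xs‖ ^ 2 + relax η ρ ^ 2 * (η ^ 2 * σ ^ 2)
  set r : ℕ → ℝ := fun k => ∫ ω, fpResidual η F G (run L η ρ G Ft x₀ ξ I k ω).point ^ 2 ∂P
  set q := 3 / 2 * √(K : ℝ) * Real.log ((K : ℝ) + 3)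
  have hlow : relax η ρ ^ 2 / (2 * q) * ∑ k ∈ Finset.range K, r k ≤ 64 / 3 * W := calc
    _ = ∑ k ∈ Finset.range K, relax η ρ * (relax η ρ / q) / 2 * r k := by
      rw [← Finset.mul_sum]
      ring
    _ ≤ ∑ k ∈ Finset.range K, relax η ρ * stepSize η ρ k / 2 * r k := by
      have : ∀ k, 0 ≤ r k := fun k => integral_nonneg fun ω => sq_nonneg _
      gcongr with k hk
      exact relax_div_le_stepSize hα.le (Finset.mem_range.1 hk)
    _ ≤ 64 / 3 * W := hsum.trans (by gcongr; exact exp_three_le)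
  calc (K : ℝ)⁻¹ * ∑ k ∈ Finset.range K, r k
      = 2 * q / (relax η ρ ^ 2 * K) *
          (relax η ρ ^ 2 / (2 * q) * ∑ k ∈ Finset.range K, r k) := by
        have hq : 0 < q := by positivity
        field_simp
    _ ≤ 2 * q / (relax η ρ ^ 2 * K) * (64 / 3 * W) := by gcongr
    _ = 64 * W * Real.log ((K : ℝ) + 3) / (relax η ρ ^ 2 * √(K : ℝ)) := by
        have hsq := Real.sq_sqrt hKpos.le
        simp only [q]
        field_simp
        linear_combination W * hsq

theorem expectationLE_fpResidual (h : StochasticInclusion L η σ F G Ft ν)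
    (hS : IsSampling P ν ξ I) (hρη : ρ < η) (hW : WeakMVI ρ F G xs) {D : ℝ} (hD : ‖x₀ - xs‖ ≤ D)
    {K : ℕ} (hK : 1 ≤ K) {δ : ℝ} (hδ : 0 < δ)
    (hle : rateConst η ρ σ D * Real.log ((K : ℝ) + 3) ≤ δ ^ 2 * √(K : ℝ)) :
    ExpectationLE (withUniformIndex K P)
      (fun q => fpResidual η F G (xout L η ρ G Ft x₀ ξ I q)) δ := by
  have := isProbabilityMeasure_uniformOn (Set.finite_Iio K) ⟨0, hK⟩
  have : IsProbabilityMeasure (withUniformIndex K P) := by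
    unfold withUniformIndex
    infer_instance
  have hrate : 64 * (‖x₀ - xs‖ ^ 2 + relax η ρ ^ 2 * (η ^ 2 * σ ^ 2)) * Real.log ((K : ℝ) + 3) /
      (relax η ρ ^ 2 * √(K : ℝ)) ≤ δ ^ 2 := by
    have hsqrt : 0 < √(K : ℝ) := Real.sqrt_pos.2 (mod_cast hK)
    have hlog := one_lt_log_add_three K
    rw [mul_div_mul_comm, ← mul_div_assoc, div_le_iff₀ hsqrt]
    refine le_trans ?_ hle
    unfold rateConst
    gcongr
  exact ((h.expectationLE_fpResidual_sq hS hρη hW hK).mono hrate).of_sq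
    (h.measurable_fpResidual.comp (measurable_from_prod_countable_right
      (h.measurable_run hS))).aestronglyMeasurable (fun _ => norm_nonneg _) hδ

end StochasticInclusion

end OuterIteration

/-! ### Expected cost -/

section CostConstants

/-- A bound for `log₂ N_k / log (k + 2)`. -/
def logLevelCapConst (L η : ℝ) : ℝ :=
  (Real.log (11520 * ((1 - η * L) ^ 2)⁻¹ + 1) / Real.log 2 + 3) / Real.log 2

/-- The constant in the bound for the expected number of calls per iteration: on average a copy of
the estimator takes at most `9 / 2 * log₂ N_k` steps with two oracle calls each, and there are at
most `(80640 / (1 - η L) ^ 2 + 1) * log₂ N_k` copies. -/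
def costConst (L η : ℝ) : ℝ :=
  9 * (80640 / (1 - η * L) ^ 2 + 1) * logLevelCapConst L η ^ 2

theorem costConst_nonneg (L η : ℝ) : 0 ≤ costConst L η := by
  unfold costConst
  positivity

theorem one_le_driftWeight_mul (k : ℕ) : 1 ≤ driftWeight k * ((k : ℝ) + 2) ^ 3 := by
  have hpos := one_lt_sqrt_mul_log k
  have hsqrt : √((k : ℝ) + 2) ≤ k + 2 :=
    Real.sqrt_le_self_iff.2 (Or.inr (by linarith [k.cast_nonneg (α := ℝ)]))
  have hlog : Real.log ((k : ℝ) + 3) ≤ k + 2 := by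
    linarith [Real.log_le_sub_one_of_pos (x := (k : ℝ) + 3) (by positivity)]
  rw [driftWeight, one_div_mul_eq_div, one_le_div (mul_pos (by positivity) (by linarith))]
  calc ((k : ℝ) + 1) * (√((k : ℝ) + 2) * Real.log ((k : ℝ) + 3))
      ≤ ((k : ℝ) + 2) * (((k : ℝ) + 2) * ((k : ℝ) + 2)) := by
        have := one_lt_log_add_three k
        gcongr
        norm_num
    _ = ((k : ℝ) + 2) ^ 3 := by ring

theorem one_le_biasTolerance_mul (k : ℕ) : 1 ≤ biasTolerance k * (120 * ((k : ℝ) + 2) ^ 3) := by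
  have hcube : (1 : ℝ) ≤ ((k : ℝ) + 2) ^ 3 :=
    one_le_pow₀ (by linarith [k.cast_nonneg (α := ℝ)])
  have := one_le_driftWeight_mul k
  rcases min_choice (driftWeight k / 120) (1 / 120) with h | h <;>
    rw [biasTolerance, h] <;> linarith

variable {L η ρ : ℝ}

theorem levelCap_le (hη : 0 < η) (hρη : ρ < η) (k : ℕ) :
    (levelCap L η ρ k : ℝ) ≤ (11520 * ((1 - η * L) ^ 2)⁻¹ + 1) * ((k : ℝ) + 2) ^ 3 := by
  have hcube : (1 : ℝ) ≤ ((k : ℝ) + 2) ^ 3 :=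
    one_le_pow₀ (by linarith [k.cast_nonneg (α := ℝ)])
  have hc : 0 ≤ 96 * ((1 - η * L) ^ 2)⁻¹ := by positivity
  have hdiv : 96 * ((1 - η * L) ^ 2)⁻¹ / biasTolerance k ≤
      96 * ((1 - η * L) ^ 2)⁻¹ * (120 * ((k : ℝ) + 2) ^ 3) := by
    rw [div_le_iff₀ (biasTolerance_pos k), mul_assoc, mul_comm (120 * _)]
    exact le_mul_of_one_le_right hc (one_le_biasTolerance_mul k)
  rw [levelCap_eq L hη hρη]
  linarith [Nat.ceil_lt_add_one (div_nonneg hc (biasTolerance_pos k).le)]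

theorem logb_levelCap_le (hη : 0 < η) (hρη : ρ < η) (hηL₀ : 0 ≤ η * L) (hηL : η * L < 1) (k : ℕ) :
    Real.logb 2 (levelCap L η ρ k) ≤ logLevelCapConst L η * Real.log ((k : ℝ) + 2) := by
  have hcap : 0 < levelCap L η ρ k := by linarith [two_le_levelCap hη hρη hηL₀ hηL k]
  have hlog : Real.log 2 ≤ Real.log ((k : ℝ) + 2) := Real.log_le_log two_pos (by simp)
  rw [logLevelCapConst, Real.logb, div_mul_eq_mul_div]
  gcongr
  set A := 11520 * ((1 - η * L) ^ 2)⁻¹ + 1 with _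
  have hA1 : 1 ≤ A := le_add_of_nonneg_left (by positivity)
  calc Real.log (levelCap L η ρ k) ≤ Real.log (A * ((k : ℝ) + 2) ^ 3) :=
        Real.log_le_log (mod_cast hcap) (levelCap_le hη hρη k)
    _ = Real.log A / Real.log 2 * Real.log 2 + 3 * Real.log ((k : ℝ) + 2) := by
        rw [Real.log_mul (by positivity) (by positivity), Real.log_pow,
          div_mul_cancel₀ _ (Real.log_pos one_lt_two).ne', Nat.cast_ofNat]
    _ ≤ Real.log A / Real.log 2 * Real.log ((k : ℝ) + 2) + 3 * Real.log ((k : ℝ) + 2) := by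
        have := Real.log_nonneg hA1
        gcongr
    _ = (Real.log A / Real.log 2 + 3) * Real.log ((k : ℝ) + 2) := (add_mul _ _ _).symm

theorem batchSize_le (hη : 0 < η) (hρη : ρ < η) (hηL₀ : 0 ≤ η * L) (hηL : η * L < 1) (k : ℕ) :
    (batchSize L η ρ k : ℝ) ≤
      (80640 / (1 - η * L) ^ 2 + 1) * Real.logb 2 (levelCap L η ρ k) := by
  have hlog := one_le_logb_levelCap hη hρη hηL₀ hηL k
  have h0 : 0 ≤ 672 * 120 * Real.logb 2 (levelCap L η ρ k) / (1 - η * L) ^ 2 := by positivity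
  refine (Nat.ceil_lt_add_one h0).le.trans ?_
  rw [add_mul, one_mul, div_mul_eq_mul_div]
  norm_num
  exact hlog

end CostConstants

section Calls

variable {Ω : Type*}

/-- The number of steps of the inner solver made by one copy of the multilevel estimator with
truncation level `N` and drawn level `i`. -/
def multilevelSteps (N i : ℕ) : ℕ :=
  if 2 ^ i ≤ N then 1 + 2 ^ i + 2 ^ (i - 1) else 1

theorem multilevelSteps_le {J : Ω → ℕ} {N : ℕ} (hN : N ≠ 0) (ω : Ω) :
    (multilevelSteps N (J ω) : ℝ) ≤ 3 + ∑ i ∈ Finset.range (Nat.log 2 N),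
      {ω | J ω = i + 1}.indicator (fun _ => 3 / 2 * (2 : ℝ) ^ (i + 1)) ω := by
  rw [sum_indicator_level J fun i _ => 3 / 2 * (2 : ℝ) ^ (i + 1)]
  simp only [multilevelSteps, ← Nat.le_log_iff_pow_le one_lt_two hN]
  rcases J ω with _ | j
  · norm_num
  · by_cases hj : j + 1 ≤ Nat.log 2 N
    · simp only [hj, Nat.le_add_left, and_self, if_true, Nat.add_sub_cancel, pow_succ]
      push_cast
      linarith
    · norm_num [hj]

theorem expectationLE_multilevelSteps [MeasurableSpace Ω] {P : Measure Ω}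
    [IsProbabilityMeasure P] {J : Ω → ℕ} (hJ : Measurable J)
    (hlaw : ∀ i : ℕ, P {ω | J ω = i + 1} = (1 / 2) ^ (i + 1)) {N : ℕ} (hN : N ≠ 0) :
    ExpectationLE P (fun ω => (multilevelSteps N (J ω) : ℝ)) (3 + 3 / 2 * Nat.log 2 N) := by
  have hlevel : ∀ i : ℕ, ExpectationLE P
      ({ω | J ω = i + 1}.indicator fun _ => 3 / 2 * (2 : ℝ) ^ (i + 1)) (3 / 2) := fun i => by
    have hmeas : MeasurableSet {ω | J ω = i + 1} := hJ (measurableSet_singleton (i + 1))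
    refine ⟨(integrable_const _).indicator hmeas, le_of_eq ?_⟩
    rw [integral_indicator_const _ hmeas, Measure.real, hlaw i, smul_eq_mul]
    simp only [one_div, ENNReal.toReal_pow, ENNReal.toReal_inv, ENNReal.toReal_ofNat, inv_pow]
    field_simp
  refine (((expectationLE_const 3).add (ExpectationLE.sum fun i _ => hlevel i)).mono
    (le_of_eq ?_)).of_nonneg_of_le ?_ (fun _ => Nat.cast_nonneg _) (multilevelSteps_le hN)
  · rw [Finset.sum_const, Finset.card_range, nsmul_eq_mul, mul_comm]
  · have : Measurable fun ω => (multilevelSteps N (J ω) : ℝ) :=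
      (measurable_of_countable fun i : ℕ => (multilevelSteps N i : ℝ)).comp hJ
    exact this.aestronglyMeasurable

end Calls

section RunCalls

variable {E Ξ Ω : Type*} [NormedAddCommGroup E] [InnerProductSpace ℝ E]

theorem fbf_calls (μ LB : ℝ) (A : E → Set E) (Bin : E → Ξ → E) (z₀ : E) (seed : ℕ → Bool → Ξ)
    (T : ℕ) : (fbf μ LB A Bin z₀ seed T).oracleCalls = 2 * T ∧
      (fbf μ LB A Bin z₀ seed T).resolventCalls = T := by
  induction T with
  | zero => exact ⟨rfl, rfl⟩
  | succ t ih => exact ⟨congrArg (· + 2) ih.1, congrArg (· + 1) ih.2⟩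

theorem mlmcFbf_calls (μ LB : ℝ) (A : E → Set E) (Bin : E → Ξ → E) (z₀ : E) (N i : ℕ)
    (seed : ℕ → ℕ → Bool → Ξ) :
    (mlmcFbf μ LB A Bin z₀ N i seed).oracleCalls = 2 * multilevelSteps N i ∧
      (mlmcFbf μ LB A Bin z₀ N i seed).resolventCalls = multilevelSteps N i := by
  unfold mlmcFbf multilevelSteps
  split_ifs <;> simp only [fbf_calls, pow_zero, mul_add, mul_one, and_self]

variable {L η ρ : ℝ} {G : E → Set E} {Ft : E → Ξ → E} {x₀ : E}

theorem estimate_calls (ξ : SeedIndex → Ξ) (I : ℕ × ℕ → ℕ) (k : ℕ) (x : E) :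
    (estimate L η ρ G Ft ξ I k x).oracleCalls = 2 * ∑ m ∈ Finset.range (batchSize L η ρ k),
        multilevelSteps (levelCap L η ρ k) (I (k, m)) ∧
      (estimate L η ρ G Ft ξ I k x).resolventCalls = ∑ m ∈ Finset.range (batchSize L η ρ k),
        multilevelSteps (levelCap L η ρ k) (I (k, m)) := by
  simp only [estimate, mlmcFbf_calls, Finset.mul_sum, and_self]

theorem run_calls (ξ : SeedIndex → Ω → Ξ) (I : ℕ × ℕ → Ω → ℕ) (K : ℕ) (ω : Ω) :
    (run L η ρ G Ft x₀ ξ I K ω).oracleCalls =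
        ∑ k ∈ Finset.range K, (iteration L η ρ G Ft x₀ ξ I k ω).oracleCalls ∧
      (run L η ρ G Ft x₀ ξ I K ω).resolventCalls =
        ∑ k ∈ Finset.range K, (iteration L η ρ G Ft x₀ ξ I k ω).resolventCalls := by
  induction K with
  | zero => exact ⟨rfl, rfl⟩
  | succ K ih =>
    rw [Finset.sum_range_succ, Finset.sum_range_succ, ← ih.1, ← ih.2]
    exact ⟨rfl, rfl⟩

theorem two_mul_batchSize_mul_le (hη : 0 < η) (hρη : ρ < η) (hηL₀ : 0 ≤ η * L) (hηL : η * L < 1)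
    (k : ℕ) :
    2 * (batchSize L η ρ k * (3 + 3 / 2 * (Nat.log 2 (levelCap L η ρ k) : ℝ))) ≤
      costConst L η * Real.log ((k : ℝ) + 2) ^ 2 := by
  have hone := one_le_logb_levelCap hη hρη hηL₀ hηL k
  have hbatch := batchSize_le hη hρη hηL₀ hηL k
  have hcap := logb_levelCap_le hη hρη hηL₀ hηL k
  have hsteps : 3 + 3 / 2 * (Nat.log 2 (levelCap L η ρ k) : ℝ) ≤
      9 / 2 * Real.logb 2 (levelCap L η ρ k) := by
    have : (Nat.log 2 (levelCap L η ρ k) : ℝ) ≤ Real.logb 2 (levelCap L η ρ k) :=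
      mod_cast Real.natLog_le_logb (levelCap L η ρ k) 2
    linarith
  set b := Real.logb 2 (levelCap L η ρ k)
  calc 2 * ((batchSize L η ρ k : ℝ) * (3 + 3 / 2 * (Nat.log 2 (levelCap L η ρ k) : ℝ)))
      ≤ 2 * (((80640 / (1 - η * L) ^ 2 + 1) * b) * (9 / 2 * b)) := by gcongr
    _ = 9 * (80640 / (1 - η * L) ^ 2 + 1) * b ^ 2 := by ring
    _ ≤ 9 * (80640 / (1 - η * L) ^ 2 + 1) *
        (logLevelCapConst L η * Real.log ((k : ℝ) + 2)) ^ 2 := by gcongr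
    _ = costConst L η * Real.log ((k : ℝ) + 2) ^ 2 := by rw [costConst]; ring

variable [MeasurableSpace Ω] {P : Measure Ω} [IsProbabilityMeasure P] [MeasurableSpace Ξ]
  {ν : Measure Ξ} {ξ : SeedIndex → Ω → Ξ} {I : ℕ × ℕ → Ω → ℕ}

theorem IsSampling.expectationLE_iteration_calls (hS : IsSampling P ν ξ I) (hη : 0 < η)
    (hρη : ρ < η) (hηL₀ : 0 ≤ η * L) (hηL : η * L < 1) (k : ℕ) :
    ExpectationLE P (fun ω => ((iteration L η ρ G Ft x₀ ξ I k ω).oracleCalls : ℝ))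
        (costConst L η * Real.log ((k : ℝ) + 2) ^ 2) ∧
      ExpectationLE P (fun ω => ((iteration L η ρ G Ft x₀ ξ I k ω).resolventCalls : ℝ))
        (costConst L η * Real.log ((k : ℝ) + 2) ^ 2) := by
  have hcap : levelCap L η ρ k ≠ 0 := by linarith [two_le_levelCap hη hρη hηL₀ hηL k]
  have hsum := ExpectationLE.sum (s := Finset.range (batchSize L η ρ k)) fun m _ =>
    expectationLE_multilevelSteps (hS.measurable_level (k, m)) (hS.law_level (k, m)) hcap
  rw [Finset.sum_const, Finset.card_range, nsmul_eq_mul] at hsum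
  have htotal := two_mul_batchSize_mul_le hη hρη hηL₀ hηL k
  have h0 : 0 ≤ batchSize L η ρ k * (3 + 3 / 2 * (Nat.log 2 (levelCap L η ρ k) : ℝ)) := by
    positivity
  simp only [iteration, estimate_calls]
  push_cast
  exact ⟨(hsum.const_mul zero_le_two).mono htotal, hsum.mono (by linarith)⟩

theorem IsSampling.expectationLE_run_calls (hS : IsSampling P ν ξ I) (hη : 0 < η)
    (hρη : ρ < η) (hηL₀ : 0 ≤ η * L) (hηL : η * L < 1) (K : ℕ) :
    ExpectationLE P (fun ω => ((run L η ρ G Ft x₀ ξ I K ω).oracleCalls : ℝ))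
        (costConst L η * (K * Real.log ((K : ℝ) + 1) ^ 2)) ∧
      ExpectationLE P (fun ω => ((run L η ρ G Ft x₀ ξ I K ω).resolventCalls : ℝ))
        (costConst L η * (K * Real.log ((K : ℝ) + 1) ^ 2)) := by
  have hle : ∀ k ∈ Finset.range K, Real.log ((k : ℝ) + 2) ^ 2 ≤ Real.log ((K : ℝ) + 1) ^ 2 := by
    intro k hk
    have hkK : (k : ℝ) + 1 ≤ K := mod_cast Finset.mem_range.1 hk
    have : 0 ≤ Real.log ((k : ℝ) + 2) :=
      Real.log_nonneg (by linarith [k.cast_nonneg (α := ℝ)])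
    gcongr ?_ ^ 2
    exact Real.log_le_log (by positivity) (by linarith)
  have hsum : ∑ k ∈ Finset.range K, costConst L η * Real.log ((k : ℝ) + 2) ^ 2 ≤
      costConst L η * (K * Real.log ((K : ℝ) + 1) ^ 2) := by
    rw [← Finset.mul_sum]
    refine mul_le_mul_of_nonneg_left ((Finset.sum_le_sum hle).trans_eq ?_) (costConst_nonneg L η)
    rw [Finset.sum_const, Finset.card_range, nsmul_eq_mul]
  have hcalls := hS.expectationLE_iteration_calls (G := G) (Ft := Ft) (x₀ := x₀) hη hρη hηL₀ hηL
  simp only [run_calls]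
  push_cast
  exact ⟨(ExpectationLE.sum fun k _ => (hcalls k).1).mono hsum,
    (ExpectationLE.sum fun k _ => (hcalls k).2).mono hsum⟩

end RunCalls

/-! ### Number of iterations -/

section IterationCount

/-- A number of iterations, for a problem of scale `s` and relative accuracy `1 / r`, with
`log (iterationCount s r) = O(1 + log r)`. The square of `1 + log r` absorbs the logarithmic factor
of the rate. -/
def iterationCount (s r : ℝ) : ℕ :=
  ⌈s ^ 4 * r ^ 4 * (1 + Real.log r) ^ 2⌉₊

variable {s r : ℝ}

theorem one_le_iterationCount_arg (hs : 1 ≤ s) (hr : 1 ≤ r) :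
    1 ≤ s ^ 4 * r ^ 4 * (1 + Real.log r) ^ 2 :=
  one_le_mul_of_one_le_of_one_le
    (one_le_mul_of_one_le_of_one_le (one_le_pow₀ hs) (one_le_pow₀ hr))
    (one_le_pow₀ (le_add_of_nonneg_right (Real.log_nonneg hr)))

theorem one_le_iterationCount (hs : 1 ≤ s) (hr : 1 ≤ r) : 1 ≤ iterationCount s r :=
  Nat.ceil_pos.2 (zero_lt_one.trans_le (one_le_iterationCount_arg hs hr))

theorem iterationCount_le (hs : 1 ≤ s) (hr : 1 ≤ r) :
    (iterationCount s r : ℝ) ≤ 2 * (s ^ 4 * r ^ 4 * (1 + Real.log r) ^ 2) :=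
  (Nat.ceil_le_two_mul (by linarith [one_le_iterationCount_arg hs hr]))

theorem log_iterationCount_add_three_le (hs : 1 ≤ s) (hr : 1 ≤ r) :
    Real.log ((iterationCount s r : ℝ) + 3) ≤ 10 * s * (1 + Real.log r) := by
  have hl : 0 ≤ Real.log r := Real.log_nonneg hr
  have harg : (iterationCount s r : ℝ) + 3 ≤ 5 * (s ^ 4 * r ^ 4 * (1 + Real.log r) ^ 2) := by
    linarith [iterationCount_le hs hr, one_le_iterationCount_arg hs hr]
  have h5 := Real.log_le_sub_one_of_pos (x := 5) (by norm_num)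
  have hlogs := Real.log_le_sub_one_of_pos (x := s) (by linarith)
  have hlogl := Real.log_le_sub_one_of_pos (x := 1 + Real.log r) (by linarith)
  calc Real.log ((iterationCount s r : ℝ) + 3)
      ≤ Real.log (5 * (s ^ 4 * r ^ 4 * (1 + Real.log r) ^ 2)) :=
        Real.log_le_log (by positivity) harg
    _ = Real.log 5 + (4 * Real.log s + 4 * Real.log r + 2 * Real.log (1 + Real.log r)) := by
        rw [Real.log_mul (by norm_num) (by positivity), Real.log_mul (by positivity)
          (by positivity), Real.log_mul (by positivity) (by positivity), Real.log_pow, Real.log_pow,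
          Real.log_pow]
        push_cast
        ring
    _ ≤ 4 * s + 6 * Real.log r := by linarith
    _ ≤ 10 * s * (1 + Real.log r) := by nlinarith [mul_nonneg (sub_nonneg.2 hs) hl]

theorem le_sqrt_iterationCount (s r : ℝ) :
    s ^ 2 * r ^ 2 * (1 + Real.log r) ≤ √(iterationCount s r : ℝ) := by
  refine Real.le_sqrt_of_sq_le ((le_of_eq ?_).trans (Nat.le_ceil _))
  ring

theorem mul_log_iterationCount_le {B ε : ℝ} (hB : 0 ≤ B) (hs : 10 * B ≤ s) (hs1 : 1 ≤ s)
    (hr : 1 ≤ r) (hεr : 1 ≤ ε * r) :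
    B * Real.log ((iterationCount s r : ℝ) + 3) ≤ ε ^ 2 * √(iterationCount s r : ℝ) := by
  have hl : 0 ≤ Real.log r := Real.log_nonneg hr
  calc B * Real.log ((iterationCount s r : ℝ) + 3)
      ≤ B * (10 * s * (1 + Real.log r)) := by
        gcongr
        exact log_iterationCount_add_three_le hs1 hr
    _ = 10 * B * (s * (1 + Real.log r)) := by ring
    _ ≤ s * (s * (1 + Real.log r)) := by gcongr
    _ ≤ (ε * r) ^ 2 * (s * (s * (1 + Real.log r))) :=
        le_mul_of_one_le_left (by positivity) (one_le_pow₀ hεr)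
    _ = ε ^ 2 * (s ^ 2 * r ^ 2 * (1 + Real.log r)) := by ring
    _ ≤ ε ^ 2 * √(iterationCount s r : ℝ) := by
        gcongr
        exact le_sqrt_iterationCount s r

theorem iterationCount_mul_log_sq_le (hs : 1 ≤ s) (hr : 1 ≤ r) :
    (iterationCount s r : ℝ) * Real.log ((iterationCount s r : ℝ) + 1) ^ 2 ≤
      200 * s ^ 6 * r ^ 4 * (1 + Real.log r) ^ 4 := by
  have h0 : 0 ≤ Real.log ((iterationCount s r : ℝ) + 1) :=
    Real.log_nonneg (le_add_of_nonneg_left (Nat.cast_nonneg _))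
  have hlog : Real.log ((iterationCount s r : ℝ) + 1) ≤ 10 * s * (1 + Real.log r) :=
    (Real.log_le_log (by positivity) (by linarith)).trans (log_iterationCount_add_three_le hs hr)
  calc (iterationCount s r : ℝ) * Real.log ((iterationCount s r : ℝ) + 1) ^ 2
      ≤ 2 * (s ^ 4 * r ^ 4 * (1 + Real.log r) ^ 2) * (10 * s * (1 + Real.log r)) ^ 2 := by
        gcongr
        exact iterationCount_le hs hr
    _ = 200 * s ^ 6 * r ^ 4 * (1 + Real.log r) ^ 4 := by ring

end IterationCount

/-! ### Total complexity -/

section TotalComplexity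

/-- The scale `s` for which `iterationCount s ε⁻¹` iterations make both the residual and its
multiple by `η⁻¹` at most `ε`. -/
def complexityScale (η ρ σ D : ℝ) : ℝ :=
  10 * (max 1 η⁻¹ ^ 2 * rateConst η ρ σ D) + 1

theorem rateConst_nonneg (η ρ σ D : ℝ) : 0 ≤ rateConst η ρ σ D := by
  unfold rateConst
  positivity

theorem one_le_complexityScale (η ρ σ D : ℝ) : 1 ≤ complexityScale η ρ σ D := by
  have := rateConst_nonneg η ρ σ D
  exact le_add_of_nonneg_left (by positivity)

theorem inv_mul_div_max_le {η ε : ℝ} (hε : 0 ≤ ε) :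
    η⁻¹ * (ε / max 1 η⁻¹) ≤ ε := by
  rw [← mul_div_assoc, mul_comm]
  exact div_le_of_le_mul₀ (by positivity) hε (by gcongr; exact le_max_right _ _)

theorem costConst_mul_iterationCount_le {L η s ε : ℝ} (hs : 1 ≤ s) (hε : 0 < ε) (hε1 : ε ≤ 1) :
    costConst L η * (iterationCount s ε⁻¹ * Real.log ((iterationCount s ε⁻¹ : ℝ) + 1) ^ 2) ≤
      costConst L η * (200 * s ^ 6) * ε⁻¹ ^ 4 * (1 + Real.log (1 / ε)) ^ 4 := by
  rw [one_div, mul_assoc, mul_assoc, ← mul_assoc (200 * s ^ 6)]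
  exact mul_le_mul_of_nonneg_left
    (iterationCount_mul_log_sq_le hs ((one_le_inv₀ hε).2 hε1)) (costConst_nonneg L η)

variable {E Ξ Ω : Type*} [NormedAddCommGroup E] [InnerProductSpace ℝ E] [CompleteSpace E]
  [SecondCountableTopology E] [MeasurableSpace E] [BorelSpace E] {L : ℝ≥0} {η ρ σ : ℝ}
  {F : E → E} {G : E → Set E} {x₀ xs : E} [MeasurableSpace Ξ] {ν : Measure Ξ}
  [IsProbabilityMeasure ν] {Ft : E → Ξ → E} [MeasurableSpace Ω] {P : Measure Ω}
  [IsProbabilityMeasure P] {ξ : SeedIndex → Ω → Ξ} {I : ℕ × ℕ → Ω → ℕ}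

theorem StochasticInclusion.expectationLE_fpResidual_iterationCount
    (h : StochasticInclusion L η σ F G Ft ν) (hS : IsSampling P ν ξ I) (hρη : ρ < η)
    (hW : WeakMVI ρ F G xs) {D : ℝ} (hD : ‖x₀ - xs‖ ≤ D) {ε : ℝ} (hε : 0 < ε) :
    ExpectationLE
      (withUniformIndex (iterationCount (complexityScale η ρ σ D) (max 1 ε⁻¹)) P)
      (fun q => fpResidual η F G (xout L η ρ G Ft x₀ ξ I q)) (ε / max 1 η⁻¹) := by
  have : 0 < max 1 η⁻¹ := zero_lt_one.trans_le (le_max_left _ _)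
  have hs := one_le_complexityScale η ρ σ D
  have hrate := rateConst_nonneg η ρ σ D
  have hεr : 1 ≤ ε * max 1 ε⁻¹ := by
    rw [← div_le_iff₀' hε, one_div]
    exact le_max_right _ _
  refine h.expectationLE_fpResidual hS hρη hW hD (one_le_iterationCount hs (le_max_left _ _))
    (by positivity) ?_
  rw [div_pow, div_mul_eq_mul_div, le_div_iff₀' (by positivity), ← mul_assoc]
  exact mul_log_iterationCount_le (by positivity) (le_add_of_nonneg_right zero_le_one) hs
    (le_max_left _ _) hεr

end TotalComplexity

end StochKM

end

theorem theoremC5_general (L : ℝ≥0) (η : ℝ) (hη : 0 < η) (hηL : η * L < 1) :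
    ∃ C : ℝ, ∀ ρ < η, ∀ σ D : ℝ, ∃ C' : ℝ, ∃ Kε : ℝ → ℕ,
    ∀ (E : Type*) [NormedAddCommGroup E] [InnerProductSpace ℝ E] [CompleteSpace E]
      [SecondCountableTopology E] [MeasurableSpace E] [BorelSpace E]
      (F : E → E) (G : E → Set E) (x₀ xs : E)
      (Ξ : Type*) [MeasurableSpace Ξ] (ν : Measure Ξ) [IsProbabilityMeasure ν] (Ft : E → Ξ → E)
      (Ω : Type*) [MeasurableSpace Ω] (P : Measure Ω) [IsProbabilityMeasure P]
      (ξ : SeedIndex → Ω → Ξ) (I : ℕ × ℕ → Ω → ℕ),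
    LipschitzWith L F → IsMaximalMonotone G → WeakMVI ρ F G xs →
    IsStochasticOracle Ft ν F σ → IsSampling P ν ξ I →
    (∀ x, ∃! y, y ∈ resolventValues (opSmul η (opAdd F G)) x) ∧
    (∀ c : ℝ, 0 < c → ∀ x, ∃! y, y ∈ resolventValues (opSmul c G) x) ∧
    (∀ K : ℕ, 1 ≤ K →
      ExpectationLE (withUniformIndex K P)
        (fun q => fpResidual η F G (xout L η ρ G Ft x₀ ξ I q) ^ 2)
        (64 * (‖x₀ - xs‖ ^ 2 + relax η ρ ^ 2 * (η ^ 2 * σ ^ 2)) * Real.log ((K : ℝ) + 3) /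
          (relax η ρ ^ 2 * √(K : ℝ)))) ∧
    (∀ k : ℕ,
      ExpectationLE P (fun ω => ((iteration L η ρ G Ft x₀ ξ I k ω).oracleCalls : ℝ))
        (C * Real.log ((k : ℝ) + 2) ^ 2) ∧
      ExpectationLE P (fun ω => ((iteration L η ρ G Ft x₀ ξ I k ω).resolventCalls : ℝ))
        (C * Real.log ((k : ℝ) + 2) ^ 2)) ∧
    (‖x₀ - xs‖ ≤ D → ∀ ε : ℝ, 0 < ε →
      1 ≤ Kε ε ∧
      ExpectationLE (withUniformIndex (Kε ε) P)
        (fun q => fpResidual η F G (xout L η ρ G Ft x₀ ξ I q)) ε ∧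
      ExpectationLE (withUniformIndex (Kε ε) P)
        (fun q => η⁻¹ * fpResidual η F G (xout L η ρ G Ft x₀ ξ I q)) ε ∧
      (ε ≤ 1 →
        ExpectationLE P (fun ω => ((run L η ρ G Ft x₀ ξ I (Kε ε) ω).oracleCalls : ℝ))
          (C' * ε⁻¹ ^ 4 * (1 + Real.log (1 / ε)) ^ 4) ∧
        ExpectationLE P (fun ω => ((run L η ρ G Ft x₀ ξ I (Kε ε) ω).resolventCalls : ℝ))
          (C' * ε⁻¹ ^ 4 * (1 + Real.log (1 / ε)) ^ 4))) := by
  refine ⟨costConst L η, fun ρ hρη σ D =>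
    ⟨costConst L η * (200 * complexityScale η ρ σ D ^ 6),
      fun ε => iterationCount (complexityScale η ρ σ D) (max 1 ε⁻¹), ?_⟩⟩
  intro E _ _ _ _ _ _ F G x₀ xs Ξ _ ν _ Ft Ω _ P _ ξ I hF hG hW hO hS
  have h : StochasticInclusion L η σ F G Ft ν := ⟨hF, hG, hO, hη, hηL⟩
  have hηL₀ : 0 ≤ η * (L : ℝ) := by positivity
  have hs := one_le_complexityScale η ρ σ D
  refine ⟨hG.existsUnique_mem_resolventValues_opAdd hF hη hηL,
    fun c hc => hG.existsUnique_mem_resolventValues hc,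
    fun K hK => h.expectationLE_fpResidual_sq hS hρη hW hK,
    hS.expectationLE_iteration_calls hη hρη hηL₀ hηL, fun hD ε hε => ?_⟩
  have hres := h.expectationLE_fpResidual_iterationCount hS hρη hW hD hε
  refine ⟨one_le_iterationCount hs (le_max_left _ _),
    hres.mono (div_le_self hε.le (le_max_left _ _)),
    (hres.const_mul (inv_pos.2 hη).le).mono (inv_mul_div_max_le hε.le), fun hε1 => ?_⟩
  simp only [max_eq_right ((one_le_inv₀ hε).2 hε1)]
  have hcost := costConst_mul_iterationCount_le (L := L) (η := η) hs hε hε1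
  have hrun := hS.expectationLE_run_calls (G := G) (Ft := Ft) (x₀ := x₀) hη hρη hηL₀ hηL
    (iterationCount (complexityScale η ρ σ D) ε⁻¹)
  exact ⟨hrun.1.mono hcost, hrun.2.mono hcost⟩

theorem theoremC5 (L : ℝ≥0) (η : ℝ) (hL : 0 < L) (hη : η < 1 / L) :
    -- constant of the cost per iteration: it depends on `η` and `L` only
    ∃ C : ℝ, ∀ ρ : ℝ, 0 < ρ → ρ < η → ∀ σ D : ℝ,
    -- constant and number of iterations of the total complexity: they depend on the parameters
    -- and on a bound `D` for the initial distance only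
    ∃ C' : ℝ, ∃ Kε : ℝ → ℕ,
    ∀ (d : ℕ) (F : EuclideanSpace ℝ (Fin d) → EuclideanSpace ℝ (Fin d))
      (G : EuclideanSpace ℝ (Fin d) → Set (EuclideanSpace ℝ (Fin d)))
      (x₀ xs : EuclideanSpace ℝ (Fin d))
      (Ξ : Type*) [MeasurableSpace Ξ] (ν : Measure Ξ) [IsProbabilityMeasure ν]
      (Ft : EuclideanSpace ℝ (Fin d) → Ξ → EuclideanSpace ℝ (Fin d))
      (Ω : Type*) [MeasurableSpace Ω] (P : Measure Ω) [IsProbabilityMeasure P]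
      (ξ : SeedIndex → Ω → Ξ) (I : ℕ × ℕ → Ω → ℕ),
    LipschitzWith L F → IsMaximalMonotone G →
    IsSolution F G xs → WeakMVI ρ F G xs →
    IsStochasticOracle Ft ν F σ → IsSampling P ν ξ I →
    -- the resolvents are everywhere defined and single-valued
    (∀ x, ∃! y, y ∈ resolventValues (opSmul η (opAdd F G)) x) ∧
    (∀ c : ℝ, 0 < c → ∀ x, ∃! y, y ∈ resolventValues (opSmul c G) x) ∧
    -- rate
    (∀ K : ℕ, 1 ≤ K →
      ExpectationLE (withUniformIndex K P) (fun q => fpResidual η F G (xout L η ρ G Ft x₀ ξ I q) ^ 2)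
        (64 * (‖x₀ - xs‖ ^ 2 + relax η ρ ^ 2 * (η ^ 2 * σ ^ 2)) * Real.log ((K : ℝ) + 3) /
          (relax η ρ ^ 2 * √(K : ℝ)))) ∧
    -- expected cost of iteration `k`
    (∀ k : ℕ,
      ExpectationLE P (fun ω => ((iteration L η ρ G Ft x₀ ξ I k ω).oracleCalls : ℝ))
        (C * Real.log ((k : ℝ) + 2) ^ 2) ∧
      ExpectationLE P (fun ω => ((iteration L η ρ G Ft x₀ ξ I k ω).resolventCalls : ℝ))
        (C * Real.log ((k : ℝ) + 2) ^ 2)) ∧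
    -- expected total complexity
    (‖x₀ - xs‖ ≤ D → ∀ ε : ℝ, 0 < ε →
      1 ≤ Kε ε ∧
      ExpectationLE (withUniformIndex (Kε ε) P) (fun q => fpResidual η F G (xout L η ρ G Ft x₀ ξ I q)) ε ∧
      ExpectationLE (withUniformIndex (Kε ε) P) (fun q => η⁻¹ * fpResidual η F G (xout L η ρ G Ft x₀ ξ I q)) ε ∧
      (ε ≤ 1 →
        ExpectationLE P (fun ω => ((run L η ρ G Ft x₀ ξ I (Kε ε) ω).oracleCalls : ℝ))
          (C' * ε⁻¹ ^ 4 * (1 + Real.log (1 / ε)) ^ 4) ∧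
        ExpectationLE P (fun ω => ((run L η ρ G Ft x₀ ξ I (Kε ε) ω).resolventCalls : ℝ))
          (C' * ε⁻¹ ^ 4 * (1 + Real.log (1 / ε)) ^ 4))) := by
  by_cases hη0 : 0 < η
  · have hηL : η * L < 1 := (lt_div_iff₀ (NNReal.coe_pos.2 hL)).1 hη
    exact (theoremC5_general L η hη0 hηL).imp fun C h ρ _ hρη σ D =>
      (h ρ hρη σ D).imp fun C' => Exists.imp fun Kε h d F G x₀ xs Ξ _ ν _ Ft Ω _ P _ ξ I hF hG _ =>
        h (EuclideanSpace ℝ (Fin d)) F G x₀ xs Ξ ν Ft Ω P ξ I hF hG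
  · exact ⟨0, fun ρ hρ hρη => absurd (hρ.trans hρη) hη0⟩
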